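/- **Setting.** Let $d,p,q\ge 0$ be integers and let $\{g_\theta:\theta\in\Theta\}$, $\Theta\subset\mathbb R^d$, be a family of nonnegative functions on $\mathbb R^p\times[0,\infty)^q$. Let $(Z_t)_{t\in\mathbb Z}$ be i.i.d. real random variables with $\mathbb E Z_0=0$, $\mathbb E Z_0^2=1$, and $\mathcal F_t=\sigma(Z_k;k\le t)$. Let $K\subset\Theta$ be compact and $\theta_0\in K$. Assume that the model $$X_t=\sigma_tZ_t,\qquad \sigma_t^2=g_{\theta_0}(X_{t-1},\dots,X_{t-p};\sigma_{t-1}^2,\dots,\sigma_{t-q}^2),\qquad t\in\mathbb Z,$$ with $\sigma_t\ge0$ and $\sigma_t$ $\mathcal F_{t-1}$-measurable, has a unique stationary ergodic solution $((X_t,\sigma_t))$. Assume that for each $x\in\mathbb R^p$ the map $(\theta,s)\mapsto g_\theta(x,s)$ is continuous on $K\times[0,\infty)^q$, and that for all $\theta\in K$ and $s\in[0,\infty)^q$ the map $x\mapsto g_\theta(x,s)$ is Borel. Put $\mathbf X_t=(X_t,\dots,X_{t-p+1})$ and $$\psi_{t}(\theta,u)=(g_\theta(\mathbf X_t,u),u_1,\dots,u_{q-1}),\qquad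 [\Phi_t(\mathbf s)](\theta)=\psi_t(\theta,\mathbf s(\theta)),\quad \mathbf s\in\mathbb C(K,[0,\infty)^q).$$ Let $\|\cdot\|_K$ be the supremum over $K$ of the Euclidean norm, $\Lambda(\phi)=\sup_{x\ne y}d(\phi(x),\phi(y))/d(x,y)$, and $\Phi_t^{(r)}=\Phi_t\circ\cdots\circ\Phi_{t-r+1}$. Fix $\varsigma\in[0,\infty)^q$ and put $\hat{\mathbf h}_0=\varsigma$ (a constant function on $K$), $\hat{\mathbf h}_{t+1}=\Phi_t(\hat{\mathbf h}_t)$ for $t\in\mathbb N$. Write $v_t\xrightarrow{\text{e.a.s.}}0$ if there is a constant $\gamma>1$ with $\gamma^t\|v_t\|\to0$ a.s. If a closed set $S$ is the closure of its interior, a function is called (twice) continuously differentiable on $S$ if it is continuous on $S$, (twice) continuously differentiable in the interior of $S$, and its partial derivatives of first (and second) order extend continuously to $S$; its derivatives on $S$ are these extensions. Write $\partial_j^k\psi_t$, $\partial_j^{k_1,k_2}\psi_t$ for the partial derivatives of the $j$-th component of $\psi_t$ with respect to the variables $(\theta,u)\in\mathbb R^{d+q}$. Write $\partial_j^k\mathbf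 h$, $\partial_j^{k_1,k_2}\mathbf h$ for those of $\mathbf h:K\to\mathbb R^q$ with respect to $\theta$, and $\mathbf h'\in\mathbb R^{dq}$, $\mathbf h''\in\mathbb R^{d^2q}$ for the vectors of all of them. **D.1.** $\mathbb E\log^+\|\Phi_0(\varsigma)\|_K<\infty$, $\mathbb E\log^+\Lambda(\Phi_0)<\infty$, and $\mathbb E\log\Lambda(\Phi_0^{(r)})<0$ for some $r\ge1$. The set $K$ is contained in the interior of $\Theta$ and equals the closure of its interior. For each $x\in\mathbb R^p$, $(\theta,s)\mapsto g_\theta(x,s)$ is continuously differentiable on $K\times[0,\infty)^q$. Let $(\mathbf h_t)_{t\in\mathbb Z}$ be the (under D.1 a.s. unique) stationary solution in $\mathbb C(K,[0,\infty)^q)$ of $\mathbf h_{t+1}=\Phi_t(\mathbf h_t)$, $t\in\mathbb Z$. **D.2.** For all $j\in\{1,\dots,q\}$ and $k\in\{1,\dots,d+q\}$, $\mathbb E\log^+\sup_{\theta\in K}|\partial_j^k\psi_0(\theta,\mathbf h_0(\theta))|<\infty$. Moreover, there are a stationary sequence $(\bar C_1(t))$ with $\mathbb E\log^+\bar C_1(0)<\infty$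 and $\kappa\in(0,1]$ such that, a.s., for all $t,j,k$ and all $u,\tilde u\in[0,\infty)^q$, $$\sup_{\theta\in K}|\partial_j^k\psi_t(\theta,u)-\partial_j^k\psi_t(\theta,\tilde u)|\le\bar C_1(t)|u-\tilde u|^\kappa.$$ **D.3.** For each $x\in\mathbb R^p$, $(\theta,s)\mapsto g_\theta(x,s)$ is twice continuously differentiable on $K\times[0,\infty)^q$. For all $j\in\{1,\dots,q\}$ and $k_1,k_2\in\{1,\dots,d+q\}$, $\mathbb E\log^+\sup_{\theta\in K}|\partial_j^{k_1,k_2}\psi_0(\theta,\mathbf h_0(\theta))|<\infty$. Also $\mathbb E\log^+\|\mathbf h_0'\|_K<\infty$ (under D.1 and D.2, $\mathbf h_t$ is a.s. continuously differentiable on $K$). Moreover, there are a stationary sequence $(\bar C_2(t))$ with $\mathbb E\log^+\bar C_2(0)<\infty$ and $\tilde\kappa\in(0,1]$ such that, a.s., for all $t,j,k_1,k_2$ and all $u,\tilde u\in[0,\infty)^q$, $$\sup_{\theta\in K}|\partial_j^{k_1,k_2}\psi_t(\theta,u)-\partial_j^{k_1,k_2}\psi_t(\theta,\tilde u)|\le\bar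 C_2(t)|u-\tilde u|^{\tilde\kappa}.$$ **Proposition.** Assume D.1–D.3. Then the functions $\hat{\mathbf h}_t$ are twice continuously differentiable on $K$, and the linear stochastic recurrence equation $\mathbf e_{t+1}=\ddot\Phi_t(\mathbf e_t)$ a.s., $t\in\mathbb Z$, in $\mathbb C(K,\mathbb R^{d^2q})$ with $$\begin{aligned}[][\ddot\Phi_t(\mathbf e)(\theta)]_{j,k_1,k_2}={}&\partial_j^{k_1,k_2}\psi_t+\sum_{i=1}^q\partial_j^{k_2,d+i}\psi_t\,\partial_i^{k_1}\mathbf h_t(\theta)\\&+\sum_{i=1}^q\Big(\partial_j^{k_1,d+i}\psi_t+\sum_{i'=1}^q\partial_j^{d+i',d+i}\psi_t\,\partial_{i'}^{k_1}\mathbf h_t(\theta)\Big)\partial_i^{k_2}\mathbf h_t(\theta)+\sum_{i=1}^q\partial_j^{d+i}\psi_t\,[\mathbf e(\theta)]_{i,k_1,k_2}\end{aligned}$$ (all derivatives of $\psi_t$ taken at $(\theta,\mathbf h_t(\theta))$; $1\le j\le q$, $1\le k_1,k_2\le d$) has a stationary solution $(\mathbf e_t)_{t\in\mathbb Z}$.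 This solution is ergodic, it is unique up to a.s. equality among stationary solutions, and it can be chosen such that $\mathbf e_t$ is $\mathcal F_{t-1}$-measurable for every $t\in\mathbb Z$. Moreover, $$\|\hat{\mathbf h}_t''-\mathbf e_t\|_K\xrightarrow{\text{e.a.s.}}0,\qquad t\to\infty,$$ and for every $t\in\mathbb Z$, a.s., $\mathbf h_t$ is twice continuously differentiable on $K$ with $\mathbf h_t''=\mathbf e_t$ on $K$. -/

import Mathlib

open MeasureTheory ProbabilityTheory Filter Topology Set
open scoped ENNReal

noncomputable section

namespace CHModel

/-! ### Spaces -/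

/-- `ℝⁿ` with the Euclidean norm. -/
abbrev E (n : ℕ) : Type := EuclideanSpace ℝ (Fin n)

/-- The closed orthant `[0, ∞)^q`, with the Euclidean distance. -/
def orthant (q : ℕ) : Set (E q) := {u | ∀ i, 0 ≤ u i}

/-- Spaces of continuous functions carry the Borel σ-field (of the uniform topology when the
domain is compact). -/
instance instMeasurableSpaceContinuousMap {α β : Type*} [TopologicalSpace α]
    [TopologicalSpace β] : MeasurableSpace C(α, β) := borel _

instance instBorelSpaceContinuousMap {α β : Type*} [TopologicalSpace α]
    [TopologicalSpace β] : BorelSpace C(α, β) := ⟨rfl⟩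

/-! ### Stationarity, ergodicity, logarithmic moments -/

/-- The shift on two-sided sequences. -/
def shift {S : Type*} (x : ℤ → S) : ℤ → S := fun t => x (t + 1)

/-- `(v_t)_{t ∈ ℤ}` is a (strictly) stationary sequence of random elements: its law on the
sequence space is invariant under the shift. -/
def IsStationarySeq {Ω S : Type*} [MeasurableSpace Ω] [MeasurableSpace S] (P : Measure Ω)
    (v : ℤ → Ω → S) : Prop :=
  (∀ t, Measurable (v t)) ∧
    MeasurePreserving (shift : (ℤ → S) → ℤ → S)
      (P.map fun ω t => v t ω) (P.map fun ω t => v t ω)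

/-- `(v_t)_{t ∈ ℤ}` is a stationary ergodic sequence of random elements: the shift is
measure-preserving and ergodic for its law on the sequence space. -/
def IsStationaryErgodicSeq {Ω S : Type*} [MeasurableSpace Ω] [MeasurableSpace S] (P : Measure Ω)
    (v : ℤ → Ω → S) : Prop :=
  (∀ t, Measurable (v t)) ∧
    Ergodic (shift : (ℤ → S) → ℤ → S) (P.map fun ω t => v t ω)

/-- `𝔼[log⁺ F]` for `F` with values in `[0, ∞]`. -/
def meanLogPlus {Ω : Type*} [MeasurableSpace Ω] (P : Measure Ω) (F : Ω → ℝ≥0∞) : ℝ≥0∞ :=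
  ∫⁻ ω, (ENNReal.log (F ω)).toENNReal ∂P

/-- `𝔼[log⁻ F]` for `F` with values in `[0, ∞]`; here `log⁻ 0 = ∞`. -/
def meanLogMinus {Ω : Type*} [MeasurableSpace Ω] (P : Measure Ω) (F : Ω → ℝ≥0∞) : ℝ≥0∞ :=
  ∫⁻ ω, (-ENNReal.log (F ω)).toENNReal ∂P

/-- `𝔼[log F] < 0`, where `𝔼[log F] = 𝔼[log⁺ F] - 𝔼[log⁻ F]` may be `-∞`. (The strict inequality
forces `𝔼[log⁺ F] < ∞`.) -/
def MeanLogNeg {Ω : Type*} [MeasurableSpace Ω] (P : Measure Ω) (F : Ω → ℝ≥0∞) : Prop :=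
  meanLogPlus P F < meanLogMinus P F

/-- The norm `‖f‖_K = sup_{θ ∈ K} |f(θ)|`, as an element of `[0, ∞]`. -/
def supNorm {κ V : Type*} [NormedAddCommGroup V] (f : κ → V) : ℝ≥0∞ := ⨆ θ, ‖f θ‖ₑ

/-- Exponentially fast a.s. convergence to zero of a sequence, given through its norms:
there is a (deterministic) `γ > 1` with `γ^t ‖v_t‖ → 0` a.s. -/
def TendstoZeroEAS {Ω : Type*} [MeasurableSpace Ω] (P : Measure Ω) (N : ℕ → Ω → ℝ≥0∞) : Prop :=
  ∃ γ : ℝ, 1 < γ ∧ ∀ᵐ ω ∂P, Tendsto (fun t => ENNReal.ofReal (γ ^ t) * N t ω) atTop (𝓝 0)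

/-- The Lipschitz coefficient `Λ(φ) = sup_{x ≠ y} d(φ x, φ y) / d(x, y) ∈ [0, ∞]`. -/
def lipCoeff {S : Type*} [MetricSpace S] (φ : S → S) : ℝ≥0∞ :=
  ⨆ (x : S) (y : S) (_ : x ≠ y), edist (φ x) (φ y) / edist x y

/-! ### Continuous differentiability on a closed set

A function on a closed set `S` which is the closure of its interior is `C¹` (resp. `C²`) on `S` if
it is continuous on `S`, is `C¹` (resp. `C²`) on the interior, and its partial derivatives up to
order one (resp. two) extend continuously to `S`. The derivatives on `S` are these
extensions. -/

section Deriv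

variable {V : Type*} [NormedAddCommGroup V] [NormedSpace ℝ V]

/-- Derivative of `f` in the direction `v` on the closed set `S`: the extension by limits of the
derivative in the interior. -/
def partial1 (S : Set V) (f : V → ℝ) (v : V) : V → ℝ :=
  extendFrom (interior S) fun x => fderiv ℝ f x v

/-- Second derivative `∂²f / ∂v∂w` on the closed set `S`. -/
def partial2 (S : Set V) (f : V → ℝ) (v w : V) : V → ℝ :=
  extendFrom (interior S) fun x => fderiv ℝ (fun y => fderiv ℝ f y w) x v

/-- `f` is continuously differentiable on the closed set `S`. -/
def IsC1On (S : Set V) (f : V → ℝ) : Prop :=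
  ContinuousOn f S ∧ ContDiffOn ℝ 1 f (interior S) ∧
    ∀ v, ∀ x ∈ S, ∃ l, Tendsto (fun y => fderiv ℝ f y v) (𝓝[interior S] x) (𝓝 l)

/-- `f` is twice continuously differentiable on the closed set `S`. -/
def IsC2On (S : Set V) (f : V → ℝ) : Prop :=
  IsC1On S f ∧ ContDiffOn ℝ 2 f (interior S) ∧
    ∀ v w, ∀ x ∈ S, ∃ l,
      Tendsto (fun z => fderiv ℝ (fun y => fderiv ℝ f y w) z v) (𝓝[interior S] x) (𝓝 l)

end Deriv

/-! ### The model -/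

/-- A parametric family `{g_θ : θ ∈ Θ}` of nonnegative functions on `ℝ^p × [0, ∞)^q`, with a compact
`K ⊆ Θ` on which `(θ, u) ↦ g_θ(x, u)` is continuous for every `x` and `x ↦ g_θ(x, u)` is Borel for
all `θ`, `u`. Values of `g` outside `Θ × ℝ^p × [0, ∞)^q` are irrelevant. -/
structure Family (d p q : ℕ) where
  Θ : Set (E d)
  K : TopologicalSpace.Compacts (E d)
  K_subset : (K : Set (E d)) ⊆ Θ
  g : E d → (Fin p → ℝ) → E q → ℝ
  g_nonneg : ∀ θ ∈ Θ, ∀ x, ∀ u ∈ orthant q, 0 ≤ g θ x u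
  g_meas : ∀ θ ∈ K, ∀ u ∈ orthant q, Measurable fun x => g θ x u
  g_cont : ∀ x, ContinuousOn (fun z : E d × E q => g z.1 x z.2) ((K : Set (E d)) ×ˢ orthant q)

/-- `(x_t, …, x_{t-n+1})`. -/
def lags {n : ℕ} (x : ℤ → ℝ) (t : ℤ) : Fin n → ℝ := fun i => x (t - (i : ℕ))

section Model

variable {d p q : ℕ}

/-- `C(K, [0, ∞)^q)`. -/
abbrev Family.H (M : Family d p q) : Type := C(M.K, orthant q)

/-- `K × [0, ∞)^q`, the domain of `(θ, u) ↦ g_θ(x, u)`. -/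
def Family.dom (M : Family d p q) : Set (E d × E q) := (M.K : Set (E d)) ×ˢ orthant q

/-- `(g_θ(x, u), u_1, …, u_{q-1})`. -/
def Family.step (M : Family d p q) (θ : E d) (x : Fin p → ℝ) (u : E q) : E q :=
  WithLp.toLp 2 fun j : Fin q =>
    if (j : ℕ) = 0 then M.g θ x u else u ⟨(j : ℕ) - 1, by omega⟩

theorem Family.step_mem (M : Family d p q) {θ : E d} (hθ : θ ∈ M.Θ) (x : Fin p → ℝ) {u : E q}
    (hu : u ∈ orthant q) : M.step θ x u ∈ orthant q := by
  intro j
  by_cases h : (j : ℕ) = 0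
  · simpa [Family.step, h] using M.g_nonneg θ hθ x u hu
  · simpa [Family.step, h] using hu _

theorem Family.continuous_step (M : Family d p q) (x : Fin p → ℝ) (s : M.H) :
    Continuous fun θ : M.K => M.step θ x (s θ) := by
  refine (PiLp.continuous_toLp 2 _).comp (continuous_pi fun j => ?_)
  by_cases h : (j : ℕ) = 0
  · simp only [h, if_true]
    exact (M.g_cont x).comp_continuous (f := fun θ : M.K => ((θ : E d), (s θ : E q)))
      (by fun_prop) fun θ => ⟨θ.2, (s θ).2⟩
  · simp only [h, if_false]
    fun_prop

/-- The map `Φ` on `C(K, [0, ∞)^q)` for observed lags `x`: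
`[Φ(s)](θ) = (g_θ(x, s(θ)), s_1(θ), …, s_{q-1}(θ))`. -/
def Family.Phi (M : Family d p q) (x : Fin p → ℝ) (s : M.H) : M.H where
  toFun θ := ⟨M.step θ x (s θ), M.step_mem (M.K_subset θ.2) x (s θ).2⟩
  continuous_toFun := (M.continuous_step x s).subtype_mk _

/-- `Φ_t^{(r)} = Φ_t ∘ Φ_{t-1} ∘ ⋯ ∘ Φ_{t-r+1}`, where `Φ_t` is `Φ` at the lags
`(x_t, …, x_{t-p+1})`. -/
def Family.PhiIter (M : Family d p q) (x : ℤ → ℝ) : ℕ → ℤ → M.H → M.H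
  | 0, _ => id
  | r + 1, t => M.Phi (lags x t) ∘ M.PhiIter x r (t - 1)

/-- `ĥ_0 = ς`, `ĥ_{t+1} = Φ_t(ĥ_t)`. -/
def Family.hHat (M : Family d p q) (x : ℤ → ℝ) (ς : orthant q) : ℕ → M.H
  | 0 => ContinuousMap.const _ ς
  | t + 1 => M.Phi (lags x (t : ℤ)) (M.hHat x ς t)

/-! ### Derivatives of the model functions -/

/-- The coordinate directions of `ℝ^d × ℝ^q`; `Sum.inl k` is the index `k` and `Sum.inr i` is the
index `d + i`. -/
def dir : Fin d ⊕ Fin q → E d × E q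
  | Sum.inl k => (EuclideanSpace.single k 1, 0)
  | Sum.inr i => (0, EuclideanSpace.single i 1)

/-- The `j`-th component of `ψ(θ, u) = (g_θ(x, u), u_1, …, u_{q-1})`. -/
def Family.psi (M : Family d p q) (x : Fin p → ℝ) (j : Fin q) (z : E d × E q) : ℝ :=
  M.step z.1 x z.2 j

/-- `∂_j^k ψ(θ, u)` on `K × [0, ∞)^q`. -/
def Family.dpsi (M : Family d p q) (x : Fin p → ℝ) (j : Fin q) (k : Fin d ⊕ Fin q) (θ : E d)
    (u : E q) : ℝ :=
  partial1 M.dom (M.psi x j) (dir k) (θ, u)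

/-- `∂_j^{k₁,k₂} ψ(θ, u)` on `K × [0, ∞)^q`. -/
def Family.ddpsi (M : Family d p q) (x : Fin p → ℝ) (j : Fin q) (k₁ k₂ : Fin d ⊕ Fin q)
    (θ : E d) (u : E q) : ℝ :=
  partial2 M.dom (M.psi x j) (dir k₁) (dir k₂) (θ, u)

/-- The `j`-th component of `s ∈ C(K, [0, ∞)^q)`, extended by zero to `ℝ^d`. -/
def Family.comp (M : Family d p q) (s : M.H) (j : Fin q) : E d → ℝ :=
  Function.extend (Subtype.val : M.K → E d) (fun θ => (s θ : E q) j) 0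

/-- `s` is twice continuously differentiable on `K`. -/
def Family.IsC2 (M : Family d p q) (s : M.H) : Prop :=
  ∀ j, IsC2On (M.K : Set (E d)) (M.comp s j)

/-- `∂_j^k s(θ)` for `θ ∈ K`. -/
def Family.D (M : Family d p q) (s : M.H) (j : Fin q) (k : Fin d) (θ : E d) : ℝ :=
  partial1 (M.K : Set (E d)) (M.comp s j) (EuclideanSpace.single k 1) θ

/-- The vector `s'(θ) ∈ ℝ^{dq}` of first partial derivatives. -/
def Family.D1 (M : Family d p q) (s : M.H) (θ : M.K) : EuclideanSpace ℝ (Fin q × Fin d) :=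
  WithLp.toLp 2 fun l => M.D s l.1 l.2 θ

/-- The vector `s''(θ) ∈ ℝ^{d²q}` of second partial derivatives; the coordinate `(j, k₁, k₂)` is
`∂_j^{k₁,k₂} s(θ)`. -/
def Family.D2 (M : Family d p q) (s : M.H) (θ : M.K) :
    EuclideanSpace ℝ (Fin q × Fin d × Fin d) :=
  WithLp.toLp 2 fun l => partial2 (M.K : Set (E d)) (M.comp s l.1)
    (EuclideanSpace.single l.2.1 1) (EuclideanSpace.single l.2.2 1) θ

/-- `C(K, ℝ^{d²q})`, with coordinates indexed by triples `(j, k₁, k₂)`. -/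
abbrev Family.H2 (M : Family d p q) : Type :=
  C(M.K, EuclideanSpace ℝ (Fin q × Fin d × Fin d))

/-- The affine map which formally differentiates `s ↦ Φ(s)` twice, at lags `x` and at the point
`s = h`:
`[Φ''(e)(θ)]_{j,k₁,k₂} = ∂_j^{k₁,k₂}ψ + ∑ᵢ ∂_j^{k₂,d+i}ψ ∂_i^{k₁}h
  + ∑ᵢ (∂_j^{k₁,d+i}ψ + ∑ᵢ' ∂_j^{d+i',d+i}ψ ∂_i'^{k₁}h) ∂_i^{k₂}h + ∑ᵢ ∂_j^{d+i}ψ e_{i,k₁,k₂}`,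
the derivatives of `ψ` being taken at `(θ, h(θ))` and those of `h` at `θ`. -/
def Family.ddPhi (M : Family d p q) (x : Fin p → ℝ) (h : M.H) (e : M.H2) (θ : M.K) :
    EuclideanSpace ℝ (Fin q × Fin d × Fin d) :=
  WithLp.toLp 2 fun l =>
    let j := l.1
    let k₁ := l.2.1
    let k₂ := l.2.2
    M.ddpsi x j (.inl k₁) (.inl k₂) θ (h θ)
      + ∑ i, M.ddpsi x j (.inl k₂) (.inr i) θ (h θ) * M.D h i k₁ θ
      + ∑ i, (M.ddpsi x j (.inl k₁) (.inr i) θ (h θ)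
          + ∑ i', M.ddpsi x j (.inr i') (.inr i) θ (h θ) * M.D h i' k₁ θ) * M.D h i k₂ θ
      + ∑ i, M.dpsi x j (.inr i) θ (h θ) * e θ (i, k₁, k₂)

/-! ### Processes and conditions -/

variable {Ω : Type*} [MeasurableSpace Ω]

/-- `(Z_t)` is i.i.d. with mean zero and unit variance. -/
structure IsInnovation (P : Measure Ω) (Z : ℤ → Ω → ℝ) : Prop where
  meas : ∀ t, Measurable (Z t)
  indep : iIndepFun Z P
  ident : ∀ t, IdentDistrib (Z t) (Z 0) P P
  mean : ∫ ω, Z 0 ω ∂P = 0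
  var : ∫ ω, Z 0 ω ^ 2 ∂P = 1

/-- `𝓕_t = σ(Z_k : k ≤ t)`. -/
abbrev past (Z : ℤ → Ω → ℝ) (t : ℤ) : MeasurableSpace Ω :=
  ⨆ k : {k : ℤ // k ≤ t}, MeasurableSpace.comap (Z k) inferInstance

/-- `((X_t, σ_t))` is a stationary ergodic solution of
`X_t = σ_t Z_t`, `σ_t² = g_θ(X_{t-1}, …, X_{t-p}, σ²_{t-1}, …, σ²_{t-q})`, with `σ_t ≥ 0`
and `σ_t` measurable with respect to `𝓕_{t-1}`. -/
structure IsModelSolution (P : Measure Ω) (M : Family d p q) (θ : E d) (Z X σ : ℤ → Ω → ℝ) :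
    Prop where
  stat : IsStationaryErgodicSeq P fun t ω => (X t ω, σ t ω)
  nonneg : ∀ t, ∀ᵐ ω ∂P, 0 ≤ σ t ω
  adapted : ∀ t, Measurable[past Z (t - 1)] (σ t)
  eq_X : ∀ t, ∀ᵐ ω ∂P, X t ω = σ t ω * Z t ω
  eq_σ : ∀ t, ∀ᵐ ω ∂P, σ t ω ^ 2 =
    M.g θ (lags (fun s => X s ω) (t - 1))
      (WithLp.toLp 2 (lags (fun s => σ s ω ^ 2) (t - 1)))

/-- `((X_t, σ_t))` is the unique stationary ergodic solution of the model. -/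
def IsUniqueModelSolution (P : Measure Ω) (M : Family d p q) (θ : E d) (Z X σ : ℤ → Ω → ℝ) :
    Prop :=
  IsModelSolution P M θ Z X σ ∧
    ∀ X' σ' : ℤ → Ω → ℝ, IsModelSolution P M θ Z X' σ' →
      ∀ t, ∀ᵐ ω ∂P, X' t ω = X t ω ∧ σ' t ω = σ t ω

/-- `(h_t)` is a stationary solution, in `C(K, [0, ∞)^q)`, of `h_{t+1} = Φ_t(h_t)`, `t ∈ ℤ`. -/
def IsStationarySolution (P : Measure Ω) (M : Family d p q) (X : ℤ → Ω → ℝ)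
    (h : ℤ → Ω → M.H) : Prop :=
  IsStationarySeq P h ∧
    ∀ t, ∀ᵐ ω ∂P, h (t + 1) ω = M.Phi (lags (fun s => X s ω) t) (h t ω)

/-- `(e_t)` solves the linear stochastic recurrence equation in `C(K, ℝ^{d²q})` for the second
derivatives. -/
def IsSecondOrderSolution (P : Measure Ω) (M : Family d p q) (X : ℤ → Ω → ℝ)
    (h : ℤ → Ω → M.H) (e : ℤ → Ω → M.H2) : Prop :=
  ∀ t, ∀ᵐ ω ∂P, ∀ θ : M.K,
    e (t + 1) ω θ = M.ddPhi (lags (fun s => X s ω) t) (h t ω) (e t ω) θ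

/-- Contractivity on average of `(Φ_t)`, and the regularity of `K` and of first order of `g`. -/
structure CondD1 (P : Measure Ω) (M : Family d p q) (X : ℤ → Ω → ℝ) (ς : orthant q) : Prop where
  moment : meanLogPlus P
    (fun ω => supNorm fun θ : M.K =>
      ((M.Phi (lags (fun s => X s ω) 0) (ContinuousMap.const _ ς) θ : orthant q) : E q)) < ∞
  lip : meanLogPlus P (fun ω => lipCoeff (M.Phi (lags (fun s => X s ω) 0))) < ∞
  contr : ∃ r : ℕ, 1 ≤ r ∧
    MeanLogNeg P fun ω => lipCoeff (M.PhiIter (fun s => X s ω) r 0)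
  K_sub : (M.K : Set (E d)) ⊆ interior M.Θ
  K_reg : closure (interior (M.K : Set (E d))) = M.K
  smooth : ∀ x, IsC1On M.dom fun z => M.g z.1 x z.2

/-- Moment and Hölder conditions for the first derivatives of `ψ_t`. -/
structure CondD2 (P : Measure Ω) (M : Family d p q) (X : ℤ → Ω → ℝ) (h : ℤ → Ω → M.H) :
    Prop where
  moment : ∀ (j : Fin q) (k : Fin d ⊕ Fin q), meanLogPlus P
    (fun ω => supNorm fun θ : M.K =>
      M.dpsi (lags (fun s => X s ω) 0) j k θ (h 0 ω θ)) < ∞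
  holder : ∃ (C : ℤ → Ω → ℝ) (κ : ℝ), IsStationarySeq P C ∧
    meanLogPlus P (fun ω => ENNReal.ofReal (C 0 ω)) < ∞ ∧ 0 < κ ∧ κ ≤ 1 ∧
    ∀ t, ∀ᵐ ω ∂P, ∀ (j : Fin q) (k : Fin d ⊕ Fin q), ∀ u ∈ orthant q, ∀ u' ∈ orthant q,
      ∀ θ ∈ M.K, |M.dpsi (lags (fun s => X s ω) t) j k θ u
        - M.dpsi (lags (fun s => X s ω) t) j k θ u'| ≤ C t ω * ‖u - u'‖ ^ κ

/-- Second-order regularity of `g`, moment and Hölder conditions for the second derivatives of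
`ψ_t`, and the moment condition on the first derivatives of `h_0`. -/
structure CondD3 (P : Measure Ω) (M : Family d p q) (X : ℤ → Ω → ℝ) (h : ℤ → Ω → M.H) :
    Prop where
  smooth : ∀ x, IsC2On M.dom fun z => M.g z.1 x z.2
  moment : ∀ (j : Fin q) (k₁ k₂ : Fin d ⊕ Fin q), meanLogPlus P
    (fun ω => supNorm fun θ : M.K =>
      M.ddpsi (lags (fun s => X s ω) 0) j k₁ k₂ θ (h 0 ω θ)) < ∞
  moment_deriv : meanLogPlus P (fun ω => supNorm (M.D1 (h 0 ω))) < ∞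
  holder : ∃ (C : ℤ → Ω → ℝ) (κ : ℝ), IsStationarySeq P C ∧
    meanLogPlus P (fun ω => ENNReal.ofReal (C 0 ω)) < ∞ ∧ 0 < κ ∧ κ ≤ 1 ∧
    ∀ t, ∀ᵐ ω ∂P, ∀ (j : Fin q) (k₁ k₂ : Fin d ⊕ Fin q), ∀ u ∈ orthant q, ∀ u' ∈ orthant q,
      ∀ θ ∈ M.K, |M.ddpsi (lags (fun s => X s ω) t) j k₁ k₂ θ u
        - M.ddpsi (lags (fun s => X s ω) t) j k₁ k₂ θ u'| ≤ C t ω * ‖u - u'‖ ^ κ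

end Model

end CHModel

end

open CHModel

noncomputable section

namespace CHModel

/-! ### Continuously differentiable functions on closed sets -/

section Calculus

variable {V W U : Type*} [NormedAddCommGroup V] [NormedSpace ℝ V] [NormedAddCommGroup W]
  [NormedSpace ℝ W] [NormedAddCommGroup U] [NormedSpace ℝ U]

/-! The probabilistic assumptions are first turned into deterministic properties of a typical path,
and the rest is analysis along one path. On a good path (`GoodPath`) the Lipschitz coefficients of
the n-step maps started at time a decay like exp(-cn), up to a factor exp(ε|a|) for every ε > 0
(`ExpBd`), and all other random coefficients grow subexponentially in time (`Tempered`).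
Subexponential factors cost only an arbitrarily small part of an exponential rate.

The equation for the second derivatives is affine, and its linear part is the Jacobian of ψ_t in the
state variable. A product of such Jacobians along a trajectory is the derivative of the iterated map
in its initial state. Testing the iterated map on constant functions bounds this product by the
Lipschitz coefficient of the iterate (`Family.norm_jac_trajD_le`). So the contraction of Φ_t is
inherited by the derivative recursions of both orders, and their backward iterates converge to
tempered orbits (`exists_tempered_orbit`).

The derivatives of ĥ satisfy the same affine recursions with coefficients evaluated at ĥ instead of
h. Since ‖ĥ - h‖ decays exponentially, the Hölder conditions make the difference of the coefficients
decay exponentially too, and variation of constants transfers this to the derivatives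
(`GoodPath.perturbation`), first for order one and then for order two. Applied to recursions started
at ever earlier times, this gives uniform convergence of C² functions to h_t together with both
derivatives, so h_t is C² and its second derivative is the limit (`GoodPath.exists_second`).

That almost every path is good rests on Borel–Cantelli for logarithmic moments (`ae_tempered`) and
on a one-sided ergodic bound obtained from maximal Birkhoff sums (`ae_bddAbove_birkhoffSum`),
applied to a truncated logarithm of the r-step Lipschitz coefficient (`ae_expBd_of_meanLogNeg`). The
limit is a measurable function of the past observations, which gives ergodicity and adaptedness.
Uniqueness follows because a stationary sequence is tight, while the difference of two solutions is
multiplied by coefficients tending to zero (`ae_nonpos_of_tight`). -/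

/-- `f` is continuously differentiable on `S` with derivative `f'`, the latter being the continuous
extension to `S` of the derivative in the interior. -/
structure HasC1 (S : Set V) (f : V → W) (f' : V → V →L[ℝ] W) : Prop where
  cont : ContinuousOn f S
  cont' : ContinuousOn f' S
  deriv : ∀ x ∈ interior S, HasFDerivAt f (f' x) x

theorem HasC1.congr {S : Set V} {f g : V → W} {f' g' : V → V →L[ℝ] W} (hf : HasC1 S f f')
    (h : EqOn g f S) (h' : EqOn g' f' S) : HasC1 S g g' where
  cont := hf.cont.congr h
  cont' := hf.cont'.congr h'
  deriv x hx := by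
    rw [h' (interior_subset hx)]
    refine (hf.deriv x hx).congr_of_eventuallyEq ?_
    filter_upwards [isOpen_interior.mem_nhds hx] with y hy using h (interior_subset hy)

theorem HasC1.clm_comp {S : Set V} {f : V → W} {f' : V → V →L[ℝ] W} (hf : HasC1 S f f')
    (L : W →L[ℝ] U) : HasC1 S (fun x => L (f x)) (fun x => L.comp (f' x)) where
  cont := L.continuous.comp_continuousOn hf.cont
  cont' := (ContinuousLinearMap.compL ℝ V W U L).continuous.comp_continuousOn hf.cont'
  deriv x hx := L.hasFDerivAt.comp x (hf.deriv x hx)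

theorem hasC1_clm (S : Set V) (L : V →L[ℝ] W) : HasC1 S (fun x => L x) (fun _ => L) where
  cont := L.continuous.continuousOn
  cont' := continuousOn_const
  deriv _ _ := L.hasFDerivAt

theorem hasC1_const (S : Set V) (c : W) : HasC1 S (fun _ => c) (fun _ => (0 : V →L[ℝ] W)) where
  cont := continuousOn_const
  cont' := continuousOn_const
  deriv _ _ := hasFDerivAt_const _ _

theorem HasC1.prodMk {S : Set V} {f : V → W} {f' : V → V →L[ℝ] W} {g : V → U}
    {g' : V → V →L[ℝ] U} (hf : HasC1 S f f') (hg : HasC1 S g g') :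
    HasC1 S (fun x => (f x, g x)) (fun x => (f' x).prod (g' x)) where
  cont := hf.cont.prodMk hg.cont
  cont' := (ContinuousLinearMap.prodₗᵢ ℝ).continuous.comp_continuousOn (hf.cont'.prodMk hg.cont')
  deriv x hx := (hf.deriv x hx).prodMk (hg.deriv x hx)

/-- Product rule for the composition of operator-valued functions. -/
theorem HasC1.comp_clm {S : Set V} {X Y Z : Type*} [NormedAddCommGroup X] [NormedSpace ℝ X]
    [NormedAddCommGroup Y] [NormedSpace ℝ Y] [NormedAddCommGroup Z] [NormedSpace ℝ Z]
    {A : V → Y →L[ℝ] Z} {A' : V → V →L[ℝ] Y →L[ℝ] Z} {B : V → X →L[ℝ] Y}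
    {B' : V → V →L[ℝ] X →L[ℝ] Y} (hA : HasC1 S A A') (hB : HasC1 S B B') :
    HasC1 S (fun x => (A x).comp (B x)) (fun x =>
      (ContinuousLinearMap.compL ℝ X Y Z (A x)).comp (B' x) +
        ((ContinuousLinearMap.compL ℝ X Y Z).flip (B x)).comp (A' x)) where
  cont := hA.cont.clm_comp hB.cont
  cont' := by
    refine ContinuousOn.add ?_ ?_
    · exact ((ContinuousLinearMap.continuous _).comp_continuousOn hA.cont).clm_comp hB.cont'
    · exact ((ContinuousLinearMap.continuous _).comp_continuousOn hB.cont).clm_comp hA.cont'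
  deriv x hx := (hA.deriv x hx).clm_comp (hB.deriv x hx)

/-- Chain rule on closed sets: the inner function may take values on the boundary of the convex
factor `C` of the domain of the outer function. -/
theorem HasC1.comp {V₁ V₂ : Type*} [NormedAddCommGroup V₁] [NormedSpace ℝ V₁]
    [NormedAddCommGroup V₂] [NormedSpace ℝ V₂] {S : Set V} {K : Set V₁} {C : Set V₂}
    (hC : Convex ℝ C) (hCc : IsClosed C) (hCi : C ⊆ closure (interior C))
    {F : V₁ × V₂ → W} {F' : V₁ × V₂ → V₁ × V₂ →L[ℝ] W} (hF : HasC1 (K ×ˢ C) F F')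
    {s : V → V₁ × V₂} {s' : V → V →L[ℝ] V₁ × V₂} (hs : HasC1 S s s')
    (hmap : MapsTo s S (K ×ˢ C)) (hint : ∀ x ∈ interior S, (s x).1 ∈ interior K) :
    HasC1 S (fun x => F (s x)) (fun x => (F' (s x)).comp (s' x)) where
  cont := hF.cont.comp hs.cont hmap
  cont' := (hF.cont'.comp hs.cont hmap).clm_comp hs.cont'
  deriv x hx := by
    obtain ⟨ε, hε, hball⟩ := Metric.nhds_basis_closedBall.mem_iff.1
      (isOpen_interior.mem_nhds (hint x hx))
    -- The point `s x` may lie on the boundary of `C`, where no two-sided derivative of `F` is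
    -- available. On the convex open set `U` the derivative of `F` exists and has the limit `F' (s
    -- x)` at `s x`, so `F` is differentiable there within `closure U`.
    set U := Metric.ball (s x).1 ε ×ˢ interior C with hU
    have hUo : IsOpen U := Metric.isOpen_ball.prod isOpen_interior
    have hUint : U ⊆ interior (K ×ˢ C) := by
      rw [interior_prod_eq]
      exact prod_mono (Metric.ball_subset_closedBall.trans hball) subset_rfl
    have hUcl : closure U ⊆ K ×ˢ C := by
      rw [hU, closure_prod_eq]
      refine prod_mono ((closure_minimal Metric.ball_subset_closedBall
        Metric.isClosed_closedBall).trans (hball.trans interior_subset)) ?_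
      exact closure_minimal interior_subset hCc
    have hsx : s x ∈ K ×ˢ C := hmap (interior_subset hx)
    have key : HasFDerivWithinAt F (F' (s x)) (closure U) (s x) := by
      refine hasFDerivWithinAt_closure_of_tendsto_fderiv (fun y hy =>
        (hF.deriv y (hUint hy)).differentiableAt.differentiableWithinAt)
        ((convex_ball _ _).prod hC.interior) hUo
        (fun y hy => ((hF.cont y (hUcl hy)).mono (subset_closure.trans hUcl))) ?_
      have h1 : Tendsto F' (𝓝[U] (s x)) (𝓝 (F' (s x))) :=
        (hF.cont' _ hsx).mono_left (nhdsWithin_mono _ (subset_closure.trans hUcl))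
      refine h1.congr' ?_
      filter_upwards [self_mem_nhdsWithin] with y hy using (hF.deriv y (hUint hy)).fderiv.symm
    -- All values of `s` near `x` stay in `closure U`, so a derivative of `F` within that set
    -- already yields a full derivative of the composition at `x`.
    have hev : ∀ᶠ y in 𝓝 x, s y ∈ closure U := by
      have hc : ContinuousAt (fun y => (s y).1) x :=
        (continuous_fst.continuousAt).comp (hs.deriv x hx).continuousAt
      filter_upwards [isOpen_interior.mem_nhds hx, hc (Metric.ball_mem_nhds _ hε)] with y hy hy2
      rw [hU, closure_prod_eq]
      exact ⟨subset_closure hy2, hCi (hmap (interior_subset hy)).2⟩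
    exact (key.comp (t := closure U) (s := {y | s y ∈ closure U}) x
      (hs.deriv x hx).hasFDerivWithinAt (fun y hy => hy)).hasFDerivAt hev

/-- Limits of continuously differentiable functions, with uniform convergence of the derivatives. -/
theorem HasC1.of_tendstoUniformlyOn {S : Set V} {f : ℕ → V → W} {f' : ℕ → V → V →L[ℝ] W}
    {g : V → W} {g' : V → V →L[ℝ] W} (h : ∀ n, HasC1 S (f n) (f' n))
    (hg : TendstoUniformlyOn f g atTop S) (hg' : TendstoUniformlyOn f' g' atTop S) :
    HasC1 S g g' where
  cont := hg.continuousOn (Frequently.of_forall fun n => (h n).cont)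
  cont' := hg'.continuousOn (Frequently.of_forall fun n => (h n).cont')
  deriv x hx := by
    refine hasFDerivAt_of_tendstoUniformlyOn isOpen_interior (hg'.mono interior_subset)
      (fun n y hy => (h n).deriv y hy) (fun y hy => hg.tendsto_at (interior_subset hy)) hx

theorem HasC1.tendsto {S : Set V} {f : V → W} {f' : V → V →L[ℝ] W} (hf : HasC1 S f f') {x : V}
    (hx : x ∈ S) : Tendsto (fderiv ℝ f) (𝓝[interior S] x) (𝓝 (f' x)) := by
  refine Tendsto.congr' ?_ ((hf.cont' x hx).mono_left (nhdsWithin_mono _ interior_subset))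
  filter_upwards [self_mem_nhdsWithin] with y hy using (hf.deriv y hy).fderiv.symm

theorem HasC1.tendsto_apply {S : Set V} {f : V → W} {f' : V → V →L[ℝ] W} (hf : HasC1 S f f')
    {x : V} (hx : x ∈ S) (v : V) :
    Tendsto (fun y => fderiv ℝ f y v) (𝓝[interior S] x) (𝓝 (f' x v)) :=
  ((ContinuousLinearMap.apply ℝ W v).continuous.tendsto _).comp (hf.tendsto hx)

theorem HasC1.contDiffOn {S : Set V} {f : V → W} {f' : V → V →L[ℝ] W} (hf : HasC1 S f f') :
    ContDiffOn ℝ 1 f (interior S) := by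
  rw [show (1 : WithTop ℕ∞) = 0 + 1 from rfl, contDiffOn_succ_iff_fderiv_of_isOpen isOpen_interior]
  refine ⟨fun y hy => (hf.deriv y hy).differentiableAt.differentiableWithinAt, by simp, ?_⟩
  rw [contDiffOn_zero]
  exact (hf.cont'.mono interior_subset).congr fun y hy => (hf.deriv y hy).fderiv

theorem HasC1.contDiffOn_two {S : Set V} {f : V → W} {f' : V → V →L[ℝ] W}
    {f'' : V → V →L[ℝ] V →L[ℝ] W} (hf : HasC1 S f f') (hf' : HasC1 S f' f'') :
    ContDiffOn ℝ 2 f (interior S) := by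
  rw [show (2 : WithTop ℕ∞) = 1 + 1 from by norm_num,
    contDiffOn_succ_iff_fderiv_of_isOpen isOpen_interior]
  refine ⟨fun y hy => (hf.deriv y hy).differentiableAt.differentiableWithinAt, by simp, ?_⟩
  exact hf'.contDiffOn.congr fun y hy => (hf.deriv y hy).fderiv

theorem HasC1.fderiv_fderiv_apply {S : Set V} {f : V → W} {f' : V → V →L[ℝ] W}
    {f'' : V → V →L[ℝ] V →L[ℝ] W} (hf : HasC1 S f f') (hf' : HasC1 S f' f'') {z : V}
    (hz : z ∈ interior S) (v w : V) :
    fderiv ℝ (fun y => fderiv ℝ f y w) z v = f'' z v w := by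
  have h1 : HasFDerivAt (fun y => f' y w) ((f'' z).flip w) z := by
    simpa using (hf'.deriv z hz).clm_apply (hasFDerivAt_const w z)
  have h2 : (fun y => fderiv ℝ f y w) =ᶠ[𝓝 z] fun y => f' y w := by
    filter_upwards [isOpen_interior.mem_nhds hz] with y hy
    rw [(hf.deriv y hy).fderiv]
  rw [h2.fderiv_eq, h1.fderiv]
  rfl

theorem HasC1.tendsto_apply_two {S : Set V} {f : V → W} {f' : V → V →L[ℝ] W}
    {f'' : V → V →L[ℝ] V →L[ℝ] W} (hf : HasC1 S f f') (hf' : HasC1 S f' f'') {x : V}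
    (hx : x ∈ S) (v w : V) :
    Tendsto (fun z => fderiv ℝ (fun y => fderiv ℝ f y w) z v) (𝓝[interior S] x)
      (𝓝 (f'' x v w)) := by
  have h1 : Tendsto (fun z => f'' z v w) (𝓝[interior S] x) (𝓝 (f'' x v w)) := by
    have h2 := (hf'.cont' x hx).mono_left (nhdsWithin_mono _ interior_subset)
    exact ((ContinuousLinearMap.apply ℝ W w).continuous.tendsto _).comp
      (((ContinuousLinearMap.apply ℝ (V →L[ℝ] W) v).continuous.tendsto _).comp h2)
  refine h1.congr' ?_
  filter_upwards [self_mem_nhdsWithin] with y hy using (hf.fderiv_fderiv_apply hf' hy v w).symm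

/-- Schwarz's theorem holds in the interior, and both sides extend continuously to `S`. -/
theorem HasC1.symmetric {S : Set V} (hS : S ⊆ closure (interior S)) {f : V → W}
    {f' : V → V →L[ℝ] W} {f'' : V → V →L[ℝ] V →L[ℝ] W} (hf : HasC1 S f f')
    (hf' : HasC1 S f' f'') {x : V} (hx : x ∈ S) (v w : V) : f'' x v w = f'' x w v := by
  have := mem_closure_iff_nhdsWithin_neBot.1 (hS hx)
  refine tendsto_nhds_unique_of_eventuallyEq (hf.tendsto_apply_two hf' hx v w)
    (hf.tendsto_apply_two hf' hx w v) ?_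
  filter_upwards [self_mem_nhdsWithin] with z hz
  rw [hf.fderiv_fderiv_apply hf' hz, hf.fderiv_fderiv_apply hf' hz]
  refine second_derivative_symmetric_of_eventually (f := f) ?_ (hf'.deriv z hz) v w
  filter_upwards [isOpen_interior.mem_nhds hz] with y hy using hf.deriv y hy

theorem HasC1.partial1_eq {S : Set V} (hS : S ⊆ closure (interior S)) {f : V → ℝ}
    {f' : V → V →L[ℝ] ℝ} (hf : HasC1 S f f') {x : V} (hx : x ∈ S) (v : V) :
    partial1 S f v x = f' x v :=
  extendFrom_eq (hS hx) (hf.tendsto_apply hx v)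

theorem HasC1.partial2_eq {S : Set V} (hS : S ⊆ closure (interior S)) {f : V → ℝ}
    {f' : V → V →L[ℝ] ℝ} {f'' : V → V →L[ℝ] V →L[ℝ] ℝ} (hf : HasC1 S f f')
    (hf' : HasC1 S f' f'') {x : V} (hx : x ∈ S) (v w : V) :
    partial2 S f v w x = f'' x v w :=
  extendFrom_eq (hS hx) (hf.tendsto_apply_two hf' hx v w)

theorem HasC1.isC1On {S : Set V} {f : V → ℝ} {f' : V → V →L[ℝ] ℝ} (hf : HasC1 S f f') :
    IsC1On S f :=
  ⟨hf.cont, hf.contDiffOn, fun v _ hx => ⟨_, hf.tendsto_apply hx v⟩⟩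

theorem HasC1.isC2On {S : Set V} {f : V → ℝ} {f' : V → V →L[ℝ] ℝ}
    {f'' : V → V →L[ℝ] V →L[ℝ] ℝ} (hf : HasC1 S f f') (hf' : HasC1 S f' f'') : IsC2On S f :=
  ⟨hf.isC1On, hf.contDiffOn_two hf', fun v w _ hx => ⟨_, hf.tendsto_apply_two hf' hx v w⟩⟩

/-! ### From partial derivatives to Fréchet derivatives on closed sets -/

section FiniteDimensional

variable [FiniteDimensional ℝ V]

theorem clm_eq_sum_basis (A : V →L[ℝ] W) :
    A = ∑ i, (LinearMap.toContinuousLinearMap ((Module.finBasis ℝ V).coord i)).smulRight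
      (A (Module.finBasis ℝ V i)) := by
  ext v
  conv_lhs => rw [← (Module.finBasis ℝ V).sum_repr v]
  simp [-Module.Basis.sum_repr]

/-- On a finite-dimensional space an operator depends continuously on its values on a basis, so
directional limits combine into a limit in operator norm. This connects `IsC1On` and `IsC2On`, which
speak of directional derivatives, with `HasC1`. -/
theorem exists_tendsto_clm {ι : Type*} {l : Filter ι} {A : ι → V →L[ℝ] W}
    (h : ∀ v, ∃ w, Tendsto (fun i => A i v) l (𝓝 w)) : ∃ L, Tendsto A l (𝓝 L) := by
  choose w hw using fun k => h (Module.finBasis ℝ V k)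
  refine ⟨∑ k, (LinearMap.toContinuousLinearMap ((Module.finBasis ℝ V).coord k)).smulRight (w k),
    ?_⟩
  have h1 : A = fun i => ∑ k, (LinearMap.toContinuousLinearMap
      ((Module.finBasis ℝ V).coord k)).smulRight (A i (Module.finBasis ℝ V k)) :=
    funext fun i => clm_eq_sum_basis (A i)
  rw [h1]
  refine tendsto_finsetSum _ fun k _ => ?_
  exact ((ContinuousLinearMap.smulRightL ℝ V W
    (LinearMap.toContinuousLinearMap ((Module.finBasis ℝ V).coord k))).continuous.tendsto _).comp
      (hw k)

theorem hasC1_extendFrom {S : Set V} (hS : S ⊆ closure (interior S)) {f : V → W}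
    (hc : ContinuousOn f S) (hd : ContDiffOn ℝ 1 f (interior S))
    (hl : ∀ v, ∀ x ∈ S, ∃ l, Tendsto (fun y => fderiv ℝ f y v) (𝓝[interior S] x) (𝓝 l)) :
    HasC1 S f (extendFrom (interior S) (fderiv ℝ f)) where
  cont := hc
  cont' := continuousOn_extendFrom hS fun x hx => exists_tendsto_clm fun v => hl v x hx
  deriv x hx := by
    rw [extendFrom_extends ?_ x hx]
    · exact ((hd.differentiableOn (by simp)).differentiableAt
        (isOpen_interior.mem_nhds hx)).hasFDerivAt
    · exact hd.continuousOn_fderiv_of_isOpen isOpen_interior (le_refl _)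

theorem hasC1_extendFrom_two {S : Set V} (hS : S ⊆ closure (interior S)) {f : V → W}
    {f' : V → V →L[ℝ] W} (hf : HasC1 S f f') (hd : ContDiffOn ℝ 2 f (interior S))
    (hl : ∀ v w, ∀ x ∈ S, ∃ l,
      Tendsto (fun z => fderiv ℝ (fun y => fderiv ℝ f y w) z v) (𝓝[interior S] x) (𝓝 l)) :
    HasC1 S f' (extendFrom (interior S) (fderiv ℝ f')) := by
  have hd' : ContDiffOn ℝ 1 f' (interior S) := by
    rw [show (2 : WithTop ℕ∞) = 1 + 1 from by norm_num,
      contDiffOn_succ_iff_fderiv_of_isOpen isOpen_interior] at hd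
    exact hd.2.2.congr fun y hy => (hf.deriv y hy).fderiv.symm
  refine hasC1_extendFrom hS hf.cont' hd' fun v x hx => exists_tendsto_clm fun w => ?_
  obtain ⟨l, hl⟩ := hl v w x hx
  refine ⟨l, hl.congr' ?_⟩
  filter_upwards [self_mem_nhdsWithin] with z hz
  have hz' : DifferentiableAt ℝ f' z :=
    (hd'.differentiableOn (by simp)).differentiableAt (isOpen_interior.mem_nhds hz)
  have h1 : HasFDerivAt (fun y => f' y w) ((fderiv ℝ f' z).flip w) z := by
    simpa using hz'.hasFDerivAt.clm_apply (hasFDerivAt_const w z)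
  have h2 : (fun y => fderiv ℝ f y w) =ᶠ[𝓝 z] fun y => f' y w := by
    filter_upwards [isOpen_interior.mem_nhds hz] with y hy
    rw [(hf.deriv y hy).fderiv]
  rw [h2.fderiv_eq, h1.fderiv]
  rfl

end FiniteDimensional

end Calculus

end CHModel

end

noncomputable section

namespace CHModel

/-! ### The model functions on their domain -/

theorem isClosed_orthant (q : ℕ) : IsClosed (orthant q) := by
  have h : orthant q = ⋂ i, {u : E q | 0 ≤ u i} := by
    ext u; simp [orthant]
  rw [h]
  exact isClosed_iInter fun i => isClosed_le continuous_const (by fun_prop)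

theorem convex_orthant (q : ℕ) : Convex ℝ (orthant q) := by
  intro u hu v hv a b ha hb _ i
  have h1 := mul_nonneg ha (hu i)
  have h2 := mul_nonneg hb (hv i)
  simpa using add_nonneg h1 h2

theorem orthant_subset_closure_interior (q : ℕ) : orthant q ⊆ closure (interior (orthant q)) := by
  intro u hu
  set w : E q := WithLp.toLp 2 fun _ => 1 with hw
  have hopen : IsOpen {v : E q | ∀ i, 0 < v i} := by
    have h : {v : E q | ∀ i, 0 < v i} = ⋂ i, {v : E q | 0 < v i} := by ext v; simp
    rw [h]
    exact isOpen_iInter_of_finite fun i => isOpen_lt continuous_const (by fun_prop)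
  have hsub : {v : E q | ∀ i, 0 < v i} ⊆ interior (orthant q) :=
    interior_maximal (fun v hv i => (hv i).le) hopen
  have ht : Tendsto (fun n : ℕ => u + (1 / ((n : ℝ) + 1)) • w) atTop (𝓝 (u + (0 : ℝ) • w)) :=
    tendsto_const_nhds.add (tendsto_one_div_add_atTop_nhds_zero_nat.smul_const w)
  rw [zero_smul, add_zero] at ht
  refine mem_closure_of_tendsto ht (Eventually.of_forall fun n => hsub fun i => ?_)
  have h1 := hu i
  have h2 : (0 : ℝ) < 1 / ((n : ℝ) + 1) := by positivity
  simp only [hw, PiLp.add_apply, PiLp.smul_apply, smul_eq_mul, mul_one]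
  linarith

section Calculus

variable {V W : Type*} [NormedAddCommGroup V] [NormedSpace ℝ V] [NormedAddCommGroup W]
  [NormedSpace ℝ W]

theorem HasC1.add {S : Set V} {f g : V → W} {f' g' : V → V →L[ℝ] W} (hf : HasC1 S f f')
    (hg : HasC1 S g g') : HasC1 S (fun x => f x + g x) (fun x => f' x + g' x) where
  cont := hf.cont.add hg.cont
  cont' := hf.cont'.add hg.cont'
  deriv x hx := (hf.deriv x hx).fun_add (hg.deriv x hx)

theorem HasC1.sum {S : Set V} {ι : Type*} [Fintype ι] {f : ι → V → W}
    {f' : ι → V → V →L[ℝ] W} (hf : ∀ i, HasC1 S (f i) (f' i)) :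
    HasC1 S (fun x => ∑ i, f i x) (fun x => ∑ i, f' i x) where
  cont := continuousOn_finsetSum _ fun i _ => (hf i).cont
  cont' := continuousOn_finsetSum _ fun i _ => (hf i).cont'
  deriv x hx := HasFDerivAt.fun_sum fun i _ => (hf i).deriv x hx

end Calculus

variable {d p q : ℕ}

/-- The inclusion of the `j`-th coordinate axis. -/
def axis (q : ℕ) (j : Fin q) : ℝ →L[ℝ] E q :=
  (ContinuousLinearMap.id ℝ ℝ).smulRight (EuclideanSpace.single j (1 : ℝ))

theorem sum_axis (c : Fin q → ℝ) (i : Fin q) : (∑ j, axis q j (c j)) i = c i := by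
  simp [axis, Pi.single_apply]

theorem eq_sum_axis (u : E q) : u = ∑ j, axis q j (u j) := by
  ext i; rw [sum_axis]

/-- `(θ, u) ↦ ψ(θ, u)` as a vector-valued function. -/
def Family.psiV (M : Family d p q) (x : Fin p → ℝ) (z : E d × E q) : E q := M.step z.1 x z.2

/-- First derivative of the `j`-th component of `ψ`. -/
def Family.psiGrad (M : Family d p q) (x : Fin p → ℝ) (j : Fin q) :
    E d × E q → E d × E q →L[ℝ] ℝ :=
  extendFrom (interior M.dom) (fderiv ℝ (M.psi x j))

/-- Second derivative of the `j`-th component of `ψ`. -/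
def Family.psiHess (M : Family d p q) (x : Fin p → ℝ) (j : Fin q) :
    E d × E q → E d × E q →L[ℝ] E d × E q →L[ℝ] ℝ :=
  extendFrom (interior M.dom) (fderiv ℝ (M.psiGrad x j))

/-- First derivative of `ψ`. -/
def Family.psi1 (M : Family d p q) (x : Fin p → ℝ) (z : E d × E q) : E d × E q →L[ℝ] E q :=
  ∑ j, (axis q j).comp (M.psiGrad x j z)

/-- Second derivative of `ψ`. -/
def Family.psi2 (M : Family d p q) (x : Fin p → ℝ) (z : E d × E q) :
    E d × E q →L[ℝ] E d × E q →L[ℝ] E q :=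
  ∑ j, (ContinuousLinearMap.compL ℝ (E d × E q) ℝ (E q) (axis q j)).comp (M.psiHess x j z)

/-- The smoothness assumptions on the family. -/
structure Family.Regular (M : Family d p q) : Prop where
  K_reg : closure (interior (M.K : Set (E d))) = M.K
  smooth : ∀ x, IsC2On M.dom fun z => M.g z.1 x z.2

namespace Family

variable {M : Family d p q}

theorem Regular.K_subset (hM : M.Regular) : (M.K : Set (E d)) ⊆ closure (interior M.K) :=
  hM.K_reg.symm.subset

theorem Regular.dom_subset (hM : M.Regular) : M.dom ⊆ closure (interior M.dom) := by
  unfold Family.dom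
  rw [interior_prod_eq, closure_prod_eq]
  exact prod_mono hM.K_subset (orthant_subset_closure_interior q)

theorem Regular.isC2On_psi (hM : M.Regular) (x : Fin p → ℝ) (j : Fin q) :
    IsC2On M.dom (M.psi x j) := by
  by_cases h : (j : ℕ) = 0
  · have h1 : M.psi x j = fun z => M.g z.1 x z.2 := by
      funext z; simp [Family.psi, Family.step, h]
    rw [h1]; exact hM.smooth x
  · have h1 : M.psi x j = fun z => ((EuclideanSpace.proj (𝕜 := ℝ) (⟨(j : ℕ) - 1, by omega⟩ :
        Fin q)).comp (ContinuousLinearMap.snd ℝ (E d) (E q))) z := by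
      funext z; simp [Family.psi, Family.step, h]
    rw [h1]
    exact (hasC1_clm _ _).isC2On (hasC1_const _ _)

theorem Regular.hasC1_psi (hM : M.Regular) (x : Fin p → ℝ) (j : Fin q) :
    HasC1 M.dom (M.psi x j) (M.psiGrad x j) :=
  have h := (hM.isC2On_psi x j).1
  hasC1_extendFrom hM.dom_subset h.1 h.2.1 h.2.2

theorem Regular.hasC1_psiGrad (hM : M.Regular) (x : Fin p → ℝ) (j : Fin q) :
    HasC1 M.dom (M.psiGrad x j) (M.psiHess x j) :=
  have h := (hM.isC2On_psi x j).2
  hasC1_extendFrom_two hM.dom_subset (hM.hasC1_psi x j) h.1 h.2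

theorem Regular.hasC1_psiV (hM : M.Regular) (x : Fin p → ℝ) :
    HasC1 M.dom (M.psiV x) (M.psi1 x) := by
  have h := HasC1.sum fun j => (hM.hasC1_psi x j).clm_comp (axis q j)
  refine h.congr (fun z _ => ?_) fun z _ => rfl
  exact eq_sum_axis _

theorem Regular.hasC1_psi1 (hM : M.Regular) (x : Fin p → ℝ) :
    HasC1 M.dom (M.psi1 x) (M.psi2 x) :=
  HasC1.sum fun j => (hM.hasC1_psiGrad x j).clm_comp
    (ContinuousLinearMap.compL ℝ (E d × E q) ℝ (E q) (axis q j))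

theorem psi1_apply (x : Fin p → ℝ) (z v : E d × E q) (j : Fin q) :
    M.psi1 x z v j = M.psiGrad x j z v := by
  rw [Family.psi1, sum_apply]
  exact sum_axis (fun j => M.psiGrad x j z v) j

theorem psi2_apply (x : Fin p → ℝ) (z v w : E d × E q) (j : Fin q) :
    M.psi2 x z v w j = M.psiHess x j z v w := by
  rw [Family.psi2, sum_apply, sum_apply]
  exact sum_axis (fun j => M.psiHess x j z v w) j

theorem Regular.dpsi_eq (hM : M.Regular) (x : Fin p → ℝ) (j : Fin q) (k : Fin d ⊕ Fin q)
    {θ : E d} (hθ : θ ∈ M.K) {u : E q} (hu : u ∈ orthant q) :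
    M.dpsi x j k θ u = M.psi1 x (θ, u) (dir k) j := by
  rw [psi1_apply]
  exact (hM.hasC1_psi x j).partial1_eq hM.dom_subset ⟨hθ, hu⟩ _

theorem Regular.ddpsi_eq (hM : M.Regular) (x : Fin p → ℝ) (j : Fin q) (k₁ k₂ : Fin d ⊕ Fin q)
    {θ : E d} (hθ : θ ∈ M.K) {u : E q} (hu : u ∈ orthant q) :
    M.ddpsi x j k₁ k₂ θ u = M.psi2 x (θ, u) (dir k₁) (dir k₂) j := by
  rw [psi2_apply]
  exact (hM.hasC1_psi x j).partial2_eq hM.dom_subset (hM.hasC1_psiGrad x j) ⟨hθ, hu⟩ _ _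

theorem Regular.psi2_symm (hM : M.Regular) (x : Fin p → ℝ) {z : E d × E q} (hz : z ∈ M.dom)
    (v w : E d × E q) : M.psi2 x z v w = M.psi2 x z w v :=
  (hM.hasC1_psiV x).symmetric hM.dom_subset (hM.hasC1_psi1 x) hz v w

/-! ### Differentiating along the recursion -/

/-- Extension by zero of a function on `K`. -/
def ext (M : Family d p q) {W : Type*} [Zero W] (c : M.K → W) : E d → W :=
  Function.extend (Subtype.val : M.K → E d) c 0

theorem ext_apply {W : Type*} [Zero W] (c : M.K → W) (θ : M.K) : M.ext c θ = c θ :=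
  Subtype.val_injective.extend_apply _ _ _

theorem ext_of_mem {W : Type*} [Zero W] (c : M.K → W) {θ : E d} (hθ : θ ∈ M.K) :
    M.ext c θ = c ⟨θ, hθ⟩ := ext_apply c ⟨θ, hθ⟩

/-- `s ∈ C(K, [0, ∞)^q)` as a function with values in `ℝ^q`. -/
def val (M : Family d p q) (s : M.H) : C(M.K, E q) := ⟨fun θ => (s θ : E q), by fun_prop⟩

/-- Values of first derivatives of functions `K → ℝ^q`. -/
abbrev W1 (d q : ℕ) : Type := E d →L[ℝ] E q

/-- Values of second derivatives of functions `K → ℝ^q`. -/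
abbrev W2 (d q : ℕ) : Type := E d →L[ℝ] E d →L[ℝ] E q

/-- These are the standard norms. In particular the product carries the maximum norm, for which both
inclusions of the factors have norm at most one. -/
instance instNormedAddCommGroupProd : NormedAddCommGroup (E d × E q) := Prod.normedAddCommGroup

instance instNormedAddCommGroupA1 : NormedAddCommGroup (E d × E q →L[ℝ] E q) :=
  ContinuousLinearMap.toNormedAddCommGroup

instance instNormedAddCommGroupA2 :
    NormedAddCommGroup (E d × E q →L[ℝ] E d × E q →L[ℝ] E q) :=
  ContinuousLinearMap.toNormedAddCommGroup

instance instNormedAddCommGroupW2 : NormedAddCommGroup (W2 d q) :=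
  ContinuousLinearMap.toNormedAddCommGroup

instance instAddW2 : Add (W2 d q) := ContinuousLinearMap.add

instance instNormedSpaceW2 : NormedSpace ℝ (W2 d q) := ContinuousLinearMap.toNormedSpace

/-- `s` is twice continuously differentiable on `K` with derivatives `a` and `b`. -/
structure HasC2 (M : Family d p q) (s : M.H) (a : C(M.K, W1 d q)) (b : C(M.K, W2 d q)) : Prop where
  first : HasC1 (M.K : Set (E d)) (M.ext (M.val s)) (M.ext a)
  second : HasC1 (M.K : Set (E d)) (M.ext a) (M.ext b)

theorem comp_eq (s : M.H) (j : Fin q) (θ : E d) : M.comp s j θ = M.ext (M.val s) θ j := by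
  by_cases h : ∃ a : M.K, (a : E d) = θ
  · obtain ⟨a, rfl⟩ := h
    rw [ext_apply, Family.comp, Subtype.val_injective.extend_apply]; rfl
  · rw [Family.comp, ext, Function.extend_apply' _ _ _ h, Function.extend_apply' _ _ _ h]; rfl

theorem HasC2.comp_first {s : M.H} {a : C(M.K, W1 d q)} {b : C(M.K, W2 d q)}
    (h : M.HasC2 s a b) (j : Fin q) : HasC1 (M.K : Set (E d)) (M.comp s j)
      (fun θ => (EuclideanSpace.proj (𝕜 := ℝ) j : E q →L[ℝ] ℝ).comp (M.ext a θ)) :=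
  (h.first.clm_comp (EuclideanSpace.proj (𝕜 := ℝ) j)).congr (fun θ _ => comp_eq s j θ)
    fun _ _ => rfl

theorem HasC2.comp_second {s : M.H} {a : C(M.K, W1 d q)} {b : C(M.K, W2 d q)}
    (h : M.HasC2 s a b) (j : Fin q) : HasC1 (M.K : Set (E d))
      (fun θ => (EuclideanSpace.proj (𝕜 := ℝ) j : E q →L[ℝ] ℝ).comp (M.ext a θ))
      (fun θ => (ContinuousLinearMap.compL ℝ (E d) (E q) ℝ (EuclideanSpace.proj (𝕜 := ℝ) j)).comp
        (M.ext b θ)) :=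
  h.second.clm_comp (ContinuousLinearMap.compL ℝ (E d) (E q) ℝ (EuclideanSpace.proj (𝕜 := ℝ) j))

theorem HasC2.isC2 {s : M.H} {a : C(M.K, W1 d q)} {b : C(M.K, W2 d q)} (h : M.HasC2 s a b) :
    M.IsC2 s := fun j => (h.comp_first j).isC2On (h.comp_second j)

theorem HasC2.D_eq (hM : M.Regular) {s : M.H} {a : C(M.K, W1 d q)} {b : C(M.K, W2 d q)}
    (h : M.HasC2 s a b) (j : Fin q) (k : Fin d) (θ : M.K) :
    M.D s j k θ = a θ (EuclideanSpace.single k 1) j := by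
  rw [Family.D, (h.comp_first j).partial1_eq hM.K_subset θ.2, ext_apply]; rfl

/-- The vector of all second partial derivatives. -/
def coords (d q : ℕ) : W2 d q →L[ℝ] EuclideanSpace ℝ (Fin q × Fin d × Fin d) :=
  LinearMap.toContinuousLinearMap
    { toFun := fun b : W2 d q => WithLp.toLp 2 fun l : Fin q × Fin d × Fin d =>
        b (EuclideanSpace.single l.2.1 1) (EuclideanSpace.single l.2.2 1) l.1
      map_add' := fun _ _ => rfl
      map_smul' := fun _ _ => rfl }

theorem coords_apply (b : W2 d q) (l : Fin q × Fin d × Fin d) :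
    coords d q b l = b (EuclideanSpace.single l.2.1 1) (EuclideanSpace.single l.2.2 1) l.1 := rfl

theorem HasC2.D2_eq (hM : M.Regular) {s : M.H} {a : C(M.K, W1 d q)} {b : C(M.K, W2 d q)}
    (h : M.HasC2 s a b) (θ : M.K) : M.D2 s θ = coords d q (b θ) := by
  ext l
  rw [coords_apply]
  refine ((h.comp_first l.1).partial2_eq hM.K_subset (h.comp_second l.1) θ.2 _ _).trans ?_
  rw [ext_apply]; rfl

theorem Regular.continuous_along {W : Type*} [TopologicalSpace W]
    {F : E d × E q → W} (hF : ContinuousOn F M.dom) (s : M.H) :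
    Continuous fun θ : M.K => F ((θ : E d), (s θ : E q)) :=
  hF.comp_continuous (by fun_prop) fun θ => ⟨θ.2, (s θ).2⟩

/-- `θ ↦ ψ'(θ, s(θ))`. -/
def along1 (hM : M.Regular) (x : Fin p → ℝ) (s : M.H) : C(M.K, E d × E q →L[ℝ] E q) :=
  ⟨fun θ => M.psi1 x (θ, s θ), Regular.continuous_along (hM.hasC1_psi1 x).cont s⟩

/-- `θ ↦ ψ''(θ, s(θ))`. -/
def along2 (hM : M.Regular) (x : Fin p → ℝ) (s : M.H) :
    C(M.K, E d × E q →L[ℝ] E d × E q →L[ℝ] E q) :=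
  ⟨fun θ => M.psi2 x (θ, s θ), Regular.continuous_along (hM.hasC1_psi1 x).cont' s⟩

/-- The derivative of `θ ↦ (θ, s(θ))` if `s` has derivative `a`. -/
def graphD (a : W1 d q) : E d →L[ℝ] E d × E q :=
  ContinuousLinearMap.inl ℝ (E d) (E q) + (ContinuousLinearMap.inr ℝ (E d) (E q)).comp a

theorem graphD_apply (a : W1 d q) (v : E d) : graphD a v = (v, a v) := by
  simp [graphD]

theorem continuous_graphD : Continuous (graphD : W1 d q → _) :=
  continuous_const.add
    (ContinuousLinearMap.compL ℝ (E d) (E q) (E d × E q)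
      (ContinuousLinearMap.inr ℝ (E d) (E q))).continuous

/-- The quadratic term in the second derivative of a composition. -/
def quad (B : E d × E q →L[ℝ] E d × E q →L[ℝ] E q) (L : E d →L[ℝ] E d × E q) : W2 d q :=
  ((ContinuousLinearMap.compL ℝ (E d) (E d × E q) (E q)).flip L).comp (B.comp L)

theorem quad_apply (B : E d × E q →L[ℝ] E d × E q →L[ℝ] E q) (L : E d →L[ℝ] E d × E q)
    (v w : E d) : quad B L v w = B (L v) (L w) := rfl

/-- The partial derivative with respect to the state variable. -/
def jac (A : E d × E q →L[ℝ] E q) : E q →L[ℝ] E q := A.comp (ContinuousLinearMap.inr ℝ _ _)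

theorem jac_apply (A : E d × E q →L[ℝ] E q) (u : E q) : jac A u = A (0, u) := rfl

theorem continuous_jac : Continuous (jac : (E d × E q →L[ℝ] E q) → _) :=
  ((ContinuousLinearMap.compL ℝ (E q) (E d × E q) (E q)).flip
    (ContinuousLinearMap.inr ℝ _ _)).continuous

/-- Action of a linear map of `ℝ^q` on second derivatives. -/
def act2 (J : E q →L[ℝ] E q) (b : W2 d q) : W2 d q :=
  (ContinuousLinearMap.compL ℝ (E d) (E q) (E q) J).comp b

theorem act2_apply (J : E q →L[ℝ] E q) (b : W2 d q) (v w : E d) : act2 J b v w = J (b v w) := rfl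

/-- The derivative of `Φ(s)` if `s` has derivative `a`. -/
def stepD (hM : M.Regular) (x : Fin p → ℝ) (s : M.H) (a : C(M.K, W1 d q)) : C(M.K, W1 d q) :=
  ⟨fun θ => (along1 hM x s θ).comp (graphD (a θ)),
    (along1 hM x s).continuous.clm_comp (continuous_graphD.comp a.continuous)⟩

/-- The second derivative of `Φ(s)` if `s` has derivatives `a` and `b`. -/
def stepE (hM : M.Regular) (x : Fin p → ℝ) (s : M.H) (a : C(M.K, W1 d q)) (b : C(M.K, W2 d q)) :
    C(M.K, W2 d q) :=
  ⟨fun θ => act2 (jac (along1 hM x s θ)) (b θ) + quad (along2 hM x s θ) (graphD (a θ)), by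
    refine Continuous.add ?_ ?_
    · exact ((ContinuousLinearMap.continuous _).comp
        (continuous_jac.comp (along1 hM x s).continuous)).clm_comp b.continuous
    · have h := continuous_graphD.comp a.continuous
      exact ((ContinuousLinearMap.continuous _).comp h).clm_comp
        ((along2 hM x s).continuous.clm_comp h)⟩

theorem stepD_apply (hM : M.Regular) (x : Fin p → ℝ) (s : M.H) (a : C(M.K, W1 d q)) (θ : M.K) :
    stepD hM x s a θ = (along1 hM x s θ).comp (graphD (a θ)) := rfl

theorem stepE_apply (hM : M.Regular) (x : Fin p → ℝ) (s : M.H) (a : C(M.K, W1 d q))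
    (b : C(M.K, W2 d q)) (θ : M.K) : stepE hM x s a b θ =
      act2 (jac (along1 hM x s θ)) (b θ) + quad (along2 hM x s θ) (graphD (a θ)) := rfl

/-- `Φ(s)` is ψ composed with the graph map θ ↦ (θ, s(θ)). The graph may touch the boundary of the
orthant, so the chain rule on closed sets is needed. The second derivative is the product rule
applied to ψ'(θ, s(θ)) ∘ `graphD`. -/
theorem HasC2.step (hM : M.Regular) (x : Fin p → ℝ) {s : M.H} {a : C(M.K, W1 d q)}
    {b : C(M.K, W2 d q)} (h : M.HasC2 s a b) :
    M.HasC2 (M.Phi x s) (stepD hM x s a) (stepE hM x s a b) := by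
  have hgraph : HasC1 (M.K : Set (E d)) (fun θ => (θ, M.ext (M.val s) θ))
      (fun θ => graphD (M.ext a θ)) := by
    refine ((hasC1_clm _ (ContinuousLinearMap.id ℝ (E d))).prodMk h.first).congr
      (fun θ _ => rfl) fun θ _ => ?_
    ext v <;> simp [graphD_apply]
  have hmaps : MapsTo (fun θ => (θ, M.ext (M.val s) θ)) (M.K : Set (E d))
      ((M.K : Set (E d)) ×ˢ orthant q) := fun θ hθ => by
    refine ⟨hθ, ?_⟩
    change M.ext (M.val s) θ ∈ orthant q
    rw [ext_of_mem _ hθ]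
    exact (s ⟨θ, hθ⟩).2
  have hA := (hM.hasC1_psiV x).comp (convex_orthant q) (isClosed_orthant q)
    (orthant_subset_closure_interior q) hgraph hmaps fun θ hθ => hθ
  have hA' := (hM.hasC1_psi1 x).comp (convex_orthant q) (isClosed_orthant q)
    (orthant_subset_closure_interior q) hgraph hmaps fun θ hθ => hθ
  have hB : HasC1 (M.K : Set (E d)) (fun θ => graphD (M.ext a θ))
      (fun θ => (ContinuousLinearMap.compL ℝ (E d) (E q) (E d × E q)
        (ContinuousLinearMap.inr ℝ (E d) (E q))).comp (M.ext b θ)) := by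
    have := (hasC1_const (M.K : Set (E d)) (ContinuousLinearMap.inl ℝ (E d) (E q))).add
      (h.second.clm_comp (ContinuousLinearMap.compL ℝ (E d) (E q) (E d × E q)
        (ContinuousLinearMap.inr ℝ (E d) (E q))))
    exact this.congr (fun θ _ => rfl) fun θ _ => by simp
  constructor
  · refine hA.congr (fun θ hθ => ?_) fun θ hθ => ?_
    · simp only [ext_of_mem _ hθ]; rfl
    · simp only [ext_of_mem _ hθ]; rfl
  · refine (hA'.comp_clm hB).congr (fun θ hθ => ?_) fun θ hθ => ?_
    · simp only [ext_of_mem _ hθ]; rfl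
    · simp only [ext_of_mem _ hθ]
      ext v w
      rfl

theorem hasC2_const (ς : orthant q) : M.HasC2 (ContinuousMap.const _ ς) 0 0 := by
  constructor
  · refine (hasC1_const _ (ς : E q)).congr (fun θ hθ => ?_) fun θ hθ => ?_
    · rw [ext_of_mem _ hθ]; rfl
    · rw [ext_of_mem _ hθ]; rfl
  · refine (hasC1_const _ 0).congr (fun θ hθ => ?_) fun θ hθ => ?_
    · rw [ext_of_mem _ hθ]; rfl
    · rw [ext_of_mem _ hθ]; rfl

/-- The derivative of `ĥ_t`. -/
def hHatD (hM : M.Regular) (x : ℤ → ℝ) (ς : orthant q) : ℕ → C(M.K, W1 d q)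
  | 0 => 0
  | t + 1 => stepD hM (lags x (t : ℤ)) (M.hHat x ς t) (hHatD hM x ς t)

/-- The second derivative of `ĥ_t`. -/
def hHatE (hM : M.Regular) (x : ℤ → ℝ) (ς : orthant q) : ℕ → C(M.K, W2 d q)
  | 0 => 0
  | t + 1 => stepE hM (lags x (t : ℤ)) (M.hHat x ς t) (hHatD hM x ς t) (hHatE hM x ς t)

theorem hasC2_hHat (hM : M.Regular) (x : ℤ → ℝ) (ς : orthant q) (t : ℕ) :
    M.HasC2 (M.hHat x ς t) (hHatD hM x ς t) (hHatE hM x ς t) := by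
  induction t with
  | zero => exact hasC2_const ς
  | succ t ih => exact ih.step hM _

/-- The vector `(e_{i,k₁,k₂}(θ))_{i}`. -/
def col (e : EuclideanSpace ℝ (Fin q × Fin d × Fin d)) (k₁ k₂ : Fin d) : E q :=
  WithLp.toLp 2 fun i => e (i, k₁, k₂)

theorem dir_inr_sum (u : E q) : ((0, u) : E d × E q) = ∑ i, u i • dir (Sum.inr i) := by
  refine Prod.ext ?_ ?_
  · simp [Prod.fst_sum, dir]
  · simp only [Prod.snd_sum, dir, Prod.smul_snd]
    conv_lhs => rw [eq_sum_axis u]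
    rfl

/-- The coordinate formula is the bilinear form ψ'' expanded at the vectors `graphD (a θ)` of the
k₁-th and k₂-th basis vectors, each a coordinate direction in θ plus a combination of state
directions. Symmetry of ψ'' is needed for the cross term of a state direction with the k₂-th
parameter direction. -/
theorem HasC2.ddPhi_apply (hM : M.Regular) (x : Fin p → ℝ) {s : M.H} {a : C(M.K, W1 d q)}
    {b : C(M.K, W2 d q)} (h : M.HasC2 s a b) (e : M.H2) (θ : M.K) (j : Fin q) (k₁ k₂ : Fin d) :
    M.ddPhi x s e θ (j, k₁, k₂) =
      (quad (along2 hM x s θ) (graphD (a θ)) (EuclideanSpace.single k₁ 1)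
        (EuclideanSpace.single k₂ 1) + jac (along1 hM x s θ) (col (e θ) k₁ k₂)) j := by
  have hz : ((θ : E d), (s θ : E q)) ∈ M.dom := ⟨θ.2, (s θ).2⟩
  have hg : ∀ k : Fin d, graphD (a θ) (EuclideanSpace.single k 1) =
      dir (Sum.inl k) + ∑ i, M.D s i k θ • dir (Sum.inr i) := fun k => by
    have h1 : (∑ i, M.D s i k θ • dir (Sum.inr i) : E d × E q) =
        (0, a θ (EuclideanSpace.single k 1)) := by
      rw [dir_inr_sum]
      exact Finset.sum_congr rfl fun i _ => by rw [h.D_eq hM]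
    rw [h1, graphD_apply]
    simp [dir]
  have hc : ((0, col (e θ) k₁ k₂) : E d × E q) = ∑ i, e θ (i, k₁, k₂) • dir (Sum.inr i) :=
    dir_inr_sum _
  rw [quad_apply, hg, hg, jac_apply, hc]
  simp only [Family.ddPhi, hM.ddpsi_eq x _ _ _ θ.2 (s θ).2, hM.dpsi_eq x _ _ θ.2 (s θ).2]
  have e1 : along1 hM x s θ = M.psi1 x (θ, s θ) := rfl
  have e2 : along2 hM x s θ = M.psi2 x (θ, s θ) := rfl
  rw [e1, e2]
  simp only [map_add, map_sum, map_smul, add_apply,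
    sum_apply, smul_apply, PiLp.add_apply,
    PiLp.smul_apply, smul_eq_mul, WithLp.ofLp_sum, Finset.sum_apply]
  simp only [hM.psi2_symm x hz (dir (Sum.inr _)) (dir (Sum.inl k₂)), mul_comm]

end Family

end CHModel

end

noncomputable section

namespace CHModel

/-! ### Subexponential growth and exponential decay -/

/-- `v` grows subexponentially in both directions. -/
def Tempered (v : ℤ → ℝ) : Prop := ∀ ε > 0, ∃ C, ∀ a, v a ≤ C * Real.exp (ε * |(a : ℝ)|)

/-- `u a n` decays exponentially in `n` at rate `c`, uniformly up to subexponential factors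
in `a`. -/
def ExpBd (c : ℝ) (u : ℤ → ℕ → ℝ) : Prop :=
  ∀ ε > 0, ∃ C, ∀ a n, u a n ≤ C * Real.exp (ε * |(a : ℝ)| - c * n)

theorem Tempered.bound {v : ℤ → ℝ} (h : Tempered v) {ε : ℝ} (hε : 0 < ε) :
    ∃ C, 0 ≤ C ∧ ∀ a, v a ≤ C * Real.exp (ε * |(a : ℝ)|) := by
  obtain ⟨C, hC⟩ := h ε hε
  exact ⟨max C 0, le_max_right _ _, fun a => (hC a).trans (by gcongr; exact le_max_left _ _)⟩

theorem ExpBd.bound {c : ℝ} {u : ℤ → ℕ → ℝ} (h : ExpBd c u) {ε : ℝ} (hε : 0 < ε) :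
    ∃ C, 0 ≤ C ∧ ∀ a n, u a n ≤ C * Real.exp (ε * |(a : ℝ)| - c * n) := by
  obtain ⟨C, hC⟩ := h ε hε
  exact ⟨max C 0, le_max_right _ _, fun a n => (hC a n).trans (by gcongr; exact le_max_left _ _)⟩

theorem Tempered.mono {v w : ℤ → ℝ} (h : Tempered w) (hvw : ∀ a, v a ≤ w a) : Tempered v :=
  fun ε hε => (h ε hε).imp fun _ hC a => (hvw a).trans (hC a)

theorem ExpBd.mono {c : ℝ} {u v : ℤ → ℕ → ℝ} (h : ExpBd c v) (huv : ∀ a n, u a n ≤ v a n) :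
    ExpBd c u := fun ε hε => (h ε hε).imp fun _ hC a n => (huv a n).trans (hC a n)

theorem ExpBd.weaken {c c' : ℝ} {u : ℤ → ℕ → ℝ} (h : ExpBd c u) (hc : c' ≤ c) : ExpBd c' u := by
  intro ε hε
  obtain ⟨C, hC0, hC⟩ := h.bound hε
  refine ⟨C, fun a n => (hC a n).trans ?_⟩
  gcongr

theorem tempered_const (b : ℝ) : Tempered fun _ => b := by
  intro ε hε
  refine ⟨max b 0, fun a => ?_⟩
  have h : 1 ≤ Real.exp (ε * |(a : ℝ)|) := Real.one_le_exp (by positivity)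
  have h0 := le_max_right b 0
  have h1 := le_max_left b 0
  nlinarith

theorem Tempered.add {v w : ℤ → ℝ} (hv : Tempered v) (hw : Tempered w) :
    Tempered fun a => v a + w a := by
  intro ε hε
  obtain ⟨C, hC⟩ := hv ε hε
  obtain ⟨D, hD⟩ := hw ε hε
  exact ⟨C + D, fun a => by rw [add_mul]; exact add_le_add (hC a) (hD a)⟩

theorem Tempered.mul {v w : ℤ → ℝ} (hv : Tempered v) (hw : Tempered w) (hw0 : ∀ a, 0 ≤ w a) :
    Tempered fun a => v a * w a := by
  intro ε hε
  obtain ⟨C, hC0, hC⟩ := hv.bound (half_pos hε)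
  obtain ⟨D, hD0, hD⟩ := hw.bound (half_pos hε)
  refine ⟨C * D, fun a => (mul_le_mul (hC a) (hD a) (hw0 a) (by positivity)).trans (le_of_eq ?_)⟩
  rw [mul_mul_mul_comm, ← Real.exp_add]
  ring_nf

theorem Tempered.sum {ι : Type*} [Fintype ι] {v : ι → ℤ → ℝ} (hv : ∀ i, Tempered (v i)) :
    Tempered fun a => ∑ i, v i a := by
  intro ε hε
  choose C hC using fun i => hv i ε hε
  exact ⟨∑ i, C i, fun a => by rw [Finset.sum_mul]; exact Finset.sum_le_sum fun i _ => hC i a⟩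

theorem ExpBd.add {c : ℝ} {u v : ℤ → ℕ → ℝ} (hu : ExpBd c u) (hv : ExpBd c v) :
    ExpBd c fun a n => u a n + v a n := by
  intro ε hε
  obtain ⟨C, hC⟩ := hu ε hε
  obtain ⟨D, hD⟩ := hv ε hε
  exact ⟨C + D, fun a n => by rw [add_mul]; exact add_le_add (hC a n) (hD a n)⟩

theorem ExpBd.mul {c c' : ℝ} {u v : ℤ → ℕ → ℝ} (hu : ExpBd c u) (hv : ExpBd c' v)
    (hv0 : ∀ a n, 0 ≤ v a n) : ExpBd (c + c') fun a n => u a n * v a n := by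
  intro ε hε
  obtain ⟨C, hC0, hC⟩ := hu.bound (half_pos hε)
  obtain ⟨D, hD0, hD⟩ := hv.bound (half_pos hε)
  refine ⟨C * D, fun a n =>
    (mul_le_mul (hC a n) (hD a n) (hv0 a n) (by positivity)).trans (le_of_eq ?_)⟩
  rw [mul_mul_mul_comm, ← Real.exp_add]
  ring_nf

theorem Tempered.expBd_start {v : ℤ → ℝ} (hv : Tempered v) : ExpBd 0 fun a _ => v a := by
  intro ε hε
  obtain ⟨C, hC⟩ := hv ε hε
  exact ⟨C, fun a n => by simpa using hC a⟩

theorem abs_cast_add_le (a : ℤ) (n : ℕ) : |((a + n : ℤ) : ℝ)| ≤ |(a : ℝ)| + n := by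
  push_cast
  exact (abs_add_le _ _).trans (by simp)

/-- Because |a + n| ≤ |a| + n, evaluating at the end of the window costs a factor exp(εn), which any
negative rate allows. -/
theorem Tempered.expBd_end {v : ℤ → ℝ} (hv : Tempered v) {c : ℝ} (hc : c < 0) :
    ExpBd c fun a n => v (a + n) := by
  intro ε hε
  obtain ⟨C, hC0, hC⟩ := hv.bound (lt_min hε (neg_pos.2 hc))
  refine ⟨C, fun a n => (hC _).trans ?_⟩
  have h1 := abs_cast_add_le a n
  have h2 : min ε (-c) * |((a + n : ℤ) : ℝ)| ≤ min ε (-c) * |(a : ℝ)| + min ε (-c) * n := by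
    rw [← mul_add]
    exact mul_le_mul_of_nonneg_left h1 (lt_min hε (neg_pos.2 hc)).le
  have h3 : min ε (-c) * |(a : ℝ)| ≤ ε * |(a : ℝ)| := by gcongr; exact min_le_left _ _
  have h4 : min ε (-c) * n ≤ -c * n := by gcongr; exact min_le_right _ _
  have : min ε (-c) * |((a + n : ℤ) : ℝ)| ≤ ε * |(a : ℝ)| - c * n := by linarith
  gcongr

theorem ExpBd.mul_end {c c' : ℝ} {u : ℤ → ℕ → ℝ} {v : ℤ → ℝ} (hu : ExpBd c u) (hv : Tempered v)
    (hv0 : ∀ a, 0 ≤ v a) (hc : c' < c) : ExpBd c' fun a n => u a n * v (a + n) :=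
  (hu.mul (hv.expBd_end (c := c' - c) (by linarith)) fun _ _ => hv0 _).weaken (by linarith)

theorem ExpBd.rpow {c κ : ℝ} {u : ℤ → ℕ → ℝ} (hu : ExpBd c u) (hu0 : ∀ a n, 0 ≤ u a n)
    (hκ : 0 < κ) : ExpBd (κ * c) fun a n => u a n ^ κ := by
  intro ε hε
  obtain ⟨C, hC0, hC⟩ := hu.bound (div_pos hε hκ)
  refine ⟨C ^ κ, fun a n => (Real.rpow_le_rpow (hu0 a n) (hC a n) hκ.le).trans (le_of_eq ?_)⟩
  rw [Real.mul_rpow hC0 (Real.exp_pos _).le, ← Real.exp_mul]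
  congr 2
  field_simp

/-- Windows that end at a fixed time start at `t - n`. With ε = c/2 the growth in the starting time
uses up half of the rate. -/
theorem ExpBd.backward {c : ℝ} {u : ℤ → ℕ → ℝ} (hu : ExpBd c u) (hc : 0 < c) (t : ℤ) :
    ∃ C, ∀ n : ℕ, u (t - n) n ≤ C * Real.exp (-(c / 2)) ^ n := by
  obtain ⟨C, hC0, hC⟩ := hu.bound (half_pos hc)
  refine ⟨C * Real.exp (c / 2 * |(t : ℝ)|), fun n => (hC _ n).trans ?_⟩
  have h1 : |((t - n : ℤ) : ℝ)| ≤ |(t : ℝ)| + n := by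
    push_cast
    exact (abs_sub _ _).trans (by simp)
  have h2 : c / 2 * |((t - n : ℤ) : ℝ)| ≤ c / 2 * (|(t : ℝ)| + n) := by gcongr
  rw [← Real.exp_nat_mul, mul_assoc, ← Real.exp_add]
  gcongr
  linarith

theorem ExpBd.tendsto_backward {c : ℝ} {u : ℤ → ℕ → ℝ} (hu : ExpBd c u) (hc : 0 < c)
    (hu0 : ∀ a n, 0 ≤ u a n) (t : ℤ) : Tendsto (fun n : ℕ => u (t - n) n) atTop (𝓝 0) := by
  obtain ⟨C, hC⟩ := hu.backward hc t
  refine squeeze_zero (fun n => hu0 _ _) hC ?_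
  have := (tendsto_pow_atTop_nhds_zero_of_lt_one (Real.exp_pos _).le
    (Real.exp_lt_one_iff.2 (by linarith : -(c / 2) < 0))).const_mul C
  simpa using this

theorem Tempered.shift_pred {v : ℤ → ℝ} (hv : Tempered v) : Tempered fun a => v (a - 1) := by
  intro ε hε
  obtain ⟨C, hC0, hC⟩ := hv.bound hε
  refine ⟨C * Real.exp ε, fun a => (hC _).trans ?_⟩
  have h1 : |((a - 1 : ℤ) : ℝ)| ≤ |(a : ℝ)| + 1 := by
    push_cast
    exact (abs_sub _ _).trans (by simp)
  rw [mul_assoc, ← Real.exp_add]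
  gcongr
  nlinarith

/-- Bound for a variation-of-constants sum. -/
theorem ExpBd.of_sum_le {c ρ ρ' : ℝ} {m r δ : ℤ → ℕ → ℝ} {δ₀ : ℤ → ℝ} (hm : ExpBd c m)
    (hr : ExpBd ρ r) (hδ₀ : Tempered δ₀) (hr0 : ∀ a n, 0 ≤ r a n) (hδ0 : ∀ a, 0 ≤ δ₀ a)
    (hρ : ρ' < ρ) (hc : ρ' < c)
    (h : ∀ a n, δ a n ≤ m a n * δ₀ a +
      ∑ k ∈ Finset.range n, m (a + (k + 1 : ℕ)) (n - 1 - k) * r a k) :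
    ExpBd ρ' δ := by
  have h1 : ExpBd ρ' fun a n => m a n * δ₀ a :=
    (hm.mul hδ₀.expBd_start fun _ _ => hδ0 _).weaken (by linarith)
  refine ExpBd.mono (h1.add ?_) h
  intro ε hε
  -- A summand decays for n - 1 - k steps at rate `c` and for k steps at rate `ρ`, hence at rate
  -- `b`, up to a factor exp(b) for the missing step. The gap b - ρ' pays for 2η: one η for the
  -- growth in the starting times, one for the number n of summands through n ≤ exp(ηn)/η.
  set b := min c ρ with hb
  have hb' : ρ' < b := lt_min hc hρ
  set η := min (ε / 2) ((b - ρ') / 2) with hη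
  have hη0 : 0 < η := lt_min (by linarith) (by linarith)
  have hη1 : η ≤ ε / 2 := min_le_left _ _
  have hη2 : η ≤ (b - ρ') / 2 := min_le_right _ _
  obtain ⟨C, hC0, hC⟩ := hm.bound hη0
  obtain ⟨D, hD0, hD⟩ := hr.bound hη0
  refine ⟨C * D * Real.exp b / η, fun a n => ?_⟩
  have hterm : ∀ k ∈ Finset.range n, m (a + (k + 1 : ℕ)) (n - 1 - k) * r a k ≤
      C * D * Real.exp (b + ε * |(a : ℝ)| + η * n - b * n) := by
    intro k hk
    have hk' : k + 1 ≤ n := Finset.mem_range.1 hk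
    refine (mul_le_mul (hC _ _) (hD a k) (hr0 a k) (by positivity)).trans ?_
    rw [mul_mul_mul_comm, ← Real.exp_add]
    gcongr
    have e1 := abs_cast_add_le a (k + 1)
    have e2 : ((n - 1 - k : ℕ) : ℝ) = n - 1 - k := by
      rw [Nat.cast_sub (by omega), Nat.cast_sub (by omega)]; simp
    have hk2 : (k : ℝ) + 1 ≤ n := by exact_mod_cast hk'
    have e3 : η * |((a + (k + 1 : ℕ) : ℤ) : ℝ)| ≤ η * (|(a : ℝ)| + n) := by
      gcongr
      refine e1.trans ?_
      push_cast
      linarith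
    have e4 : b * ((n : ℝ) - 1 - k) ≤ c * ((n : ℝ) - 1 - k) :=
      mul_le_mul_of_nonneg_right (min_le_left _ _) (by linarith)
    have e5 : b * (k : ℝ) ≤ ρ * k := mul_le_mul_of_nonneg_right (min_le_right _ _) (by positivity)
    have e6 : 2 * η * |(a : ℝ)| ≤ ε * |(a : ℝ)| := by gcongr; linarith
    rw [e2]
    nlinarith
  refine (Finset.sum_le_sum hterm).trans ?_
  rw [Finset.sum_const, Finset.card_range, nsmul_eq_mul]
  have hn : (n : ℝ) ≤ Real.exp (η * n) / η := by
    rw [le_div_iff₀ hη0]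
    have := Real.add_one_le_exp (η * n)
    linarith
  calc (n : ℝ) * (C * D * Real.exp (b + ε * |(a : ℝ)| + η * n - b * n))
      ≤ Real.exp (η * n) / η * (C * D * Real.exp (b + ε * |(a : ℝ)| + η * n - b * n)) := by
        gcongr
    _ = C * D / η * Real.exp (b + ε * |(a : ℝ)| + 2 * η * n - b * n) := by
        rw [show b + ε * |(a : ℝ)| + 2 * η * n - b * n =
          η * n + (b + ε * |(a : ℝ)| + η * n - b * n) by ring, Real.exp_add (η * n)]
        ring
    _ ≤ C * D / η * Real.exp (b + (ε * |(a : ℝ)| - ρ' * n)) := by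
        gcongr
        have : 2 * η * (n : ℝ) ≤ (b - ρ') * n := by gcongr; linarith
        linarith
    _ = C * D * Real.exp b / η * Real.exp (ε * |(a : ℝ)| - ρ' * n) := by
        rw [Real.exp_add]; ring

/-! ### Orbits of contractive random maps -/

section Orbit

variable {Y : Type*}

/-- `φ_{a+n-1} ∘ ⋯ ∘ φ_a`. -/
def flow (φ : ℤ → Y → Y) (a : ℤ) : ℕ → Y → Y
  | 0 => id
  | n + 1 => φ (a + n) ∘ flow φ a n

theorem flow_succ_apply (φ : ℤ → Y → Y) (a : ℤ) (n : ℕ) (y : Y) :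
    flow φ a (n + 1) y = φ (a + n) (flow φ a n y) := rfl

theorem flow_add (φ : ℤ → Y → Y) (a : ℤ) (k n : ℕ) :
    flow φ a (k + n) = flow φ (a + k) n ∘ flow φ a k := by
  induction n with
  | zero => rfl
  | succ n ih =>
    funext y
    rw [← add_assoc, flow_succ_apply, ih]
    simp only [Function.comp_apply, flow_succ_apply]
    congr 1
    push_cast
    ring

theorem flow_succ' (φ : ℤ → Y → Y) (a : ℤ) (n : ℕ) (y : Y) :
    flow φ a (n + 1) y = flow φ (a + 1) n (φ a y) := by
  have := congrFun (flow_add φ a 1 n) y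
  rw [add_comm 1 n] at this
  rw [this]
  simp [flow]

theorem flow_orbit {φ : ℤ → Y → Y} {y : ℤ → Y} (hy : ∀ t, y (t + 1) = φ t (y t)) (a : ℤ)
    (n : ℕ) : flow φ a n (y a) = y (a + n) := by
  induction n with
  | zero => simp [flow]
  | succ n ih =>
    rw [flow_succ_apply, ih, ← hy]
    congr 1
    push_cast
    ring

/-- Existence of a tempered orbit, as the limit of the backward iterates. -/
theorem exists_tempered_orbit [MetricSpace Y] [CompleteSpace Y] {φ : ℤ → Y → Y} {c : ℝ}
    (hc : 0 < c) {m : ℤ → ℕ → ℝ} (hm : ExpBd c m)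
    (hlip : ∀ a n y y', dist (flow φ a n y) (flow φ a n y') ≤ m a n * dist y y') (y₀ : Y)
    (h0 : Tempered fun t => dist (φ t y₀) y₀) :
    ∃ y : ℤ → Y, (∀ t, y (t + 1) = φ t (y t)) ∧ Tempered (fun t => dist (y t) y₀) ∧
      ∀ t, Tendsto (fun n : ℕ => flow φ (t - n) n y₀) atTop (𝓝 (y t)) := by
  -- Consecutive backward iterates are images, under the same n-step map, of `y₀` and of its image
  -- under one map. Their distance is geometric in n with a constant subexponential in t, which
  -- gives both convergence and temperedness of the limit. Two factors with exponent η(|t| + n)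
  -- arise, hence the choices ε/2 and c/4 below.
  have hstep : ∀ ε > 0, ∃ C, 0 ≤ C ∧ ∀ (t : ℤ) (n : ℕ),
      dist (flow φ (t - n) n y₀) (flow φ (t - (n + 1 : ℕ)) (n + 1) y₀) ≤
        C * Real.exp (ε * |(t : ℝ)|) * Real.exp (-(c / 2)) ^ n := by
    intro ε hε
    set η := min (ε / 2) (c / 4) with hη
    have hη0 : 0 < η := lt_min (by linarith) (by linarith)
    obtain ⟨C, hC0, hC⟩ := hm.bound hη0
    obtain ⟨D, hD0, hD⟩ := h0.shift_pred.bound hη0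
    refine ⟨C * D, by positivity, fun t n => ?_⟩
    have e1 : flow φ (t - (n + 1 : ℕ)) (n + 1) y₀ = flow φ (t - n) n (φ (t - n - 1) y₀) := by
      have e2 : t - ((n + 1 : ℕ) : ℤ) = t - n - 1 := by push_cast; ring
      rw [flow_succ', e2, sub_add_cancel]
    rw [e1, dist_comm]
    refine (hlip _ _ _ _).trans ?_
    refine (mul_le_mul (hC _ _) (hD (t - n)) dist_nonneg (by positivity)).trans ?_
    rw [← Real.exp_nat_mul, mul_assoc (C * D), ← Real.exp_add (ε * _), mul_mul_mul_comm,
      ← Real.exp_add (_ - _)]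
    refine mul_le_mul_of_nonneg_left (Real.exp_le_exp.2 ?_) (by positivity)
    have h1 : |((t - n : ℤ) : ℝ)| ≤ |(t : ℝ)| + n := by
      push_cast
      exact (abs_sub _ _).trans (by simp)
    have h2 : η * |((t - n : ℤ) : ℝ)| ≤ η * (|(t : ℝ)| + n) := by gcongr
    have h3 : η * |(t : ℝ)| ≤ ε / 2 * |(t : ℝ)| := by gcongr; exact min_le_left _ _
    have h4 : η * (n : ℝ) ≤ c / 4 * n := by gcongr; exact min_le_right _ _
    nlinarith
  have hr : Real.exp (-(c / 2)) < 1 := Real.exp_lt_one_iff.2 (by linarith)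
  have hlim : ∀ t, ∃ z, Tendsto (fun n : ℕ => flow φ (t - n) n y₀) atTop (𝓝 z) := fun t => by
    obtain ⟨C, -, hC⟩ := hstep 1 one_pos
    exact cauchySeq_tendsto_of_complete (cauchySeq_of_le_geometric _ _ hr (hC t))
  choose y hy using hlim
  refine ⟨y, fun t => ?_, fun ε hε => ?_, hy⟩
  -- The one-step Lipschitz bound allows the limit to pass through `φ t`, so the limit is an orbit.
  · have hcont : Continuous (φ t) := by
      have h1 : ∀ y y', dist (φ t y) (φ t y') ≤ m t 1 * dist y y' := fun y y' => by
        simpa [flow] using hlip t 1 y y'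
      have h2 : LipschitzWith (Real.toNNReal (m t 1)) (φ t) :=
        LipschitzWith.of_dist_le_mul fun y y' => (h1 y y').trans
          (mul_le_mul_of_nonneg_right (Real.le_coe_toNNReal _) dist_nonneg)
      exact h2.continuous
    have h1 := (hcont.tendsto _).comp (hy t)
    have h2 := (hy (t + 1)).comp (tendsto_add_atTop_nat 1)
    refine tendsto_nhds_unique h2 (h1.congr fun n => ?_)
    simp only [Function.comp_apply]
    rw [flow_succ_apply]
    have : t + 1 - ((n + 1 : ℕ) : ℤ) = t - n := by push_cast; ring
    rw [this]
    congr 1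
    ring
  · obtain ⟨C, hC0, hC⟩ := hstep ε hε
    refine ⟨C / (1 - Real.exp (-(c / 2))), fun t => ?_⟩
    have := dist_le_of_le_geometric_of_tendsto₀ _ _ hr (hC t) (hy t)
    change dist (y t) y₀ ≤ _
    rw [dist_comm]
    refine this.trans (le_of_eq ?_)
    ring

end Orbit

/-! ### Linear recursions -/

/-- A linear action of the endomorphisms of `ℝ^q` on `W`, contractive with respect to the
operator norm. -/
structure MatAct (q : ℕ) (W : Type*) [NormedAddCommGroup W] where
  act : (E q →L[ℝ] E q) → W → W
  id_act : ∀ w, act (ContinuousLinearMap.id ℝ _) w = w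
  comp_act : ∀ J J' w, act (J.comp J') w = act J (act J' w)
  act_add : ∀ J w w', act J (w + w') = act J w + act J w'
  sub_act : ∀ J J' w, act (J - J') w = act J w - act J' w
  norm_le : ∀ J w, ‖act J w‖ ≤ ‖J‖ * ‖w‖

/-- `J_{n-1} ⋯ J_0`. -/
def jprod {q : ℕ} (J : ℕ → E q →L[ℝ] E q) : ℕ → E q →L[ℝ] E q
  | 0 => ContinuousLinearMap.id ℝ _
  | n + 1 => (J n).comp (jprod J n)

namespace MatAct

variable {q : ℕ} {W : Type*} [NormedAddCommGroup W] (A : MatAct q W)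

theorem act_sub (J : E q →L[ℝ] E q) (w w' : W) : A.act J (w - w') = A.act J w - A.act J w' := by
  have := A.act_add J (w - w') w'
  rw [sub_add_cancel] at this
  rw [this, add_sub_cancel_right]

theorem act_zero (J : E q →L[ℝ] E q) : A.act J 0 = 0 := by
  have := A.act_sub J 0 0
  rwa [sub_zero, sub_self] at this

theorem norm_act_sub_le (J J' : E q →L[ℝ] E q) (w : W) :
    ‖A.act J w - A.act J' w‖ ≤ ‖J - J'‖ * ‖w‖ := by
  rw [← A.sub_act]; exact A.norm_le _ _

theorem homogeneous {J : ℕ → E q →L[ℝ] E q} {δ : ℕ → W} (h : ∀ n, δ (n + 1) = A.act (J n) (δ n))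
    (n : ℕ) : δ n = A.act (jprod J n) (δ 0) := by
  induction n with
  | zero => rw [jprod, A.id_act]
  | succ n ih => rw [h, jprod, A.comp_act, ← ih]

/-- Variation of constants: the error made at step k is propagated by J_{n-1} ⋯ J_{k+1}. Only k < n
occurs, so the natural subtraction is exact. -/
theorem variation {J : ℕ → E q →L[ℝ] E q} {δ r : ℕ → W}
    (h : ∀ n, δ (n + 1) = A.act (J n) (δ n) + r n) (n : ℕ) :
    δ n = A.act (jprod J n) (δ 0) +
      ∑ k ∈ Finset.range n, A.act (jprod (fun i => J (k + 1 + i)) (n - 1 - k)) (r k) := by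
  induction n with
  | zero => simp [jprod, A.id_act]
  | succ n ih =>
    have hsum : ∀ s : Finset ℕ, ∀ f : ℕ → W, A.act (J n) (∑ k ∈ s, f k) =
        ∑ k ∈ s, A.act (J n) (f k) := fun s f =>
      map_sum (AddMonoidHom.mk' (A.act (J n)) (A.act_add _)) f s
    rw [h, ih, A.act_add, Finset.sum_range_succ, hsum, jprod, A.comp_act, add_assoc]
    congr 2
    · refine Finset.sum_congr rfl fun k hk => ?_
      have hk' := Finset.mem_range.1 hk
      rw [← A.comp_act]
      have e1 : n + 1 - 1 - k = (n - 1 - k) + 1 := by omega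
      rw [e1, jprod]
      congr 3
      omega
    · simp [jprod, A.id_act]

theorem norm_variation_le {J : ℕ → E q →L[ℝ] E q} {δ r : ℕ → W}
    (h : ∀ n, δ (n + 1) = A.act (J n) (δ n) + r n) (n : ℕ) :
    ‖δ n‖ ≤ ‖jprod J n‖ * ‖δ 0‖ +
      ∑ k ∈ Finset.range n, ‖jprod (fun i => J (k + 1 + i)) (n - 1 - k)‖ * ‖r k‖ := by
  rw [A.variation h n]
  refine (norm_add_le _ _).trans (add_le_add (A.norm_le _ _) ?_)
  exact (norm_sum_le _ _).trans (Finset.sum_le_sum fun k _ => A.norm_le _ _)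

end MatAct

end CHModel

end

noncomputable section

namespace CHModel

/-! ### Products of Jacobians along trajectories -/

theorem dist_le_lipCoeff {S : Type*} [MetricSpace S] {φ : S → S} (h : lipCoeff φ ≠ ∞) (x y : S) :
    dist (φ x) (φ y) ≤ (lipCoeff φ).toReal * dist x y := by
  by_cases hxy : x = y
  · subst hxy; simp
  have h1 : edist (φ x) (φ y) / edist x y ≤ lipCoeff φ :=
    le_iSup_of_le x (le_iSup_of_le y (le_iSup_of_le hxy le_rfl))
  have h2 : edist (φ x) (φ y) ≤ lipCoeff φ * edist x y :=
    (ENNReal.div_le_iff (by simpa using hxy) (edist_ne_top _ _)).1 h1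
  rw [dist_edist, dist_edist, ← ENNReal.toReal_mul]
  exact ENNReal.toReal_mono (ENNReal.mul_ne_top h (edist_ne_top _ _)) h2

/-- The action on `ℝ^q`. -/
def actV (q : ℕ) : MatAct q (E q) where
  act J w := J w
  id_act _ := rfl
  comp_act _ _ _ := rfl
  act_add J w w' := map_add J w w'
  sub_act _ _ _ := rfl
  norm_le J w := J.le_opNorm w

/-- The action on first derivatives. -/
def actD (d q : ℕ) : MatAct q (Family.W1 d q) where
  act J w := J.comp w
  id_act _ := rfl
  comp_act _ _ _ := rfl
  act_add J w w' := ContinuousLinearMap.comp_add J w w'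
  sub_act J J' w := ContinuousLinearMap.sub_comp J J' w
  norm_le J w := ContinuousLinearMap.opNorm_comp_le J w

/-- The action on second derivatives. -/
def actE (d q : ℕ) : MatAct q (Family.W2 d q) where
  act J w := Family.act2 J w
  id_act _ := rfl
  comp_act _ _ _ := rfl
  act_add J w w' := ContinuousLinearMap.comp_add _ w w'
  sub_act J J' w := by
    ext v v'
    rfl
  norm_le J w := by
    refine ContinuousLinearMap.opNorm_le_bound _ (by positivity) fun v => ?_
    refine (ContinuousLinearMap.opNorm_comp_le J (w v)).trans ?_
    rw [mul_assoc]
    gcongr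
    exact w.le_opNorm v

variable {d p q : ℕ}

namespace Family

variable {M : Family d p q}

/-- The random maps `Φ_t` along the path `x`. -/
def sys (M : Family d p q) (x : ℤ → ℝ) (t : ℤ) : M.H → M.H := M.Phi (lags x t)

theorem PhiIter_eq_flow (x : ℤ → ℝ) (r : ℕ) (t : ℤ) :
    M.PhiIter x r t = flow (M.sys x) (t - r + 1) r := by
  induction r generalizing t with
  | zero => rfl
  | succ r ih =>
    rw [PhiIter, ih, flow]
    have e1 : t - ((r + 1 : ℕ) : ℤ) + 1 = t - r := by push_cast; ring
    have e2 : t - 1 - (r : ℤ) + 1 = t - r := by ring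
    rw [e1, e2, sub_add_cancel]
    rfl

theorem lags_translate {n : ℕ} (x : ℤ → ℝ) (a t : ℤ) :
    (lags (fun s => x (s + a)) t : Fin n → ℝ) = lags x (a + t) := by
  funext i
  simp only [lags]
  congr 1
  ring

theorem hHat_translate (x : ℤ → ℝ) (ς : orthant q) (a : ℤ) (n : ℕ) :
    M.hHat (fun s => x (s + a)) ς n = flow (M.sys x) a n (ContinuousMap.const _ ς) := by
  induction n with
  | zero => rfl
  | succ n ih => rw [hHat, ih, lags_translate]; rfl

theorem sys_translate (x : ℤ → ℝ) (a t : ℤ) : M.sys (fun s => x (s + a)) t = M.sys x (a + t) := by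
  rw [sys, sys, lags_translate]

/-- The trajectory, started at time `a` in `u`, of the recursion with parameter `θ`, as a function
of `(θ, u)`. -/
def traj (M : Family d p q) (x : ℤ → ℝ) (a : ℤ) : ℕ → E d × E q → E q
  | 0, z => z.2
  | n + 1, z => M.psiV (lags x (a + n)) (z.1, traj M x a n z)

/-- The derivative of the trajectory. -/
def trajD (M : Family d p q) (x : ℤ → ℝ) (a : ℤ) : ℕ → E d × E q → E d × E q →L[ℝ] E q
  | 0, _ => ContinuousLinearMap.snd ℝ _ _
  | n + 1, z => (M.psi1 (lags x (a + n)) (z.1, traj M x a n z)).comp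
      ((ContinuousLinearMap.fst ℝ _ _).prod (trajD M x a n z))

theorem flow_eq_traj (x : ℤ → ℝ) (a : ℤ) (n : ℕ) (s : M.H) (θ : M.K) :
    (flow (M.sys x) a n s θ : E q) = M.traj x a n (θ, s θ) := by
  induction n with
  | zero => rfl
  | succ n ih => rw [flow_succ_apply, traj, ← ih]; rfl

theorem hasC1_traj (hM : M.Regular) (x : ℤ → ℝ) (a : ℤ) (n : ℕ) :
    HasC1 M.dom (M.traj x a n) (M.trajD x a n) ∧ MapsTo (M.traj x a n) M.dom (orthant q) := by
  induction n with
  | zero => exact ⟨(hasC1_clm M.dom (ContinuousLinearMap.snd ℝ (E d) (E q))).congr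
      (fun _ _ => rfl) (fun _ _ => rfl), fun z hz => hz.2⟩
  | succ n ih =>
    refine ⟨?_, fun z hz => M.step_mem (M.K_subset hz.1) _ (ih.2 hz)⟩
    refine (hM.hasC1_psiV (lags x (a + n))).comp (convex_orthant q) (isClosed_orthant q)
      (orthant_subset_closure_interior q)
      ((hasC1_clm M.dom (ContinuousLinearMap.fst ℝ (E d) (E q))).prodMk ih.1)
      (fun z hz => ⟨hz.1, ih.2 hz⟩) fun z hz => ?_
    unfold dom at hz
    rw [interior_prod_eq] at hz
    exact hz.1

/-- Differentiating in the initial state leaves θ fixed, so the chain rule produces a pure product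
of state Jacobians. -/
theorem jac_trajD (x : ℤ → ℝ) (a : ℤ) (n : ℕ) (z : E d × E q) :
    jac (M.trajD x a n z) =
      jprod (fun k => jac (M.psi1 (lags x (a + k)) (z.1, M.traj x a k z))) n := by
  induction n with
  | zero => rfl
  | succ n ih =>
    rw [jprod, ← ih]
    rfl

/-- This is where contraction passes to the derivatives. Two constant functions u and v are at
distance at most |u - v|, and their images at θ are the trajectories from u and v. So the trajectory
is Lipschitz in its initial state with the coefficient of the iterate, and its derivative is bounded
by the same number. -/
theorem norm_jac_trajD_le (hM : M.Regular) (x : ℤ → ℝ) (a : ℤ) (n : ℕ)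
    (hL : lipCoeff (flow (M.sys x) a n) ≠ ∞) {z : E d × E q} (hz : z ∈ M.dom) :
    ‖jac (M.trajD x a n z)‖ ≤ (lipCoeff (flow (M.sys x) a n)).toReal := by
  have hint : ∀ z ∈ interior M.dom,
      ‖jac (M.trajD x a n z)‖ ≤ (lipCoeff (flow (M.sys x) a n)).toReal := by
    rintro ⟨θ, u⟩ hz
    have h1 := (hasC1_traj hM x a n).1.deriv _ hz
    have h2 : HasFDerivAt (fun v => M.traj x a n (θ, v)) (jac (M.trajD x a n (θ, u))) u :=
      h1.comp u (hasFDerivAt_prodMk_right θ u)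
    unfold dom at hz
    rw [interior_prod_eq] at hz
    refine h2.le_of_lip' ENNReal.toReal_nonneg ?_
    filter_upwards [isOpen_interior.mem_nhds hz.2] with v hv
    have hθ : θ ∈ M.K := interior_subset hz.1
    have h3 := dist_le_lipCoeff hL (ContinuousMap.const M.K (⟨v, interior_subset hv⟩ : orthant q))
      (ContinuousMap.const M.K (⟨u, interior_subset hz.2⟩ : orthant q))
    have h4 := (ContinuousMap.dist_apply_le_dist (⟨θ, hθ⟩ : M.K)).trans h3
    rw [Subtype.dist_eq, flow_eq_traj, flow_eq_traj, dist_eq_norm] at h4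
    refine h4.trans ?_
    gcongr
    rw [ContinuousMap.dist_le (norm_nonneg _)]
    intro θ'
    rw [Subtype.dist_eq, dist_eq_norm]
    rfl
  -- The bound extends to boundary points of the domain by continuity of the derivative.
  have := mem_closure_iff_nhdsWithin_neBot.1 (hM.dom_subset hz)
  have hc : Tendsto (fun y => ‖jac (M.trajD x a n y)‖) (𝓝[interior M.dom] z)
      (𝓝 ‖jac (M.trajD x a n z)‖) :=
    ((continuous_norm.comp continuous_jac).tendsto _).comp
      (((hasC1_traj hM x a n).1.cont' z hz).mono_left (nhdsWithin_mono _ interior_subset))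
  exact le_of_tendsto hc (by filter_upwards [self_mem_nhdsWithin] with y hy using hint y hy)

/-- The Jacobians of `Φ_{a+k}` along the trajectory started at time `a` in `s`. -/
def jacs (hM : M.Regular) (x : ℤ → ℝ) (a : ℤ) (s : M.H) (θ : M.K) (k : ℕ) : E q →L[ℝ] E q :=
  jac (along1 hM (lags x (a + k)) (flow (M.sys x) a k s) θ)

theorem jacs_add (hM : M.Regular) (x : ℤ → ℝ) (a : ℤ) (s : M.H) (θ : M.K) (k i : ℕ) :
    jacs hM x a s θ (k + i) = jacs hM x (a + k) (flow (M.sys x) a k s) θ i := by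
  rw [jacs, jacs, flow_add]
  congr 3
  push_cast
  ring_nf

theorem norm_jprod_jacs_le (hM : M.Regular) (x : ℤ → ℝ) (a : ℤ) (n : ℕ)
    (hL : lipCoeff (flow (M.sys x) a n) ≠ ∞) (s : M.H) (θ : M.K) :
    ‖jprod (jacs hM x a s θ) n‖ ≤ (lipCoeff (flow (M.sys x) a n)).toReal := by
  have h1 : jacs hM x a s θ =
      fun k : ℕ => jac (M.psi1 (lags x (a + k)) ((θ : E d), M.traj x a k (θ, s θ))) := by
    funext k
    rw [← flow_eq_traj]
    rfl
  rw [h1]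
  have h2 := norm_jac_trajD_le hM x a n hL (z := ((θ : E d), (s θ : E q))) ⟨θ.2, (s θ).2⟩
  rwa [jac_trajD] at h2

/-- A tail of the Jacobians along a trajectory consists of the Jacobians along the trajectory
restarted at its position at time a + k. The bound does not depend on that position; it feeds the
sum in the variation of constants. -/
theorem norm_jprod_jacs_shift_le (hM : M.Regular) (x : ℤ → ℝ) (a : ℤ) (k n : ℕ)
    (hL : lipCoeff (flow (M.sys x) (a + k) n) ≠ ∞) (s : M.H) (θ : M.K) :
    ‖jprod (fun i => jacs hM x a s θ (k + i)) n‖ ≤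
      (lipCoeff (flow (M.sys x) (a + k) n)).toReal := by
  have h1 : (fun i => jacs hM x a s θ (k + i)) = jacs hM x (a + k) (flow (M.sys x) a k s) θ :=
    funext fun i => jacs_add hM x a s θ k i
  rw [h1]
  exact norm_jprod_jacs_le hM x _ n hL _ θ

end Family

end CHModel

end

noncomputable section

namespace CHModel

namespace Family

variable {d p q : ℕ} {M : Family d p q}

/-! ### Analysis along a fixed path -/

instance instCompleteSpaceW2 : CompleteSpace (W2 d q) :=
  have : CompleteSpace (E d →L[ℝ] E q) := inferInstance
  inferInstanceAs (CompleteSpace (E d →L[ℝ] (E d →L[ℝ] E q)))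

theorem norm_nonneg_map {W : Type*} [NormedAddCommGroup W] (f : C(M.K, W)) : 0 ≤ ‖f‖ :=
  norm_nonneg f

theorem norm_sub_apply_le {W : Type*} [NormedAddCommGroup W] (f g : C(M.K, W)) (θ : M.K) :
    ‖f θ - g θ‖ ≤ ‖f - g‖ := ContinuousMap.norm_coe_le_norm (f - g) θ

/-- The Lipschitz coefficients of the iterates along the path `x`, as real numbers. -/
def lipR (M : Family d p q) (x : ℤ → ℝ) (a : ℤ) (n : ℕ) : ℝ :=
  (lipCoeff (flow (M.sys x) a n)).toReal

theorem lipR_nonneg (x : ℤ → ℝ) (a : ℤ) (n : ℕ) : 0 ≤ M.lipR x a n := ENNReal.toReal_nonneg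

/-- A path `x` of the observations along which the maps `Φ_t` contract exponentially. -/
structure Contracting (M : Family d p q) (x : ℤ → ℝ) (c : ℝ) : Prop where
  pos : 0 < c
  finite : ∀ a n, lipCoeff (flow (M.sys x) a n) ≠ ∞
  bound : ExpBd c (M.lipR x)

/-- A path `x` and an orbit `h` along which the growth and Hölder conditions on the derivatives
of `ψ` hold. -/
structure GoodPath (hM : M.Regular) (ς : orthant q) (x : ℤ → ℝ) (h : ℤ → M.H) (c κ κ' : ℝ) :
    Prop extends Contracting M x c where
  orbit : ∀ t, h (t + 1) = M.sys x t (h t)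
  init : Tempered fun t => dist (h t) (ContinuousMap.const _ ς)
  psi1 : Tempered fun t => ‖along1 hM (lags x t) (h t)‖
  psi2 : Tempered fun t => ‖along2 hM (lags x t) (h t)‖
  κ_pos : 0 < κ
  κ_le : κ ≤ 1
  κ'_pos : 0 < κ'
  κ'_le : κ' ≤ 1
  holder1 : ∃ C : ℤ → ℝ, Tempered C ∧ (∀ t, 0 ≤ C t) ∧ ∀ t s s',
    ‖along1 hM (lags x t) s - along1 hM (lags x t) s'‖ ≤ C t * dist s s' ^ κ
  holder2 : ∃ C : ℤ → ℝ, Tempered C ∧ (∀ t, 0 ≤ C t) ∧ ∀ t s s',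
    ‖along2 hM (lags x t) s - along2 hM (lags x t) s'‖ ≤ C t * dist s s' ^ κ'

theorem jacs_orbit (hM : M.Regular) {x : ℤ → ℝ} {h : ℤ → M.H}
    (horb : ∀ t, h (t + 1) = M.sys x t (h t)) (a : ℤ) (θ : M.K) (n : ℕ) :
    jacs hM x a (h a) θ n = jac (along1 hM (lags x (a + n)) (h (a + n)) θ) := by
  rw [jacs, flow_orbit horb]

section Linear

variable {W : Type*} [NormedAddCommGroup W] (A : MatAct q W)

/-- The difference of two solutions of an affine recursion solves the homogeneous one, and the
products of Jacobians along the orbit are bounded uniformly in θ. So each affine derivative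
recursion contracts like Φ itself. -/
theorem Contracting.dist_flow_le (hM : M.Regular) {x : ℤ → ℝ} {c : ℝ} (hx : Contracting M x c)
    {h : ℤ → M.H} (horb : ∀ t, h (t + 1) = M.sys x t (h t))
    {φ : ℤ → C(M.K, W) → C(M.K, W)}
    (hφ : ∀ t y y' θ, φ t y θ - φ t y' θ =
      A.act (jac (along1 hM (lags x t) (h t) θ)) (y θ - y' θ)) (a : ℤ) (n : ℕ)
    (y y' : C(M.K, W)) :
    dist (flow φ a n y) (flow φ a n y') ≤ M.lipR x a n * dist y y' := by
  rw [ContinuousMap.dist_le (mul_nonneg (lipR_nonneg _ _ _) dist_nonneg)]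
  intro θ
  have h1 := A.homogeneous (J := jacs hM x a (h a) θ)
    (δ := fun n => flow φ a n y θ - flow φ a n y' θ)
    (fun n => by rw [flow_succ_apply, flow_succ_apply, hφ, jacs_orbit hM horb]) n
  rw [dist_eq_norm, h1]
  refine (A.norm_le _ _).trans ?_
  gcongr
  · exact lipR_nonneg _ _ _
  · exact norm_jprod_jacs_le hM x a n (hx.finite a n) _ θ
  · rw [← dist_eq_norm]
    exact ContinuousMap.dist_apply_le_dist θ

/-- With J' the Jacobian along the approximation and J the one along the orbit, J'e' + B' - (Je + B)
= J'(e' - e) + (J' - J)e + (B' - B). The homogeneous part is taken along the approximation, where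
Jacobian products are equally controlled, and the remaining terms are exponentially small. -/
theorem GoodPath.perturbation {hM : M.Regular} {ς : orthant q} {x : ℤ → ℝ} {h : ℤ → M.H}
    {c κ κ' : ℝ} (hg : GoodPath hM ς x h c κ κ') {e : ℤ → C(M.K, W)} {e' : ℤ → ℕ → C(M.K, W)}
    {B : ℤ → M.K → W} {B' : ℤ → ℕ → M.K → W} {r : ℤ → ℕ → ℝ} {ρ ρ₁ ρ' : ℝ}
    (he : ∀ t θ, e (t + 1) θ = A.act (jac (along1 hM (lags x t) (h t) θ)) (e t θ) + B t θ)
    (he' : ∀ a n θ, e' a (n + 1) θ = A.act (jacs hM x a (ContinuousMap.const _ ς) θ n) (e' a n θ)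
      + B' a n θ)
    (h0 : ∀ a, e' a 0 = 0) (het : Tempered fun t => ‖e t‖) (hr0 : ∀ a n, 0 ≤ r a n)
    (hr : ExpBd ρ r) (hB : ∀ a n θ, ‖B' a n θ - B (a + n) θ‖ ≤ r a n)
    (hJ : ExpBd ρ₁ fun a n => ‖along1 hM (lags x (a + n)) (flow (M.sys x) a n
      (ContinuousMap.const _ ς)) - along1 hM (lags x (a + n)) (h (a + n))‖)
    (hρ : ρ' < ρ) (hρ₁ : ρ' < ρ₁) (hc : ρ' < c) :
    ExpBd ρ' fun a n => ‖e' a n - e (a + n)‖ := by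
  -- The midpoint of ρ' and ρ₁ leaves room below for the final rate and above for the tempered
  -- factor ‖e‖.
  have hr' := (hJ.mul_end het (fun _ => norm_nonneg _)
    (show (ρ' + ρ₁) / 2 < ρ₁ by linarith)).weaken (min_le_left ((ρ' + ρ₁) / 2) ρ)
  have hr'' := hr'.add (hr.weaken (min_le_right ((ρ' + ρ₁) / 2) ρ))
  refine ExpBd.of_sum_le hg.bound hr'' het (fun a n => by have := hr0 a n; positivity)
    (fun _ => norm_nonneg _) (lt_min (by linarith) hρ) hc fun a n => ?_
  have hnn : 0 ≤ M.lipR x a n * ‖e a‖ + ∑ k ∈ Finset.range n,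
      M.lipR x (a + (k + 1 : ℕ)) (n - 1 - k) *
      (‖along1 hM (lags x (a + k)) (flow (M.sys x) a k (ContinuousMap.const _ ς)) -
        along1 hM (lags x (a + k)) (h (a + k))‖ * ‖e (a + k)‖ + r a k) := by
    have := lipR_nonneg (M := M) x
    exact add_nonneg (mul_nonneg (this _ _) (norm_nonneg _)) (Finset.sum_nonneg fun k _ =>
      mul_nonneg (this _ _) (by have := hr0 a k; positivity))
  rw [ContinuousMap.norm_le _ hnn]
  intro θ
  have h1 := A.norm_variation_le (J := jacs hM x a (ContinuousMap.const _ ς) θ)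
    (δ := fun n => e' a n θ - e (a + n) θ)
    (r := fun n => A.act (jacs hM x a (ContinuousMap.const _ ς) θ n) (e (a + n) θ) -
      A.act (jac (along1 hM (lags x (a + n)) (h (a + n)) θ)) (e (a + n) θ) +
        (B' a n θ - B (a + n) θ)) (fun n => by
      have e1 : a + ((n + 1 : ℕ) : ℤ) = a + n + 1 := by push_cast; ring
      rw [he', e1, he, A.act_sub]
      abel) n
  refine h1.trans (add_le_add ?_ (Finset.sum_le_sum fun k _ => ?_))
  · gcongr
    · exact lipR_nonneg _ _ _
    · exact norm_jprod_jacs_le hM x a n (hg.finite a n) _ θ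
    -- The approximation starts at zero, so the initial error is ‖e a‖, which is tempered.
    · simp only [h0, Nat.cast_zero, add_zero, ContinuousMap.zero_apply, zero_sub, norm_neg]
      exact (e a).norm_coe_le_norm θ
  · gcongr
    · exact lipR_nonneg _ _ _
    · exact norm_jprod_jacs_shift_le hM x a (k + 1) _ (hg.finite _ _) _ θ
    · refine (norm_add_le _ _).trans (add_le_add ?_ (hB a k θ))
      refine (A.norm_act_sub_le _ _ _).trans ?_
      gcongr
      · have e2 : jacs hM x a (ContinuousMap.const _ ς) θ k -
            jac (along1 hM (lags x (a + k)) (h (a + k)) θ) =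
            ((along1 hM (lags x (a + k)) (flow (M.sys x) a k (ContinuousMap.const _ ς)) -
              along1 hM (lags x (a + k)) (h (a + k))) θ).comp
                (ContinuousLinearMap.inr ℝ (E d) (E q)) := by
          ext; rfl
        rw [e2]
        refine (ContinuousLinearMap.opNorm_comp_le _ _).trans ?_
        refine (mul_le_of_le_one_right (norm_nonneg _)
          (ContinuousLinearMap.norm_inr_le_one ℝ (E d) (E q))).trans ?_
        exact ContinuousMap.norm_coe_le_norm _ θ
      · exact (e (a + k)).norm_coe_le_norm θ

end Linear

/-! ### Estimates for the coefficients of the derivative recursions -/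

theorem stepD_eq (hM : M.Regular) (x : Fin p → ℝ) (s : M.H) (a : C(M.K, W1 d q)) (θ : M.K) :
    stepD hM x s a θ = (actD d q).act (jac (along1 hM x s θ)) (a θ) +
      (along1 hM x s θ).comp (ContinuousLinearMap.inl ℝ (E d) (E q)) := by
  rw [stepD_apply, graphD, ContinuousLinearMap.comp_add, add_comm]
  rfl

theorem norm_graphD_le (a : W1 d q) : ‖graphD a‖ ≤ 1 + ‖a‖ := by
  refine (norm_add_le _ _).trans (add_le_add (ContinuousLinearMap.norm_inl_le_one ℝ _ _) ?_)
  refine (ContinuousLinearMap.opNorm_comp_le _ _).trans ?_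
  exact mul_le_of_le_one_left (norm_nonneg _) (ContinuousLinearMap.norm_inr_le_one ℝ _ _)

theorem norm_graphD_sub_le (a a' : W1 d q) : ‖graphD a - graphD a'‖ ≤ ‖a - a'‖ := by
  have h1 : graphD a - graphD a' = (ContinuousLinearMap.inr ℝ (E d) (E q)).comp (a - a') := by
    rw [graphD, graphD, add_sub_add_left_eq_sub, ContinuousLinearMap.comp_sub]
  rw [h1]
  refine (ContinuousLinearMap.opNorm_comp_le _ _).trans ?_
  exact mul_le_of_le_one_left (norm_nonneg _) (ContinuousLinearMap.norm_inr_le_one ℝ _ _)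

theorem norm_quad_le (B : E d × E q →L[ℝ] E d × E q →L[ℝ] E q) (L : E d →L[ℝ] E d × E q) :
    ‖quad B L‖ ≤ ‖B‖ * ‖L‖ * ‖L‖ := by
  refine ContinuousLinearMap.opNorm_le_bound₂ _ (by positivity) fun v w => ?_
  rw [quad_apply]
  refine (B.le_opNorm₂ _ _).trans ?_
  have h1 := L.le_opNorm v
  have h2 := L.le_opNorm w
  calc ‖B‖ * ‖L v‖ * ‖L w‖ ≤ ‖B‖ * (‖L‖ * ‖v‖) * (‖L‖ * ‖w‖) := by gcongr
    _ = _ := by ring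

/-- Telescoping: one of the three arguments of B(L, L) is changed at a time. -/
theorem norm_quad_sub_le (B B' : E d × E q →L[ℝ] E d × E q →L[ℝ] E q)
    (L L' : E d →L[ℝ] E d × E q) : ‖quad B' L' - quad B L‖ ≤
      ‖B' - B‖ * ‖L'‖ * ‖L'‖ + ‖B‖ * (‖L'‖ + ‖L‖) * ‖L' - L‖ := by
  refine ContinuousLinearMap.opNorm_le_bound₂ _ (by positivity) fun v w => ?_
  have e1 : (quad B' L' - quad B L) v w =
      (B' - B) (L' v) (L' w) + (B ((L' - L) v) (L' w) + B (L v) ((L' - L) w)) := by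
    simp only [sub_apply, quad_apply, map_sub]
    abel
  rw [e1]
  have f1 := (B' - B).le_opNorm₂ (L' v) (L' w)
  have f2 := B.le_opNorm₂ ((L' - L) v) (L' w)
  have f3 := B.le_opNorm₂ (L v) ((L' - L) w)
  have g1 := L'.le_opNorm v
  have g2 := L'.le_opNorm w
  have g3 := L.le_opNorm v
  have g4 := (L' - L).le_opNorm v
  have g5 := (L' - L).le_opNorm w
  calc _ ≤ ‖B' - B‖ * ‖L' v‖ * ‖L' w‖ +
        (‖B‖ * ‖(L' - L) v‖ * ‖L' w‖ + ‖B‖ * ‖L v‖ * ‖(L' - L) w‖) :=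
        (norm_add_le _ _).trans (add_le_add f1 ((norm_add_le _ _).trans (add_le_add f2 f3)))
    _ ≤ ‖B' - B‖ * (‖L'‖ * ‖v‖) * (‖L'‖ * ‖w‖) +
        (‖B‖ * (‖L' - L‖ * ‖v‖) * (‖L'‖ * ‖w‖) + ‖B‖ * (‖L‖ * ‖v‖) * (‖L' - L‖ * ‖w‖)) := by
        gcongr
    _ = _ := by ring

/-- The bound is arranged as a sum of products of a decaying factor (β or δ) with decaying or
tempered factors. Repeated summands replace the constant 2, so the rules for sums and products of
`ExpBd` apply verbatim. The estimate behind it is (1 + t + δ)² ≤ 2(1 + t)² + 2δ². -/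
theorem norm_quad_graphD_sub_le {B B' : E d × E q →L[ℝ] E d × E q →L[ℝ] E q} {a a' : W1 d q}
    {β b t δ : ℝ} (hB' : ‖B' - B‖ ≤ β) (hB : ‖B‖ ≤ b) (ha : ‖a‖ ≤ t) (ha' : ‖a' - a‖ ≤ δ) :
    ‖quad B' (graphD a') - quad B (graphD a)‖ ≤
      β * ((1 + t) * (1 + t)) + β * ((1 + t) * (1 + t)) + (β * (δ * δ) + β * (δ * δ)) +
        (δ * (b * (1 + t)) + δ * (b * (1 + t)) + δ * δ * b) := by
  have f3 : ‖graphD a‖ ≤ 1 + t := (norm_graphD_le _).trans (by linarith)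
  have f4 : ‖graphD a' - graphD a‖ ≤ δ := (norm_graphD_sub_le _ _).trans ha'
  have f5 : ‖graphD a'‖ ≤ 1 + t + δ := by
    have := norm_le_norm_add_norm_sub (graphD a) (graphD a')
    rw [norm_sub_rev] at this
    linarith
  have hβ0 : 0 ≤ β := (norm_nonneg _).trans hB'
  have hδ0 : 0 ≤ δ := (norm_nonneg _).trans ha'
  have ht0 : 0 ≤ t := (norm_nonneg _).trans ha
  have hb0 : 0 ≤ b := (norm_nonneg _).trans hB
  refine (norm_quad_sub_le _ _ _ _).trans ?_
  calc _ ≤ β * (1 + t + δ) * (1 + t + δ) + b * ((1 + t + δ) + (1 + t)) * δ := by gcongr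
    _ ≤ _ := by
      have : β * (1 + t + δ) * (1 + t + δ) ≤ β * (2 * ((1 + t) * (1 + t)) + 2 * (δ * δ)) := by
        rw [mul_assoc]
        gcongr
        nlinarith [sq_nonneg (1 + t - δ)]
      refine (add_le_add_left this _).trans (le_of_eq ?_)
      ring

theorem hHatD_translate_succ (hM : M.Regular) (x : ℤ → ℝ) (ς : orthant q) (a : ℤ) (n : ℕ) :
    hHatD hM (fun s => x (s + a)) ς (n + 1) = stepD hM (lags x (a + n))
      (flow (M.sys x) a n (ContinuousMap.const _ ς)) (hHatD hM (fun s => x (s + a)) ς n) := by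
  rw [hHatD, hHat_translate, lags_translate]

theorem hHatE_translate_succ (hM : M.Regular) (x : ℤ → ℝ) (ς : orthant q) (a : ℤ) (n : ℕ) :
    hHatE hM (fun s => x (s + a)) ς (n + 1) = stepE hM (lags x (a + n))
      (flow (M.sys x) a n (ContinuousMap.const _ ς)) (hHatD hM (fun s => x (s + a)) ς n)
      (hHatE hM (fun s => x (s + a)) ς n) := by
  rw [hHatE, hHat_translate, lags_translate]

theorem tendstoUniformlyOn_ext {W : Type*} [NormedAddCommGroup W] {f : ℕ → C(M.K, W)}
    {g : C(M.K, W)} (h : Tendsto f atTop (𝓝 g)) :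
    TendstoUniformlyOn (fun n => M.ext (f n)) (M.ext g) atTop (M.K : Set (E d)) := by
  rw [Metric.tendstoUniformlyOn_iff]
  intro ε hε
  filter_upwards [Metric.tendsto_nhds.1 h ε hε] with n hn θ hθ
  rw [ext_of_mem _ hθ, ext_of_mem _ hθ, dist_comm]
  exact (ContinuousMap.dist_apply_le_dist _).trans_lt hn

theorem tendsto_of_norm_sub {W : Type*} [NormedAddCommGroup W] {f : ℕ → C(M.K, W)}
    {g : C(M.K, W)} (h : Tendsto (fun n => ‖f n - g‖) atTop (𝓝 0)) : Tendsto f atTop (𝓝 g) :=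
  tendsto_iff_dist_tendsto_zero.2 (by simpa only [dist_eq_norm] using h)

theorem HasC2.of_tendsto {s : ℕ → M.H} {a : ℕ → C(M.K, W1 d q)} {b : ℕ → C(M.K, W2 d q)}
    (h : ∀ n, M.HasC2 (s n) (a n) (b n)) {s₀ : M.H} {a₀ : C(M.K, W1 d q)} {b₀ : C(M.K, W2 d q)}
    (hs : Tendsto s atTop (𝓝 s₀)) (ha : Tendsto a atTop (𝓝 a₀)) (hb : Tendsto b atTop (𝓝 b₀)) :
    M.HasC2 s₀ a₀ b₀ where
  first := HasC1.of_tendstoUniformlyOn (fun n => (h n).first) (tendstoUniformlyOn_ext (by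
      rw [tendsto_iff_dist_tendsto_zero] at hs ⊢
      refine squeeze_zero (fun _ => dist_nonneg) (fun n => ?_) hs
      rw [ContinuousMap.dist_le dist_nonneg]
      exact fun θ => ContinuousMap.dist_apply_le_dist (f := s n) θ)) (tendstoUniformlyOn_ext ha)
  second := HasC1.of_tendstoUniformlyOn (fun n => (h n).second) (tendstoUniformlyOn_ext ha)
    (tendstoUniformlyOn_ext hb)

/-! ### First and second derivatives along a good path -/

namespace GoodPath

variable {hM : M.Regular} {ς : orthant q} {x : ℤ → ℝ} {h : ℤ → M.H} {c κ κ' : ℝ}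

theorem expBd_dist (hg : GoodPath hM ς x h c κ κ') :
    ExpBd c fun a n => dist (flow (M.sys x) a n (ContinuousMap.const _ ς)) (h (a + n)) := by
  refine ExpBd.mono ((hg.bound.mul hg.init.expBd_start fun _ _ => dist_nonneg).weaken
    (by linarith)) fun a n => ?_
  rw [← flow_orbit hg.orbit, dist_comm (h a)]
  exact dist_le_lipCoeff (hg.finite a n) _ _

theorem expBd_holder (hg : GoodPath hM ς x h c κ κ') {C : ℤ → ℝ} (hC : Tempered C)
    (hC0 : ∀ t, 0 ≤ C t) {k ρ : ℝ} (hk : 0 < k) (hρ : ρ < k * c) : ExpBd ρ fun a n =>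
      C (a + n) * dist (flow (M.sys x) a n (ContinuousMap.const _ ς)) (h (a + n)) ^ k :=
  ((hg.expBd_dist.rpow (fun _ _ => dist_nonneg) hk).mul_end hC hC0 hρ).mono
    fun _ _ => (mul_comm _ _).le

/-- The number κκ'c is a common lower bound for the rates c, κc and κ'c. Each later estimate loses
some rate strictly, which is recorded by halving: 1/2 for the coefficients, 1/4 for first
derivatives, 1/8 for the inhomogeneity of second order, 1/16 for second derivatives, 1/32 for the
final convergence. -/
theorem rate_pos (hg : GoodPath hM ς x h c κ κ') : 0 < κ * κ' * c :=
  mul_pos (mul_pos hg.κ_pos hg.κ'_pos) hg.pos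

theorem rate_le (hg : GoodPath hM ς x h c κ κ') :
    κ * κ' * c ≤ c ∧ κ * κ' * c ≤ κ * c ∧ κ * κ' * c ≤ κ' * c := by
  have h1 := hg.κ_pos.le
  have h2 := hg.κ'_pos.le
  have h3 := hg.pos.le
  have h4 : κ * κ' ≤ κ := mul_le_of_le_one_right h1 hg.κ'_le
  have h5 : κ * κ' ≤ κ' := mul_le_of_le_one_left h2 hg.κ_le
  exact ⟨mul_le_of_le_one_left h3 (h4.trans hg.κ_le), by gcongr, by gcongr⟩

theorem expBd_along1 (hg : GoodPath hM ς x h c κ κ') : ExpBd (κ * κ' * c / 2) fun a n =>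
    ‖along1 hM (lags x (a + n)) (flow (M.sys x) a n (ContinuousMap.const _ ς)) -
      along1 hM (lags x (a + n)) (h (a + n))‖ := by
  obtain ⟨C, hC, hC0, hH⟩ := hg.holder1
  have := hg.rate_pos
  have := hg.rate_le
  exact (hg.expBd_holder hC hC0 hg.κ_pos (by linarith)).mono fun a n => hH _ _ _

theorem expBd_along2 (hg : GoodPath hM ς x h c κ κ') : ExpBd (κ * κ' * c / 2) fun a n =>
    ‖along2 hM (lags x (a + n)) (flow (M.sys x) a n (ContinuousMap.const _ ς)) -
      along2 hM (lags x (a + n)) (h (a + n))‖ := by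
  obtain ⟨C, hC, hC0, hH⟩ := hg.holder2
  have := hg.rate_pos
  have := hg.rate_le
  exact (hg.expBd_holder hC hC0 hg.κ'_pos (by linarith)).mono fun a n => hH _ _ _

/-- First derivatives. -/
theorem exists_first (hg : GoodPath hM ς x h c κ κ') : ∃ D : ℤ → C(M.K, W1 d q),
    (∀ t, D (t + 1) = stepD hM (lags x t) (h t) (D t)) ∧ (Tempered fun t => ‖D t‖) ∧
      ExpBd (κ * κ' * c / 4) fun a n => ‖hHatD hM (fun s => x (s + a)) ς n - D (a + n)‖ := by
  have hinl : ∀ L : E d × E q →L[ℝ] E q,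
      ‖L.comp (ContinuousLinearMap.inl ℝ (E d) (E q))‖ ≤ ‖L‖ := fun L =>
    (ContinuousLinearMap.opNorm_comp_le _ _).trans (mul_le_of_le_one_right (norm_nonneg _)
      (ContinuousLinearMap.norm_inl_le_one ℝ _ _))
  obtain ⟨D, hD, hDt, -⟩ := exists_tempered_orbit hg.pos hg.bound
    (hg.toContracting.dist_flow_le (actD d q) hM hg.orbit
      (φ := fun t => stepD hM (lags x t) (h t)) fun t y y' θ => by
        rw [stepD_eq, stepD_eq, MatAct.act_sub]; abel) 0 (by
      refine hg.psi1.mono fun t => ?_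
      rw [dist_zero_right, ContinuousMap.norm_le _ (norm_nonneg _)]
      intro θ
      rw [stepD_eq, ContinuousMap.zero_apply, MatAct.act_zero, zero_add]
      exact (hinl _).trans (ContinuousMap.norm_coe_le_norm _ θ))
  simp only [dist_zero_right] at hDt
  have hp := hg.rate_pos
  have hl := hg.rate_le
  refine ⟨D, hD, hDt, ?_⟩
  refine hg.perturbation (actD d q) (e := D) (e' := fun a n => hHatD hM (fun s => x (s + a)) ς n)
    (B := fun t θ => (along1 hM (lags x t) (h t) θ).comp (ContinuousLinearMap.inl ℝ (E d) (E q)))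
    (B' := fun a n θ => (along1 hM (lags x (a + n)) (flow (M.sys x) a n
      (ContinuousMap.const _ ς)) θ).comp (ContinuousLinearMap.inl ℝ (E d) (E q)))
    (fun t θ => by rw [hD, stepD_eq]) (fun a n θ => by
      rw [hHatD_translate_succ, stepD_eq]; rfl) (fun a => rfl) hDt
    (fun _ _ => norm_nonneg _) hg.expBd_along1 (fun a n θ => ?_) hg.expBd_along1
    (by linarith) (by linarith) (by linarith)
  rw [← ContinuousLinearMap.sub_comp]
  exact (hinl _).trans (norm_sub_apply_le _ _ θ)

/-- The second derivatives of the approximating recursion converge exponentially fast. -/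
theorem expBd_second (hg : GoodPath hM ς x h c κ κ') {D : ℤ → C(M.K, W1 d q)}
    {e : ℤ → C(M.K, W2 d q)} (hDt : Tempered fun t => ‖D t‖)
    (hDe : ExpBd (κ * κ' * c / 4) fun a n => ‖hHatD hM (fun s => x (s + a)) ς n - D (a + n)‖)
    (he : ∀ t, e (t + 1) = stepE hM (lags x t) (h t) (D t) (e t))
    (het : Tempered fun t => ‖e t‖) :
    ExpBd (κ * κ' * c / 16) fun a n => ‖hHatE hM (fun s => x (s + a)) ς n - e (a + n)‖ := by
  have hp := hg.rate_pos
  have hl := hg.rate_le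
  set β : ℤ → ℕ → ℝ := fun a n =>
    ‖along2 hM (lags x (a + n)) (flow (M.sys x) a n (ContinuousMap.const _ ς)) -
      along2 hM (lags x (a + n)) (h (a + n))‖ with hβ
  set δ : ℤ → ℕ → ℝ := fun a n => ‖hHatD hM (fun s => x (s + a)) ς n - D (a + n)‖ with hδ
  set T : ℤ → ℝ := fun t => 1 + ‖D t‖ with hT
  set b : ℤ → ℝ := fun t => ‖along2 hM (lags x t) (h t)‖ with hb
  have hδ0 : ∀ a n, 0 ≤ δ a n := fun a n => norm_nonneg_map _
  have hT0 : ∀ t, 0 ≤ T t := fun t => by positivity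
  have hb0 : ∀ t, 0 ≤ b t := fun t => norm_nonneg _
  have hTt : Tempered T := (tempered_const 1).add hDt
  have r1 : ExpBd (κ * κ' * c / 8) fun a n => β a n * (T (a + n) * T (a + n)) :=
    hg.expBd_along2.mul_end (hTt.mul hTt hT0) (fun t => mul_nonneg (hT0 t) (hT0 t))
      (by linarith)
  have r2 : ExpBd (κ * κ' * c / 8) fun a n => β a n * (δ a n * δ a n) :=
    (hg.expBd_along2.mul (hDe.mul hDe hδ0)
      fun a n => mul_nonneg (hδ0 a n) (hδ0 a n)).weaken (by linarith)
  have r3 : ExpBd (κ * κ' * c / 8) fun a n => δ a n * (b (a + n) * T (a + n)) :=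
    hDe.mul_end (hg.psi2.mul hTt hT0) (fun t => mul_nonneg (hb0 t) (hT0 t)) (by linarith)
  have r4 : ExpBd (κ * κ' * c / 8) fun a n => (δ a n * δ a n) * b (a + n) :=
    ((hDe.mul hDe hδ0).mul_end hg.psi2 hb0
      (show κ * κ' * c / 8 < _ by linarith))
  have r := (((r1.add r1).add (r2.add r2)).add ((r3.add r3).add r4))
  refine hg.perturbation (actE d q) (e := e)
    (e' := fun a n => hHatE hM (fun s => x (s + a)) ς n)
    (B := fun t θ => quad (along2 hM (lags x t) (h t) θ) (graphD (D t θ)))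
    (B' := fun a n θ => quad (along2 hM (lags x (a + n)) (flow (M.sys x) a n
      (ContinuousMap.const _ ς)) θ) (graphD (hHatD hM (fun s => x (s + a)) ς n θ)))
    (fun t θ => by rw [he, stepE_apply]; rfl) (fun a n θ => by
      rw [hHatE_translate_succ, stepE_apply]; rfl) (fun a => rfl) het
    (fun a n => by positivity) r (fun a n θ => ?_) hg.expBd_along1
    (by linarith) (by linarith) (by linarith)
  exact norm_quad_graphD_sub_le (norm_sub_apply_le _ _ θ) (ContinuousMap.norm_coe_le_norm _ θ)
    (ContinuousMap.norm_coe_le_norm _ θ) (norm_sub_apply_le _ _ θ)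

/-- First and second derivatives. -/
theorem exists_second (hg : GoodPath hM ς x h c κ κ') :
    ∃ (D : ℤ → C(M.K, W1 d q)) (e : ℤ → C(M.K, W2 d q)),
      (∀ t, M.HasC2 (h t) (D t) (e t)) ∧
      (∀ t, e (t + 1) = stepE hM (lags x t) (h t) (D t) (e t)) ∧ (Tempered fun t => ‖e t‖) ∧
      ExpBd (κ * κ' * c / 16) fun a n => ‖hHatE hM (fun s => x (s + a)) ς n - e (a + n)‖ := by
  obtain ⟨D, hD, hDt, hDe⟩ := hg.exists_first
  have hp := hg.rate_pos
  have hl := hg.rate_le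
  obtain ⟨e, he, het, -⟩ := exists_tempered_orbit hg.pos hg.bound
    (hg.toContracting.dist_flow_le (actE d q) hM hg.orbit
      (φ := fun t => stepE hM (lags x t) (h t) (D t)) fun t y y' θ => by
        rw [stepE_apply, stepE_apply, MatAct.act_sub, add_sub_add_right_eq_sub]; rfl) 0 (by
      have h1 : Tempered fun t => 1 + ‖D t‖ := (tempered_const 1).add hDt
      refine ((hg.psi2.mul h1 fun t => by positivity).mul h1 fun t => by positivity).mono
        fun t => ?_
      rw [dist_zero_right, ContinuousMap.norm_le _ (by positivity)]
      intro θ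
      have h0 : act2 (jac (along1 hM (lags x t) (h t) θ)) (0 : W2 d q) = 0 :=
        (actE d q).act_zero _
      rw [stepE_apply, ContinuousMap.zero_apply, h0, zero_add]
      have f1 := ContinuousMap.norm_coe_le_norm (along2 hM (lags x t) (h t)) θ
      have f2 := (norm_graphD_le (D t θ)).trans
        (add_le_add_right (ContinuousMap.norm_coe_le_norm (D t) θ) 1)
      refine (norm_quad_le _ _).trans ?_
      gcongr)
  simp only [dist_zero_right] at het
  have hexp := hg.expBd_second hDt hDe he het
  refine ⟨D, e, fun t => ?_, he, het, hexp⟩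
  -- Translating the path by t - n makes the n-th approximation start at time t - n and end at time
  -- t. These functions are C² and converge uniformly with both derivatives.
  refine HasC2.of_tendsto (s := fun n : ℕ => M.hHat (fun s => x (s + (t - n))) ς n)
    (a := fun n : ℕ => hHatD hM (fun s => x (s + (t - n))) ς n)
    (b := fun n : ℕ => hHatE hM (fun s => x (s + (t - n))) ς n)
    (fun n => hasC2_hHat hM _ ς n) ?_ ?_ ?_
  · rw [tendsto_iff_dist_tendsto_zero]
    have := hg.expBd_dist.tendsto_backward hg.pos (fun _ _ => dist_nonneg) t
    simpa only [sub_add_cancel, hHat_translate] using this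
  · refine tendsto_of_norm_sub ?_
    have := hDe.tendsto_backward (by linarith) (fun _ _ => norm_nonneg_map _) t
    simpa only [sub_add_cancel] using this
  · refine tendsto_of_norm_sub ?_
    have := hexp.tendsto_backward (by linarith) (fun _ _ => norm_nonneg _) t
    simpa only [sub_add_cancel] using this

end GoodPath

end Family

end CHModel

end

noncomputable section

namespace CHModel

/-! ### A maximal ergodic argument -/

section Maximal

variable {S : Type*} {T : S → S} {f : S → ℝ}

/-- The maximum of the Birkhoff sums `S_0, …, S_n`. -/
def maxBirkhoff (T : S → S) (f : S → ℝ) : ℕ → S → ℝ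
  | 0, _ => 0
  | n + 1, x => max 0 (f x + maxBirkhoff T f n (T x))

theorem maxBirkhoff_nonneg (n : ℕ) (x : S) : 0 ≤ maxBirkhoff T f n x := by
  cases n with
  | zero => exact le_rfl
  | succ n => exact le_max_left _ _

theorem birkhoffSum_le_maxBirkhoff (n : ℕ) (x : S) :
    birkhoffSum T f n x ≤ maxBirkhoff T f n x := by
  induction n generalizing x with
  | zero => simp [maxBirkhoff]
  | succ n ih =>
    rw [birkhoffSum_succ']
    exact (add_le_add_right (ih _) _).trans (le_max_right _ _)

theorem maxBirkhoff_mono (x : S) : Monotone fun n => maxBirkhoff T f n x := by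
  refine monotone_nat_of_le_succ fun n => ?_
  induction n generalizing x with
  | zero => exact maxBirkhoff_nonneg _ _
  | succ n ih => exact max_le_max le_rfl (add_le_add_right (ih (T x)) _)

variable [MeasurableSpace S] {μ : Measure S}

theorem integrable_maxBirkhoff (hT : MeasurePreserving T μ μ) (hf : Integrable f μ) (n : ℕ) :
    Integrable (maxBirkhoff T f n) μ := by
  induction n with
  | zero => exact integrable_zero _ _ _
  | succ n ih =>
    exact (integrable_zero S ℝ μ).sup (hf.add (hT.integrable_comp_of_integrable ih))

/-- Let M_n be the maximal Birkhoff sum, so that M_{n+1} = max(0, f + M_n ∘ T). The set where M_n is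
unbounded is invariant. If it had full measure, then M_{n+1} - M_n ∘ T would converge to f,
dominated by |f|; but its integral is ∫(M_{n+1} - M_n) ≥ 0, which contradicts ∫f < 0. -/
theorem ae_bddAbove_birkhoffSum [IsProbabilityMeasure μ] (hT : Ergodic T μ) (hfm : Measurable f)
    (hf : Integrable f μ) (hneg : ∫ x, f x ∂μ < 0) :
    ∀ᵐ x ∂μ, BddAbove (range fun n => birkhoffSum T f n x) := by
  have hTp := hT.toMeasurePreserving
  have hmeas : ∀ n, Measurable (maxBirkhoff T f n) := fun n => by
    induction n with
    | zero => exact measurable_const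
    | succ n ih => exact measurable_const.max (hfm.add (ih.comp hTp.measurable))
  set A : Set S := {x | ∀ N : ℕ, ∃ n, (N : ℝ) < maxBirkhoff T f n x} with hA
  have hAm : MeasurableSet A := by
    have : A = ⋂ N : ℕ, ⋃ n, {x | (N : ℝ) < maxBirkhoff T f n x} := by ext x; simp [hA]
    rw [this]
    exact MeasurableSet.iInter fun N => MeasurableSet.iUnion fun n =>
      measurableSet_lt measurable_const (hmeas n)
  have hinv : T ⁻¹' A = A := by
    ext x
    simp only [hA, mem_preimage, mem_ofPred_eq]
    constructor
    · intro h N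
      obtain ⟨k, hk⟩ := exists_nat_gt ((N : ℝ) - f x)
      obtain ⟨n, hn⟩ := h k
      refine ⟨n + 1, lt_max_of_lt_right ?_⟩
      linarith
    · intro h N
      obtain ⟨k, hk⟩ := exists_nat_gt (max (N + f x) 0)
      obtain ⟨n, hn⟩ := h k
      refine ⟨n, ?_⟩
      have h1 := (le_max_left _ _).trans_lt hk
      have h2 := (le_max_right ((N : ℝ) + f x) 0).trans_lt hk
      cases n with
      | zero =>
        rw [maxBirkhoff] at hn
        linarith
      | succ n =>
        rw [maxBirkhoff, lt_max_iff] at hn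
        rcases hn with hn | hn
        · linarith
        · have := maxBirkhoff_mono (T := T) (f := f) (T x) (Nat.le_succ n)
          simp only at this
          linarith
  rcases hT.toPreErgodic.ae_mem_or_ae_notMem hAm hinv with h | h
  · exfalso
    have hlim : Tendsto (fun n => ∫ x, (maxBirkhoff T f (n + 1) x - maxBirkhoff T f n (T x)) ∂μ)
        atTop (𝓝 (∫ x, f x ∂μ)) := by
      refine tendsto_integral_of_dominated_convergence (fun x => |f x|) (fun n => ?_) hf.abs
        (fun n => Eventually.of_forall fun x => ?_) ?_
      · exact ((hmeas (n + 1)).sub ((hmeas n).comp hTp.measurable)).aestronglyMeasurable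
      · have h0 := maxBirkhoff_nonneg (T := T) (f := f) n (T x)
        rw [maxBirkhoff, Real.norm_eq_abs]
        rcases le_total 0 (f x + maxBirkhoff T f n (T x)) with h1 | h1
        · rw [max_eq_right h1, add_sub_cancel_right]
        · rw [max_eq_left h1, zero_sub, abs_neg, abs_of_nonneg h0]
          exact le_trans (by linarith) (neg_le_abs (f x))
      · filter_upwards [h] with x hx
        have hx' : T x ∈ A := by rw [← hinv] at hx; exact hx
        obtain ⟨k, hk⟩ := exists_nat_gt (-f x)
        obtain ⟨n, hn⟩ := hx' k
        refine tendsto_const_nhds.congr' ?_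
        filter_upwards [eventually_ge_atTop n] with m hm
        have h1 := maxBirkhoff_mono (T := T) (f := f) (T x) hm
        simp only at h1
        rw [maxBirkhoff, max_eq_right (by linarith)]
        ring
    have hnn : 0 ≤ ∫ x, f x ∂μ := by
      refine ge_of_tendsto' hlim fun n => ?_
      have hi := integrable_maxBirkhoff hTp hf
      have hi2 : Integrable (fun x => maxBirkhoff T f n (T x)) μ :=
        hTp.integrable_comp_of_integrable (hi n)
      have hi3 : ∫ x, maxBirkhoff T f n (T x) ∂μ = ∫ x, maxBirkhoff T f n x ∂μ := by
        rw [← integral_map hTp.aemeasurable (hmeas n).aestronglyMeasurable, hTp.map_eq]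
      rw [integral_sub (hi _) hi2, hi3, sub_nonneg]
      exact integral_mono (hi _) (hi _) fun x => maxBirkhoff_mono x (Nat.le_succ n)
    linarith
  · filter_upwards [h] with x hx
    simp only [hA, mem_ofPred_eq, not_forall, not_exists, not_lt] at hx
    obtain ⟨N, hN⟩ := hx
    refine ⟨N, ?_⟩
    rintro _ ⟨n, rfl⟩
    exact (birkhoffSum_le_maxBirkhoff n x).trans (hN n)

/-- Boundedness of the sums is applied to f - ∫f - ε, whose mean is -ε. -/
theorem ae_birkhoffSum_le [IsProbabilityMeasure μ] (hT : Ergodic T μ) (hfm : Measurable f)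
    (hf : Integrable f μ) {ε : ℝ} (hε : 0 < ε) :
    ∀ᵐ x ∂μ, ∃ C, ∀ n : ℕ, birkhoffSum T f n x ≤ n * (∫ x, f x ∂μ) + ε * n + C := by
  have h := ae_bddAbove_birkhoffSum (f := fun x => f x - ((∫ x, f x ∂μ) + ε)) hT
    (hfm.sub_const _) (hf.sub (integrable_const _)) (by
      rw [integral_sub hf (integrable_const _)]
      simp [hε])
  filter_upwards [h] with x ⟨C, hC⟩
  refine ⟨C, fun n => ?_⟩
  have h1 := hC ⟨n, rfl⟩
  simp only [birkhoffSum, Finset.sum_sub_distrib, Finset.sum_const, Finset.card_range,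
    nsmul_eq_mul] at h1 ⊢
  linarith

theorem ae_abs_birkhoffSum_le [IsProbabilityMeasure μ] (hT : Ergodic T μ) (hfm : Measurable f)
    (hf : Integrable f μ) {ε : ℝ} (hε : 0 < ε) :
    ∀ᵐ x ∂μ, ∃ C, ∀ n : ℕ, |birkhoffSum T f n x - n * (∫ x, f x ∂μ)| ≤ ε * n + C := by
  filter_upwards [ae_birkhoffSum_le hT hfm hf hε, ae_birkhoffSum_le hT hfm.neg hf.neg hε]
    with x ⟨C, hC⟩ ⟨D, hD⟩
  refine ⟨max C D, fun n => ?_⟩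
  have h1 := hC n
  have h2 := hD n
  have h3 := le_max_left C D
  have h4 := le_max_right C D
  rw [birkhoffSum_neg] at h2
  simp only [Pi.neg_apply] at h2
  rw [integral_neg] at h2
  rw [abs_le]
  constructor <;> linarith

end Maximal

/-! ### Two-sided sequences -/

section TwoSided

variable {α : Type*}

/-- Translation of two-sided sequences. -/
def tr (t : ℤ) (x : ℤ → α) : ℤ → α := fun s => x (s + t)

theorem tr_tr (s t : ℤ) (x : ℤ → α) : tr s (tr t x) = tr (s + t) x := by
  funext i; simp only [tr]; congr 1; ring

theorem tr_zero (x : ℤ → α) : tr 0 x = x := by funext i; simp [tr]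

theorem shift_eq_tr : (shift : (ℤ → α) → ℤ → α) = tr 1 := rfl

theorem shift_iterate (n : ℕ) (x : ℤ → α) : shift^[n] x = tr n x := by
  induction n with
  | zero => simp [tr_zero]
  | succ n ih =>
    rw [Function.iterate_succ_apply', ih, shift_eq_tr, tr_tr]
    congr 1
    push_cast
    ring

variable [MeasurableSpace α]

theorem measurable_tr (t : ℤ) : Measurable (tr t : (ℤ → α) → ℤ → α) :=
  measurable_pi_lambda _ fun s => measurable_pi_apply (s + t)

/-- The shift as a measurable equivalence. -/
def shiftEquiv (α : Type*) [MeasurableSpace α] : (ℤ → α) ≃ᵐ (ℤ → α) where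
  toFun := tr 1
  invFun := tr (-1)
  left_inv x := by rw [tr_tr]; simp [tr_zero]
  right_inv x := by rw [tr_tr]; simp [tr_zero]
  measurable_toFun := measurable_tr 1
  measurable_invFun := measurable_tr (-1)

theorem shiftEquiv_symm_iterate (n : ℕ) (x : ℤ → α) : (shiftEquiv α).symm^[n] x = tr (-n) x := by
  induction n with
  | zero => simp [tr_zero]
  | succ n ih =>
    rw [Function.iterate_succ_apply', ih]
    change tr (-1) (tr (-(n : ℤ)) x) = _
    rw [tr_tr]
    congr 1
    push_cast
    ring

variable {μ : Measure (ℤ → α)}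

theorem measurePreserving_tr (h : MeasurePreserving (shift : (ℤ → α) → ℤ → α) μ μ) (t : ℤ) :
    MeasurePreserving (tr t) μ μ := by
  have hs : MeasurePreserving (shiftEquiv α).symm μ μ :=
    MeasurePreserving.symm (shiftEquiv α) h
  obtain ⟨n, rfl | rfl⟩ := t.eq_nat_or_neg
  · have := h.iterate n
    rwa [show (shift^[n] : (ℤ → α) → ℤ → α) = tr n from funext (shift_iterate n)] at this
  · have := hs.iterate n
    rwa [show ((shiftEquiv α).symm^[n] : (ℤ → α) → ℤ → α) = tr (-n) from
      funext (shiftEquiv_symm_iterate n)] at this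

/-- Uniform control of the sums of a stationary ergodic sequence over windows. -/
theorem ae_sum_window_le [IsProbabilityMeasure μ] (h : Ergodic (shift : (ℤ → α) → ℤ → α) μ)
    {f : (ℤ → α) → ℝ} (hfm : Measurable f) (hf : Integrable f μ) {ε : ℝ} (hε : 0 < ε) :
    ∀ᵐ x ∂μ, ∃ C, ∀ (a : ℤ) (n : ℕ), ∑ i ∈ Finset.range n, f (tr (a + i) x) ≤
      n * (∫ x, f x ∂μ) + ε * (|(a : ℝ)| + n) + C := by
  set m := ∫ x, f x ∂μ with hm
  have hs : Ergodic (shiftEquiv α).symm μ := Ergodic.symm (e := shiftEquiv α) h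
  have hsp := hs.toMeasurePreserving
  have hm' : ∫ x, f ((shiftEquiv α).symm x) ∂μ = m :=
    hsp.integral_comp (shiftEquiv α).symm.measurableEmbedding f
  filter_upwards [ae_abs_birkhoffSum_le h hfm hf (half_pos hε),
    ae_abs_birkhoffSum_le hs (hfm.comp hsp.measurable)
      (hsp.integrable_comp_of_integrable hf) (half_pos hε)] with x ⟨C, hC⟩ ⟨D, hD⟩
  simp only [Function.comp_apply, hm', ← hm] at hC hD
  simp only [birkhoffSum, shift_iterate, shiftEquiv_symm_iterate, Function.comp_apply] at hC hD
  -- `G` is a discrete primitive of t ↦ f(tr t x) on all of ℤ with G(0) = 0; for negative k it is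
  -- minus the sum over the times k, …, -1. A window sum is then G(a + n) - G(a), and the forward
  -- and backward ergodic bounds control `G` on the two half-lines.
  set G : ℤ → ℝ := fun k => if 0 ≤ k then ∑ i ∈ Finset.range k.toNat, f (tr i x)
    else -∑ i ∈ Finset.range (-k).toNat, f ((shiftEquiv α).symm (tr (-(i : ℤ)) x)) with hG
  have hsymm : ∀ y : ℤ → α, (shiftEquiv α).symm y = tr (-1) y := fun _ => rfl
  have hstep : ∀ k : ℤ, G (k + 1) = G k + f (tr k x) := by
    intro k
    rcases lt_trichotomy k (-1) with hk | hk | hk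
    · obtain ⟨n, rfl⟩ : ∃ n : ℕ, k = -(n + 2 : ℕ) := ⟨(-k - 2).toNat, by omega⟩
      have e1 : (-(-((n + 2 : ℕ) : ℤ))).toNat = n + 2 := by omega
      have e2 : (-(-((n + 2 : ℕ) : ℤ) + 1)).toNat = n + 1 := by omega
      simp only [hG, e1, e2]
      rw [if_neg (by omega), if_neg (by omega), Finset.sum_range_succ _ (n + 1), hsymm, tr_tr,
        show -1 + -((n + 1 : ℕ) : ℤ) = -((n + 2 : ℕ) : ℤ) by push_cast; ring]
      ring
    · subst hk
      simp [hG, hsymm, tr_tr]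
    · obtain ⟨n, rfl⟩ : ∃ n : ℕ, k = n := ⟨k.toNat, by omega⟩
      have e1 : ((n : ℤ) + 1).toNat = n + 1 := by omega
      simp only [hG, e1, Int.toNat_natCast]
      rw [if_pos (by omega), if_pos (by omega), Finset.sum_range_succ]
  have hbd : ∀ k : ℤ, |G k - k * m| ≤ ε / 2 * |(k : ℝ)| + (|C| + |D|) := by
    intro k
    obtain ⟨n, rfl | rfl⟩ := k.eq_nat_or_neg
    · have := hC n
      simp only [hG, Int.toNat_natCast, Nat.cast_nonneg, if_true, Int.cast_natCast, Nat.abs_cast]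
      have := le_abs_self C
      have := abs_nonneg D
      linarith
    · have h1 := hD n
      have h2 : G (-n) = -∑ i ∈ Finset.range n, f ((shiftEquiv α).symm (tr (-(i : ℤ)) x)) := by
        rcases Nat.eq_zero_or_pos n with rfl | hn
        · simp [hG]
        · simp only [hG]
          rw [if_neg (by omega), neg_neg, Int.toNat_natCast]
      rw [h2, Int.cast_neg, Int.cast_natCast, abs_neg, Nat.abs_cast, neg_mul, neg_sub_neg, abs_sub_comm]
      have := le_abs_self D
      have := abs_nonneg C
      linarith
  refine ⟨2 * (|C| + |D|), fun a n => ?_⟩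
  have hsum : ∑ i ∈ Finset.range n, f (tr (a + i) x) = G (a + n) - G a := by
    induction n with
    | zero => simp
    | succ n ih =>
      rw [Finset.sum_range_succ, ih]
      have := hstep (a + n)
      rw [Nat.cast_succ, ← add_assoc, this]
      ring
  have h1 := (abs_le.1 (hbd (a + n))).2
  have h2 := (abs_le.1 (hbd a)).1
  have h3 := abs_cast_add_le a n
  have h4 : ε / 2 * |((a + n : ℤ) : ℝ)| ≤ ε / 2 * (|(a : ℝ)| + n) := by gcongr
  rw [hsum]
  push_cast at h1 h2 h4 ⊢
  nlinarith [abs_nonneg (a : ℝ)]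

end TwoSided

/-! ### Logarithmic moments and subexponential growth -/

theorem tempered_of_cofinite {v : ℤ → ℝ}
    (h : ∀ ε > 0, {t : ℤ | Real.exp (ε * |(t : ℝ)|) < v t}.Finite) : Tempered v := by
  intro ε hε
  refine ⟨1 + ∑ t ∈ (h ε hε).toFinset, |v t|, fun a => ?_⟩
  have h0 : 0 ≤ ∑ t ∈ (h ε hε).toFinset, |v t| := Finset.sum_nonneg fun _ _ => abs_nonneg _
  have h1 : 1 ≤ Real.exp (ε * |(a : ℝ)|) := Real.one_le_exp (by positivity)
  by_cases ha : Real.exp (ε * |(a : ℝ)|) < v a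
  · have h2 : |v a| ≤ ∑ t ∈ (h ε hε).toFinset, |v t| :=
      Finset.single_le_sum (f := fun t => |v t|) (fun _ _ => abs_nonneg _) (by simpa using ha)
    have h3 := le_abs_self (v a)
    nlinarith
  · nlinarith

theorem ofReal_exp_lt_iff {w : ℝ≥0∞} {r : ℝ} (hr : 0 ≤ r) :
    ENNReal.ofReal (Real.exp r) < w ↔ ENNReal.ofReal r < (ENNReal.log w).toENNReal := by
  rw [← ENNReal.log_lt_log_iff, ENNReal.log_ofReal_of_pos (Real.exp_pos r), Real.log_exp]
  rcases le_total 0 (ENNReal.log w) with h | h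
  · conv_lhs => rw [← EReal.coe_toENNReal h, ← max_eq_left hr, ← EReal.coe_ennreal_ofReal]
    rw [EReal.coe_ennreal_lt_coe_ennreal_iff]
  · rw [EReal.toENNReal_of_nonpos h]
    constructor
    · intro h1
      exact absurd (h1.trans_le h) (by simpa using hr)
    · intro h1
      exact absurd h1 not_lt_zero

/-- Borel–Cantelli: integrability of log⁺ W₀ makes the probabilities of W₀ > exp(εn) summable in n,
so with identical marginals W_t > exp(ε|t|) only for finitely many t. No dependence structure
enters. -/
theorem ae_tempered {Ω : Type*} [MeasurableSpace Ω] {P : Measure Ω} [IsProbabilityMeasure P]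
    {W : ℤ → Ω → ℝ≥0∞} (hW : ∀ t, AEMeasurable (W t) P) (hlaw : ∀ t, P.map (W t) = P.map (W 0))
    (hlog : meanLogPlus P (W 0) < ∞) :
    ∀ᵐ ω ∂P, (∀ t, W t ω ≠ ∞) ∧ Tempered fun t => (W t ω).toReal := by
  have hlogm : Measurable fun w : ℝ≥0∞ => (ENNReal.log w).toENNReal :=
    measurable_ereal_toENNReal.comp ENNReal.measurable_log
  set Y : Ω → ℝ≥0∞ := fun ω => (ENNReal.log (W 0 ω)).toENNReal with hY
  have hYm : AEMeasurable Y P := hlogm.comp_aemeasurable (hW 0)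
  have hlaw' : ∀ t (B : Set ℝ≥0∞), MeasurableSet B → P {ω | W t ω ∈ B} = P {ω | W 0 ω ∈ B} := by
    intro t B hB
    have := congrArg (fun ν => ν B) (hlaw t)
    rwa [Measure.map_apply_of_aemeasurable (hW t) hB,
      Measure.map_apply_of_aemeasurable (hW 0) hB] at this
  have hYfin : ∀ᵐ ω ∂P, Y ω < ∞ := ae_lt_top' hYm hlog.ne
  have hWfin : ∀ t, ∀ᵐ ω ∂P, W t ω ≠ ∞ := by
    intro t
    have h0 : P {ω | W 0 ω ∈ ({∞} : Set ℝ≥0∞)} = 0 := by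
      have : ∀ᵐ ω ∂P, ¬ (W 0 ω ∈ ({∞} : Set ℝ≥0∞)) := by
        filter_upwards [hYfin] with ω hω h
        rw [mem_singleton_iff] at h
        simp [hY, h] at hω
      rw [ae_iff] at this
      simpa using this
    rw [ae_iff]
    rw [← hlaw' t _ (measurableSet_singleton _)] at h0
    simpa using h0
  have hsum : ∀ ε : ℝ, 0 < ε →
      ∑' n : ℕ, P {ω | ENNReal.ofReal (Real.exp (ε * n)) < W 0 ω} ≠ ∞ := by
    intro ε hε
    let mΩ : MeasureSpace Ω := { toMeasurableSpace := inferInstance, volume := P }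
    have hprob : IsProbabilityMeasure (volume : Measure Ω) := ‹IsProbabilityMeasure P›
    have hint : Integrable (fun ω => (Y ω).toReal / ε) (volume : Measure Ω) :=
      (integrable_toReal_of_lintegral_ne_top hYm hlog.ne).div_const ε
    have h1 := tsum_prob_mem_Ioi_lt_top hint (fun ω => by positivity)
    refine ne_of_lt (lt_of_le_of_lt (ENNReal.tsum_le_tsum fun n => ?_) h1)
    change P _ ≤ P _
    refine measure_mono_ae ?_
    filter_upwards [hYfin] with ω hω h
    change ENNReal.ofReal (Real.exp (ε * n)) < W 0 ω at h
    change (n : ℝ) < (Y ω).toReal / ε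
    rw [ofReal_exp_lt_iff (by positivity)] at h
    rw [lt_div_iff₀ hε, mul_comm]
    exact (ENNReal.ofReal_lt_iff_lt_toReal (by positivity) hω.ne).1 h
  have hsum2 : ∀ ε : ℝ, 0 < ε → ∀ᵐ ω ∂P,
      {t : ℤ | ENNReal.ofReal (Real.exp (ε * |(t : ℝ)|)) < W t ω}.Finite := by
    intro ε hε
    have hone : ∀ g : ℕ → ℤ, (∀ n, |((g n : ℤ) : ℝ)| = n) → ∀ᵐ ω ∂P,
        {n : ℕ | ENNReal.ofReal (Real.exp (ε * n)) < W (g n) ω}.Finite := by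
      intro g hg
      refine ae_finite_setOfPred_mem (s := fun n : ℕ =>
        {ω | ENNReal.ofReal (Real.exp (ε * n)) < W (g n) ω}) ?_
      have h1 := hsum ε hε
      have h2 : ∀ n : ℕ, P {ω | ENNReal.ofReal (Real.exp (ε * n)) < W (g n) ω} =
          P {ω | ENNReal.ofReal (Real.exp (ε * n)) < W 0 ω} := fun n =>
        hlaw' (g n) (Ioi _) measurableSet_Ioi
      simpa only [h2] using h1
    filter_upwards [hone (fun n => n) (fun n => by simp), hone (fun n => -n) (fun n => by simp)]
      with ω h1 h2
    refine ((h1.image (fun n : ℕ => (n : ℤ))).union (h2.image (fun n : ℕ => -(n : ℤ)))).subset ?_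
    intro t ht
    obtain ⟨n, rfl | rfl⟩ := t.eq_nat_or_neg
    · exact Or.inl ⟨n, by simpa using ht, rfl⟩
    · exact Or.inr ⟨n, by simpa using ht, rfl⟩
  -- Countably many values 1/(k+1) of ε suffice for a single null set.
  have hsum3 : ∀ᵐ ω ∂P, ∀ k : ℕ,
      {t : ℤ | ENNReal.ofReal (Real.exp (1 / ((k : ℝ) + 1) * |(t : ℝ)|)) < W t ω}.Finite :=
    ae_all_iff.2 fun k => hsum2 _ (by positivity)
  filter_upwards [hsum3, ae_all_iff.2 hWfin] with ω h1 h2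
  refine ⟨h2, tempered_of_cofinite fun ε hε => ?_⟩
  obtain ⟨k, hk⟩ := exists_nat_one_div_lt hε
  refine (h1 k).subset fun t ht => ?_
  change Real.exp (ε * |(t : ℝ)|) < (W t ω).toReal at ht
  change ENNReal.ofReal (Real.exp (1 / ((k : ℝ) + 1) * |(t : ℝ)|)) < W t ω
  rw [ENNReal.ofReal_lt_iff_lt_toReal (Real.exp_pos _).le (h2 t)]
  refine lt_of_le_of_lt (Real.exp_le_exp.2 ?_) ht
  gcongr

/-! ### Tightness -/

/-- Where Y > 0, every bound U_m ≤ R must fail eventually, since otherwise a_m U_m + b_m would be at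
most a_m R + b_m → 0 infinitely often. As all U_m have one law, this event has probability at most
P(U₀ > R), and R → ∞. -/
theorem ae_nonpos_of_tight {Ω : Type*} [MeasurableSpace Ω] {P : Measure Ω}
    [IsProbabilityMeasure P] {Y : Ω → ℝ} {a b U : ℕ → Ω → ℝ} (hU : ∀ m, Measurable (U m))
    (hlaw : ∀ m, P.map (U m) = P.map (U 0)) (ha0 : ∀ m ω, 0 ≤ a m ω)
    (ha : ∀ᵐ ω ∂P, Tendsto (fun m => a m ω) atTop (𝓝 0))
    (hb : ∀ᵐ ω ∂P, Tendsto (fun m => b m ω) atTop (𝓝 0))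
    (hY : ∀ᵐ ω ∂P, ∀ m, Y ω ≤ a m ω * U m ω + b m ω) : ∀ᵐ ω ∂P, Y ω ≤ 0 := by
  have hlaw' : ∀ m (R : ℝ), P {ω | R < U m ω} = P {ω | R < U 0 ω} := by
    intro m R
    have := congrArg (fun ν => ν (Ioi R)) (hlaw m)
    rwa [Measure.map_apply (hU m) measurableSet_Ioi,
      Measure.map_apply (hU 0) measurableSet_Ioi] at this
  have hR : ∀ R : ℕ, P {ω | ¬ Y ω ≤ 0} ≤ P {ω | (R : ℝ) < U 0 ω} := by
    intro R
    have h1 : P {ω | ¬ Y ω ≤ 0} ≤ P (⋃ n : ℕ, ⋂ m : {m // n ≤ m}, {ω | (R : ℝ) < U m ω}) := by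
      refine measure_mono_ae ?_
      filter_upwards [ha, hb, hY] with ω ha hb hY hpos
      by_contra hcon
      have hcon' : ∀ n, ∃ m, n ≤ m ∧ U m ω ≤ R := by
        intro n
        by_contra hc
        push Not at hc
        exact hcon (mem_iUnion.2 ⟨n, mem_iInter.2 fun m => hc m.1 m.2⟩)
      refine hpos (ge_of_tendsto_of_frequently
        (f := fun m => a m ω * R + b m ω) (by simpa using (ha.mul_const (R : ℝ)).add hb) ?_)
      rw [frequently_atTop]
      intro n
      obtain ⟨m, hm, hUm⟩ := hcon' n
      refine ⟨m, hm, (hY m).trans ?_⟩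
      have := ha0 m ω
      gcongr
    refine h1.trans ?_
    rw [Monotone.measure_iUnion]
    · refine iSup_le fun n => ?_
      rw [← hlaw' n]
      exact measure_mono (iInter_subset_of_subset ⟨n, le_rfl⟩ subset_rfl)
    · intro n n' hn
      exact iInter_mono' fun m => ⟨⟨m.1, hn.trans m.2⟩, subset_rfl⟩
  have hlim : Tendsto (fun R : ℕ => P {ω | (R : ℝ) < U 0 ω}) atTop (𝓝 0) := by
    have h1 := tendsto_measure_iInter_atTop (μ := P) (s := fun R : ℕ => {ω | (R : ℝ) < U 0 ω})
      (fun R => (measurableSet_lt measurable_const (hU 0)).nullMeasurableSet)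
      (fun R R' hR ω (hω : (R' : ℝ) < U 0 ω) => lt_of_le_of_lt (by exact_mod_cast hR) hω)
      ⟨0, measure_ne_top _ _⟩
    have h2 : ⋂ R : ℕ, {ω | (R : ℝ) < U 0 ω} = ∅ := by
      ext ω
      simp only [mem_iInter, mem_ofPred_eq, mem_empty_iff_false, iff_false, not_forall, not_lt]
      exact exists_nat_ge _
    rwa [h2, measure_empty] at h1
  rw [ae_iff]
  exact le_antisymm (ge_of_tendsto' hlim hR) bot_le

end CHModel

end

noncomputable section

namespace CHModel

/-! ### Contraction on average -/

theorem Tempered.translate {v : ℤ → ℝ} (hv : Tempered v) (j : ℤ) : Tempered fun a => v (a + j) := by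
  intro ε hε
  obtain ⟨C, hC0, hC⟩ := hv.bound hε
  refine ⟨C * Real.exp (ε * |(j : ℝ)|), fun a => (hC _).trans ?_⟩
  have h1 : |((a + j : ℤ) : ℝ)| ≤ |(a : ℝ)| + |(j : ℝ)| := by
    push_cast
    exact abs_add_le _ _
  rw [mul_assoc, ← Real.exp_add]
  refine mul_le_mul_of_nonneg_left (Real.exp_le_exp.2 ?_) hC0
  have := mul_le_mul_of_nonneg_left h1 hε.le
  linarith

/-- A submultiplicative cocycle decays exponentially if its blocks of length `r` have negative
mean logarithm. -/
theorem expBd_of_blocks {m : ℤ → ℕ → ℝ} (hm0 : ∀ a n, 0 ≤ m a n) (h0 : ∀ a, m a 0 ≤ 1)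
    (hsub : ∀ a k n, m a (k + n) ≤ m a k * m (a + k) n) (h1 : Tempered fun a => m a 1) {f : ℤ → ℝ}
    {r : ℕ} (hr : 1 ≤ r) (hf : ∀ a, m a r ≤ Real.exp (f a)) {c : ℝ} (hc : 0 < c)
    (hw : ∀ ε > 0, ∃ C, ∀ (a : ℤ) (n : ℕ), ∑ i ∈ Finset.range n, f (a + i) ≤
      n * (-c) + ε * (|(a : ℝ)| + n) + C) : ExpBd (c / (2 * r)) m := by
  have hr0 : (0 : ℝ) < r := by exact_mod_cast hr
  have hr1 : (1 : ℝ) ≤ r := by exact_mod_cast hr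
  have htemp : ∀ j, Tempered fun a => m a j := by
    intro j
    induction j with
    | zero => exact (tempered_const 1).mono h0
    | succ j ih => exact (ih.mul (h1.translate j) fun a => hm0 _ _).mono fun a => hsub a j 1
  set g : ℤ → ℝ := fun a => ∑ j : Fin (2 * r), m a j with hg
  have hgt : Tempered g := Tempered.sum fun j : Fin (2 * r) => htemp j
  have hg0 : ∀ a, 0 ≤ g a := fun a => Finset.sum_nonneg fun _ _ => hm0 _ _
  have hmg : ∀ a j, j < 2 * r → m a j ≤ g a := fun a j hj =>
    Finset.single_le_sum (f := fun j : Fin (2 * r) => m a j) (fun _ _ => hm0 _ _)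
      (Finset.mem_univ (⟨j, hj⟩ : Fin (2 * r)))
  have hblock : ∀ (a : ℤ) (K : ℕ), m a (r * K) ≤
      Real.exp (∑ k ∈ Finset.range K, f (a + (r * k : ℕ))) := by
    intro a K
    induction K with
    | zero => simpa using h0 a
    | succ K ih =>
      rw [Finset.sum_range_succ, Real.exp_add, Nat.mul_succ]
      exact (hsub _ _ _).trans (mul_le_mul ih (hf _) (hm0 _ _) (Real.exp_pos _).le)
  -- The block sums with stride r over all r offsets fill a full window of length rK. Averaging over
  -- offsets avoids the r-th power of the shift, which may fail to be ergodic.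
  have hdouble : ∀ (a : ℤ) (K : ℕ), ∑ j ∈ Finset.range r, ∑ k ∈ Finset.range K,
      f (a + j + (r * k : ℕ)) = ∑ i ∈ Finset.range (r * K), f (a + i) := by
    intro a K
    induction K with
    | zero => simp
    | succ K ih =>
      simp only [Finset.sum_range_succ, Finset.sum_add_distrib, Nat.mul_succ, ih,
        Finset.sum_range_add]
      congr 1
      refine Finset.sum_congr rfl fun j _ => ?_
      congr 1
      push_cast
      ring
  -- For each offset j < r the n steps are split into j initial steps, K full blocks and fewer than
  -- 2r final steps. Multiplying the r resulting bounds gives the r-th power of m.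
  have hpow : ∀ (a : ℤ) (n K : ℕ), r * (K + 1) ≤ n → n < r * (K + 1) + r → ∀ (B : ℝ),
      (∀ j < r, g a * g (a + j + (r * K : ℕ)) ≤ B) →
      m a n ^ r ≤ B ^ r * Real.exp (∑ i ∈ Finset.range (r * K), f (a + i)) := by
    intro a n K hK hK' B hB
    rw [← hdouble, Real.exp_sum, ← Finset.card_range r]
    nth_rewrite 1 [← Finset.prod_const]
    nth_rewrite 1 [← Finset.prod_const]
    rw [Finset.card_range, ← Finset.prod_mul_distrib]
    refine Finset.prod_le_prod (fun _ _ => hm0 _ _) fun j hj => ?_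
    have hj' := Finset.mem_range.1 hj
    have e1 : n = j + (r * K + (n - j - r * K)) := by
      have : r * (K + 1) = r * K + r := Nat.mul_succ _ _
      omega
    have e2 : n - j - r * K < 2 * r := by
      have : r * (K + 1) = r * K + r := Nat.mul_succ _ _
      omega
    calc m a n ≤ m a j * m (a + j) (r * K + (n - j - r * K)) := by
          conv_lhs => rw [e1]
          exact hsub _ _ _
      _ ≤ m a j * (m (a + j) (r * K) * m (a + j + (r * K : ℕ)) (n - j - r * K)) := by
          gcongr
          · exact hm0 _ _
          · exact hsub _ _ _
      _ ≤ g a * (Real.exp (∑ k ∈ Finset.range K, f (a + j + (r * k : ℕ))) *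
            g (a + j + (r * K : ℕ))) := by
          have := hm0
          gcongr
          · exact mul_nonneg (hm0 _ _) (hm0 _ _)
          · exact hg0 a
          · exact hmg _ _ (by omega)
          · exact hm0 _ _
          · exact hblock _ _
          · exact hmg _ _ e2
      _ = g a * g (a + j + (r * K : ℕ)) *
            Real.exp (∑ k ∈ Finset.range K, f (a + j + (r * k : ℕ))) := by ring
      _ ≤ _ := by gcongr; exact hB j hj'
  intro ε hε
  -- The r-th root of the product bound would give rate c/r. Half of it is spent: c/4 (before the
  -- root) on the boundary factors through η and c/4 on the ergodic error through ε'.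
  set η := min (ε / 4) (c / (4 * r)) with hη
  set ε' := min (ε / 2) (c / 4) with hε'
  have hη0 : 0 < η := lt_min (by positivity) (by positivity)
  have hε'0 : 0 < ε' := lt_min (by positivity) (by positivity)
  obtain ⟨C₀, hC₀⟩ := hgt η hη0
  obtain ⟨C₁, hC₁⟩ := hw ε' hε'0
  set C := max C₀ 1 with hCdef
  have hC1 : 1 ≤ C := le_max_right _ _
  have hgC : ∀ a, g a ≤ C * Real.exp (η * |(a : ℝ)|) := fun a =>
    (hC₀ a).trans (by gcongr; exact le_max_left _ _)
  set l := Real.log C with hl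
  have hl0 : 0 ≤ l := Real.log_nonneg hC1
  have hCl : C = Real.exp l := (Real.exp_log (by linarith)).symm
  have hηr : r * η ≤ c / 4 := by
    calc r * η ≤ r * (c / (4 * r)) := by gcongr; exact min_le_right _ _
      _ = c / 4 := by field_simp
  have hη4 : η ≤ ε / 4 := min_le_left _ _
  have hε2 : ε' ≤ ε / 2 := min_le_left _ _
  have hε4 : ε' ≤ c / 4 := min_le_right _ _
  refine ⟨Real.exp (2 * l + 2 * c * r + |C₁| + c), fun a n => ?_⟩
  rw [← Real.exp_add]
  have ha0 : 0 ≤ |(a : ℝ)| := abs_nonneg _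
  rcases lt_or_ge n r with hn | hn
  · refine (hmg a n (by omega)).trans ((hgC a).trans ?_)
    rw [hCl, ← Real.exp_add]
    refine Real.exp_le_exp.2 ?_
    have e1 : η * |(a : ℝ)| ≤ ε * |(a : ℝ)| := by gcongr; linarith
    have e2 : c / (2 * r) * n ≤ c := by
      have : (n : ℝ) ≤ r := by exact_mod_cast hn.le
      calc c / (2 * r) * n ≤ c / (2 * r) * r := by gcongr
        _ = c / 2 := by field_simp
        _ ≤ c := by linarith
    have := abs_nonneg C₁
    have : 0 < 2 * c * r := by positivity
    linarith
  · obtain ⟨K, hK1, hK2⟩ : ∃ K, r * (K + 1) ≤ n ∧ n < r * (K + 1) + r := by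
      refine ⟨n / r - 1, ?_, ?_⟩
      · rw [Nat.sub_add_cancel (Nat.div_pos hn hr)]
        exact Nat.mul_div_le n r
      · rw [Nat.sub_add_cancel (Nat.div_pos hn hr)]
        exact Nat.lt_mul_div_succ n hr |>.trans_eq (by rw [Nat.mul_succ])
    have hKn : ((r * K : ℕ) : ℝ) ≤ n := by
      have : r * K ≤ n := by rw [Nat.mul_succ] at hK1; omega
      exact_mod_cast this
    have hKn' : (n : ℝ) - 2 * r ≤ ((r * K : ℕ) : ℝ) := by
      have : n ≤ r * K + 2 * r := by rw [Nat.mul_succ] at hK2; omega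
      have : (n : ℝ) ≤ ((r * K : ℕ) : ℝ) + 2 * r := by exact_mod_cast this
      linarith
    have hB := hpow a n K hK1 hK2 (Real.exp (2 * l + η * (2 * |(a : ℝ)| + n))) (by
      intro j hj
      refine (mul_le_mul (hgC _) (hgC _) (hg0 _) (by positivity)).trans ?_
      rw [hCl, ← Real.exp_add, ← Real.exp_add, ← Real.exp_add]
      refine Real.exp_le_exp.2 ?_
      have e1 : |((a + j + (r * K : ℕ) : ℤ) : ℝ)| ≤ |(a : ℝ)| + n := by
        have h2 := abs_cast_add_le a (j + r * K)
        have h3 : ((j + r * K : ℕ) : ℝ) ≤ n := by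
          have : j + r * K ≤ n := by rw [Nat.mul_succ] at hK1; omega
          exact_mod_cast this
        have h4 : a + j + ((r * K : ℕ) : ℤ) = a + ((j + r * K : ℕ) : ℤ) := by push_cast; ring
        rw [h4]
        linarith
      have e2 := mul_le_mul_of_nonneg_left e1 hη0.le
      linarith)
    have hsum := hC₁ a (r * K)
    have hexp : m a n ^ r ≤
        Real.exp (2 * l + 2 * c * r + |C₁| + c + (ε * |(a : ℝ)| - c / (2 * r) * n)) ^ r := by
      refine hB.trans ?_
      rw [← Real.exp_nat_mul, ← Real.exp_nat_mul, ← Real.exp_add]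
      refine Real.exp_le_exp.2 ?_
      have e1 : (r : ℝ) * (c / (2 * r) * n) = c / 2 * n := by field_simp
      have e2 : ((r * K : ℕ) : ℝ) * (-c) ≤ ((n : ℝ) - 2 * r) * (-c) :=
        mul_le_mul_of_nonpos_right hKn' (by linarith)
      have e3 : ε' * (|(a : ℝ)| + ((r * K : ℕ) : ℝ)) ≤ ε / 2 * |(a : ℝ)| + c / 4 * n := by
        rw [mul_add]
        gcongr
      have e4 : (r : ℝ) * (η * (2 * |(a : ℝ)| + n)) ≤ r * (ε / 2 * |(a : ℝ)|) + c / 4 * n := by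
        have f1 : (r : ℝ) * η * n ≤ c / 4 * n := by gcongr
        have f2 : (r : ℝ) * (η * (2 * |(a : ℝ)|)) ≤ r * (ε / 4 * (2 * |(a : ℝ)|)) := by gcongr
        nlinarith
      have e5 : ε / 2 * |(a : ℝ)| ≤ r * (ε / 2 * |(a : ℝ)|) :=
        le_mul_of_one_le_left (by positivity) hr1
      have e6 : |C₁| ≤ r * |C₁| := le_mul_of_one_le_left (abs_nonneg _) hr1
      have e7 : 2 * c * r ≤ r * (2 * c * r) := le_mul_of_one_le_left (by positivity) hr1
      have e8 := le_abs_self C₁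
      have e9 : 0 ≤ r * c := by positivity
      have e10 : (r : ℝ) * (2 * l + 2 * c * r + |C₁| + c + (ε * |(a : ℝ)| - c / (2 * r) * n)) =
          r * (2 * l) + r * (2 * c * r) + r * |C₁| + r * c + 2 * (r * (ε / 2 * |(a : ℝ)|)) -
            r * (c / (2 * r) * n) := by ring
      rw [e10, e1, mul_add]
      linarith
    exact (pow_le_pow_iff_left₀ (hm0 _ _) (Real.exp_pos _).le (by omega)).1 hexp

/-- A truncation of the logarithm from below with negative mean. -/
theorem exists_integrable_log_bound {S : Type*} [MeasurableSpace S] {μ : Measure S}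
    [IsProbabilityMeasure μ] {L : S → ℝ≥0∞} (hL : Measurable L) (hneg : MeanLogNeg μ L) :
    ∃ f : S → ℝ, Measurable f ∧ Integrable f μ ∧ ∫ x, f x ∂μ < 0 ∧
      ∀ᵐ x ∂μ, L x ≤ ENNReal.ofReal (Real.exp (f x)) := by
  set Pp : S → ℝ≥0∞ := fun x => (ENNReal.log (L x)).toENNReal with hP
  set Q : S → ℝ≥0∞ := fun x => (-ENNReal.log (L x)).toENNReal with hQ
  have hlog : Measurable fun x => ENNReal.log (L x) := ENNReal.measurable_log.comp hL
  have hPm : Measurable Pp := hlog.ereal_toENNReal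
  have hQm : Measurable Q := (measurable_ereal_toENNReal.comp (continuous_neg.measurable.comp hlog))
  -- The mean of log⁻ may be infinite, but by monotone convergence some truncation at N already
  -- exceeds the mean of log⁺.
  have hsup : ∫⁻ x, Q x ∂μ = ⨆ N : ℕ, ∫⁻ x, min (Q x) N ∂μ := by
    rw [← lintegral_iSup (fun N => hQm.min measurable_const)
      (fun N N' h x => min_le_min le_rfl (by exact_mod_cast h))]
    refine lintegral_congr fun x => ?_
    rw [← inf_iSup_eq, ENNReal.iSup_natCast, inf_top_eq]
  have hneg' : ∫⁻ x, Pp x ∂μ < ∫⁻ x, Q x ∂μ := hneg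
  rw [hsup, lt_iSup_iff] at hneg'
  obtain ⟨N, hN⟩ := hneg'
  have hQN : ∫⁻ x, min (Q x) N ∂μ ≠ ∞ := by
    refine ne_of_lt (lt_of_le_of_lt (lintegral_mono fun x => min_le_right _ _) ?_)
    simp
  have hPfin := hN.ne_top
  have hi1 := integrable_toReal_of_lintegral_ne_top hPm.aemeasurable hPfin
  have hi2 := integrable_toReal_of_lintegral_ne_top (hQm.min measurable_const).aemeasurable hQN
  refine ⟨fun x => (Pp x).toReal - (min (Q x) N).toReal,
    hPm.ennreal_toReal.sub (hQm.min measurable_const).ennreal_toReal, hi1.sub hi2, ?_, ?_⟩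
  · rw [integral_sub hi1 hi2, integral_toReal hPm.aemeasurable (ae_lt_top hPm hPfin),
      integral_toReal (hQm.min measurable_const).aemeasurable
        (ae_lt_top (hQm.min measurable_const) hQN), sub_neg]
    exact (ENNReal.toReal_lt_toReal hPfin hQN).2 hN
  · filter_upwards [ae_lt_top hPm hPfin] with x hx
    rcases eq_or_ne (L x) 0 with h0 | h0
    · simp [h0]
    have htop : L x ≠ ∞ := by
      intro h
      simp [hP, h] at hx
    have hlx := ENNReal.log_pos_real h0 htop
    have hpos := ENNReal.toReal_pos h0 htop
    rw [← ENNReal.ofReal_toReal htop]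
    refine ENNReal.ofReal_le_ofReal ?_
    rw [← Real.exp_log hpos]
    refine Real.exp_le_exp.2 ?_
    simp only [hP, hQ, hlx, EReal.real_coe_toENNReal, ← EReal.coe_neg]
    rcases le_total 0 (Real.log (L x).toReal) with h | h
    · rw [ENNReal.ofReal_of_nonpos (by linarith : -Real.log (L x).toReal ≤ 0)]
      simp [ENNReal.toReal_ofReal h]
    · have h1 : (min (ENNReal.ofReal (-Real.log (L x).toReal)) (N : ℝ≥0∞)).toReal ≤
          -Real.log (L x).toReal := by
        refine (ENNReal.toReal_mono ENNReal.ofReal_ne_top (min_le_left _ _)).trans ?_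
        rw [ENNReal.toReal_ofReal (by linarith)]
      rw [ENNReal.ofReal_of_nonpos h, ENNReal.toReal_zero]
      linarith

/-- A one-sided substitute for the subadditive ergodic theorem, uniform over windows: an integrable
majorant of log L_r with negative mean is summed over windows, and submultiplicativity turns these
sums into exponential decay. The moment of log⁺ L_1 controls incomplete blocks. -/
theorem ae_expBd_of_meanLogNeg {α : Type*} [MeasurableSpace α] {μ : Measure (ℤ → α)}
    [IsProbabilityMeasure μ] (h : Ergodic (shift : (ℤ → α) → ℤ → α) μ)
    {L : ℕ → (ℤ → α) → ℝ≥0∞} (hL : ∀ n, Measurable (L n)) (h0 : ∀ x, L 0 x ≤ 1)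
    (hsub : ∀ (k n : ℕ) x, L (k + n) x ≤ L n (tr k x) * L k x) (h1 : meanLogPlus μ (L 1) < ∞)
    {r : ℕ} (hr : 1 ≤ r) (hneg : MeanLogNeg μ (L r)) :
    ∃ c, 0 < c ∧ ∀ᵐ x ∂μ, (∀ (a : ℤ) n, L n (tr a x) ≠ ∞) ∧
      ExpBd c fun a n => (L n (tr a x)).toReal := by
  obtain ⟨f, hfm, hfi, hfneg, hfL⟩ := exists_integrable_log_bound (hL r) hneg
  have hr0 : (0 : ℝ) < r := by exact_mod_cast hr
  refine ⟨-(∫ x, f x ∂μ) / (2 * r), div_pos (by linarith) (by positivity), ?_⟩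
  have htr := fun t : ℤ => measurePreserving_tr h.toMeasurePreserving t
  have hL1 := ae_tempered (P := μ) (W := fun t x => L 1 (tr t x))
    (fun t => ((hL 1).comp (measurable_tr t)).aemeasurable) (fun t => by
      have h2 : ∀ t, μ.map (fun x => L 1 (tr t x)) = μ.map (L 1) := fun t => by
        rw [← (htr t).map_eq, Measure.map_map (hL 1) (measurable_tr t), (htr t).map_eq]
        rfl
      rw [h2, h2]) (by simpa only [tr_zero] using h1)
  have hf' : ∀ᵐ x ∂μ, ∀ t : ℤ, L r (tr t x) ≤ ENNReal.ofReal (Real.exp (f (tr t x))) :=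
    ae_all_iff.2 fun t => (htr t).quasiMeasurePreserving.ae hfL
  have hwin : ∀ᵐ x ∂μ, ∀ k : ℕ, ∃ C, ∀ (a : ℤ) (n : ℕ),
      ∑ i ∈ Finset.range n, f (tr (a + i) x) ≤
        n * (∫ x, f x ∂μ) + 1 / ((k : ℝ) + 1) * (|(a : ℝ)| + n) + C :=
    ae_all_iff.2 fun k => ae_sum_window_le h hfm hfi (by positivity)
  filter_upwards [hL1, hf', hwin] with x ⟨hx1, hx2⟩ hx3 hx4
  have hfin : ∀ (n : ℕ) (a : ℤ), L n (tr a x) ≠ ∞ := by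
    intro n
    induction n with
    | zero => exact fun a => ne_top_of_le_ne_top ENNReal.one_ne_top (h0 _)
    | succ n ih =>
      intro a
      refine ne_top_of_le_ne_top (ENNReal.mul_ne_top ?_ (ih a)) (hsub n 1 (tr a x))
      rw [tr_tr]
      exact hx1 _
  refine ⟨fun a n => hfin n a, ?_⟩
  refine expBd_of_blocks (m := fun a n => (L n (tr a x)).toReal) (f := fun t => f (tr t x)) (fun _ _ => ENNReal.toReal_nonneg)
    (fun a => ?_) (fun a k n => ?_) hx2 hr (fun a => ?_)
    (c := -(∫ x, f x ∂μ)) (by linarith) fun ε hε => ?_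
  · simpa using ENNReal.toReal_mono ENNReal.one_ne_top (h0 (tr a x))
  · have h2 := hsub k n (tr a x)
    rw [tr_tr, add_comm (k : ℤ) a, mul_comm] at h2
    rw [← ENNReal.toReal_mul]
    exact ENNReal.toReal_mono (ENNReal.mul_ne_top (hfin _ _) (hfin _ _)) h2
  · simpa [ENNReal.toReal_ofReal (Real.exp_pos _).le] using
      ENNReal.toReal_mono ENNReal.ofReal_ne_top (hx3 a)
  · obtain ⟨k, hk⟩ := exists_nat_one_div_lt hε
    obtain ⟨C, hC⟩ := hx4 k
    refine ⟨C, fun a n => (hC a n).trans ?_⟩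
    rw [neg_neg]
    gcongr

end CHModel

end

noncomputable section

namespace CHModel

/-! ### Measurability -/

/-- Restriction to a countable dense set is a continuous injection between Polish spaces, hence a
measurable embedding. So pointwise evaluations determine the Borel structure. -/
theorem measurable_continuousMap {α X Y : Type*} {m : MeasurableSpace α} [MetricSpace X]
    [CompactSpace X] [MetricSpace Y] [CompleteSpace Y] [SecondCountableTopology Y]
    [MeasurableSpace Y] [BorelSpace Y] {f : α → C(X, Y)}
    (hf : ∀ x, Measurable fun a => f a x) : Measurable f := by
  obtain ⟨s, hsc, hsd⟩ := TopologicalSpace.exists_countable_dense X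
  have : Countable s := hsc.to_subtype
  have hemb : MeasurableEmbedding fun (g : C(X, Y)) (x : s) => g x :=
    Continuous.measurableEmbedding (by fun_prop) fun g g' h =>
      DFunLike.coe_injective (Continuous.ext_on hsd g.continuous g'.continuous
        fun x hx => congrFun h ⟨x, hx⟩)
  exact hemb.measurable_comp_iff.1 (measurable_pi_lambda _ fun x => hf x)

section Calculus

variable {α V W : Type*} {m : MeasurableSpace α} [NormedAddCommGroup V] [NormedSpace ℝ V]
  [NormedAddCommGroup W] [NormedSpace ℝ W] [MeasurableSpace W] [BorelSpace W]
  [SecondCountableTopology W]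

/-- In the interior the derivative is a limit of difference quotients; at boundary points it is a
limit of interior derivatives. -/
theorem HasC1.measurable_apply {S : Set V} (hS : S ⊆ closure (interior S)) {F : α → V → W}
    {F' : α → V → V →L[ℝ] W} (hF : ∀ a, HasC1 S (F a) (F' a))
    (hm : ∀ z ∈ S, Measurable fun a => F a z) {z : V} (hz : z ∈ S) (v : V) :
    Measurable fun a => F' a z v := by
  have hint : ∀ z ∈ interior S, Measurable fun a => F' a z v := by
    intro z hz
    have ht : Tendsto (fun n : ℕ => z + ((n : ℝ) + 1)⁻¹ • v) atTop (𝓝 (z + (0 : ℝ) • v)) :=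
      tendsto_const_nhds.add (((tendsto_natCast_atTop_atTop.atTop_add
        tendsto_const_nhds).inv_tendsto_atTop).smul_const v)
    rw [zero_smul, add_zero] at ht
    obtain ⟨N, hN⟩ := eventually_atTop.1 (ht.eventually (isOpen_interior.mem_nhds hz))
    refine measurable_of_tendsto_metrizable (f := fun (n : ℕ) a =>
      (((n + N : ℕ) : ℝ) + 1) • (F a (z + (((n + N : ℕ) : ℝ) + 1)⁻¹ • v) - F a z)) (fun n => ?_) ?_
    · exact ((hm _ (interior_subset (hN _ (Nat.le_add_left _ _)))).sub
        (hm _ (interior_subset hz))).const_smul (((n + N : ℕ) : ℝ) + 1)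
    · refine tendsto_pi_nhds.2 fun a => ?_
      have h1 := ((hF a).deriv z hz).lim_real v
      have h2 : Tendsto (fun n : ℕ => ((n + N : ℕ) : ℝ) + 1) atTop atTop :=
        ((tendsto_natCast_atTop_atTop.comp (tendsto_add_atTop_nat N))).atTop_add
          tendsto_const_nhds
      exact h1.comp h2
  obtain ⟨u, hu, hut⟩ := mem_closure_iff_seq_limit.1 (hS hz)
  refine measurable_of_tendsto_metrizable (f := fun n a => F' a (u n) v)
    (fun n => hint _ (hu n)) (tendsto_pi_nhds.2 fun a => ?_)
  have h1 : Tendsto (fun n => F' a (u n)) atTop (𝓝 (F' a z)) :=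
    ((hF a).cont' z hz).tendsto.comp
      (tendsto_nhdsWithin_iff.2 ⟨hut, Eventually.of_forall fun n => interior_subset (hu n)⟩)
  exact ((ContinuousLinearMap.apply ℝ W v).continuous.tendsto _).comp h1

theorem measurable_clm_apply [FiniteDimensional ℝ V] [MeasurableSpace V] [BorelSpace V]
    {A : α → V →L[ℝ] W} {b : α → V} (hA : ∀ v, Measurable fun a => A a v) (hb : Measurable b) :
    Measurable fun a => A a (b a) := by
  have h : (fun a => A a (b a)) = fun a => ∑ i, LinearMap.toContinuousLinearMap
      ((Module.finBasis ℝ V).coord i) (b a) • A a (Module.finBasis ℝ V i) := by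
    funext a
    conv_lhs => rw [clm_eq_sum_basis (A a)]
    simp
  rw [h]
  exact Finset.measurable_sum _ fun i _ =>
    ((ContinuousLinearMap.measurable _).comp hb).smul (hA _)

end Calculus

instance instCompleteSpaceOrthant (q : ℕ) : CompleteSpace (orthant q) :=
  (isClosed_orthant q).completeSpace_coe

namespace Family

variable {d p q : ℕ} {M : Family d p q} {α : Type*} {m : MeasurableSpace α}

/-- Carathéodory functions, continuous in the state and measurable in the lags, are jointly
measurable. -/
theorem measurable_comp_dom {W : Type*} [NormedAddCommGroup W] [MeasurableSpace W] [BorelSpace W]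
    {F : (Fin p → ℝ) → E d × E q → W} (hF : ∀ x, ContinuousOn (F x) M.dom)
    (hm : ∀ z ∈ M.dom, Measurable fun x => F x z) (θ : M.K) {y : α → Fin p → ℝ}
    (hy : Measurable y) {u : α → orthant q} (hu : Measurable u) :
    Measurable fun a => F (y a) (θ, u a) := by
  have h := measurable_uncurry_of_continuous_of_measurable
    (u := fun (w : orthant q) (x : Fin p → ℝ) => F x ((θ : E d), (w : E q)))
    (fun x => (hF x).comp_continuous (by fun_prop) fun w => ⟨θ.2, w.2⟩)
    (fun w => hm _ ⟨θ.2, w.2⟩)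
  exact h.comp (hu.prodMk hy)

theorem continuousOn_psiV (x : Fin p → ℝ) : ContinuousOn (M.psiV x) M.dom := by
  refine (PiLp.continuous_toLp 2 _).comp_continuousOn (continuousOn_pi.2 fun j => ?_)
  by_cases h : (j : ℕ) = 0
  · simp only [h, if_true]
    exact M.g_cont x
  · simp only [h, if_false]
    fun_prop

theorem measurable_psiV_of_mem {z : E d × E q} (hz : z ∈ M.dom) :
    Measurable fun x => M.psiV x z := by
  refine (WithLp.measurable_toLp 2 _).comp (measurable_pi_lambda _ fun j => ?_)
  by_cases h : (j : ℕ) = 0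
  · simp only [h, if_true]
    exact M.g_meas _ hz.1 _ hz.2
  · simp only [h, if_false]
    fun_prop

theorem measurable_psi1_of_mem (hM : M.Regular) {z : E d × E q} (hz : z ∈ M.dom)
    (v : E d × E q) : Measurable fun x => M.psi1 x z v :=
  HasC1.measurable_apply hM.dom_subset hM.hasC1_psiV (fun _ h => measurable_psiV_of_mem h) hz v

theorem measurable_psi2_of_mem (hM : M.Regular) {z : E d × E q} (hz : z ∈ M.dom)
    (v w : E d × E q) : Measurable fun x => M.psi2 x z v w :=
  HasC1.measurable_apply (F := fun x z => M.psi1 x z w) hM.dom_subset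
    (fun x => (hM.hasC1_psi1 x).clm_comp (ContinuousLinearMap.apply ℝ (E q) w))
    (fun _ h => measurable_psi1_of_mem hM h w) hz v

theorem measurable_along1 (hM : M.Regular) {y : α → Fin p → ℝ} (hy : Measurable y)
    {s : α → M.H} (hs : Measurable s) (θ : M.K) (v : E d × E q) :
    Measurable fun a => along1 hM (y a) (s a) θ v :=
  measurable_comp_dom (F := fun x z => M.psi1 x z v)
    (fun x => ((hM.hasC1_psi1 x).clm_comp (ContinuousLinearMap.apply ℝ (E q) v)).cont)
    (fun _ h => measurable_psi1_of_mem hM h v) θ hy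
    ((ContinuousEvalConst.continuous_eval_const θ).measurable.comp hs)

theorem measurable_along2 (hM : M.Regular) {y : α → Fin p → ℝ} (hy : Measurable y)
    {s : α → M.H} (hs : Measurable s) (θ : M.K) (v w : E d × E q) :
    Measurable fun a => along2 hM (y a) (s a) θ v w :=
  measurable_comp_dom (F := fun x z => M.psi2 x z v w)
    (fun x => (((ContinuousLinearMap.apply ℝ (E q) w).continuous.comp
      (ContinuousLinearMap.apply ℝ (E d × E q →L[ℝ] E q) v).continuous).comp_continuousOn
        (hM.hasC1_psi1 x).cont'))
    (fun _ h => measurable_psi2_of_mem hM h v w) θ hy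
    ((ContinuousEvalConst.continuous_eval_const θ).measurable.comp hs)

theorem measurable_Phi {y : α → Fin p → ℝ} (hy : Measurable y) {s : α → M.H}
    (hs : Measurable s) : Measurable fun a => M.Phi (y a) (s a) :=
  measurable_continuousMap fun θ =>
    Measurable.subtype_mk (measurable_comp_dom (F := M.psiV) continuousOn_psiV
      (fun _ h => measurable_psiV_of_mem h) θ hy
      ((ContinuousEvalConst.continuous_eval_const θ).measurable.comp hs))

theorem measurable_lags {n : ℕ} {y : ℤ → α → ℝ} {t : ℤ} (hy : ∀ s ≤ t, Measurable (y s)) :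
    Measurable fun a => (lags (fun s => y s a) t : Fin n → ℝ) :=
  measurable_pi_lambda _ fun i => hy _ (by simp)

/-- Measurability is tracked with respect to the coordinates at times before n only, which later
yields adaptedness. -/
theorem measurable_hHat (ς : orthant q) {y : ℤ → α → ℝ} (n : ℕ)
    (hy : ∀ s < (n : ℤ), Measurable (y s)) :
    Measurable fun a => M.hHat (fun s => y s a) ς n := by
  induction n with
  | zero => exact measurable_const
  | succ n ih =>
    exact measurable_Phi (measurable_lags fun s hs => hy s (by push_cast; omega))
      (ih fun s hs => hy s (by push_cast; omega))

theorem measurable_hHatD (hM : M.Regular) (ς : orthant q) {y : ℤ → α → ℝ} (n : ℕ)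
    (hy : ∀ s < (n : ℤ), Measurable (y s)) (θ : M.K) (v : E d) :
    Measurable fun a => hHatD hM (fun s => y s a) ς n θ v := by
  induction n with
  | zero => exact measurable_const
  | succ n ih =>
    have hy' : ∀ s < (n : ℤ), Measurable (y s) := fun s hs => hy s (by push_cast; omega)
    have h := measurable_clm_apply
      (measurable_along1 hM (measurable_lags (t := n) fun s hs => hy s (by push_cast; omega))
        (measurable_hHat ς n hy') θ)
      ((measurable_const (a := v)).prodMk (ih hy'))
    simpa only [hHatD, stepD_apply, ContinuousLinearMap.comp_apply, graphD_apply] using h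

theorem measurable_hHatE (hM : M.Regular) (ς : orthant q) {y : ℤ → α → ℝ} (n : ℕ)
    (hy : ∀ s < (n : ℤ), Measurable (y s)) (θ : M.K) (v w : E d) :
    Measurable fun a => hHatE hM (fun s => y s a) ς n θ v w := by
  induction n with
  | zero => exact measurable_const
  | succ n ih =>
    have hy' : ∀ s < (n : ℤ), Measurable (y s) := fun s hs => hy s (by push_cast; omega)
    have hl : Measurable fun a => (lags (fun s => y s a) (n : ℤ) : Fin p → ℝ) :=
      measurable_lags fun s hs => hy s (by push_cast; omega)
    have hs := measurable_hHat (M := M) ς n hy'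
    have hD : ∀ v, Measurable fun a => (v, hHatD hM (fun s => y s a) ς n θ v) := fun v =>
      measurable_const.prodMk (measurable_hHatD hM ς n hy' θ v)
    have h1 := measurable_clm_apply (measurable_along1 hM hl hs θ)
      ((measurable_const (a := (0 : E d))).prodMk (ih hy'))
    have h2 := measurable_clm_apply
      (A := fun a => along2 hM (lags (fun s => y s a) (n : ℤ)) (M.hHat (fun s => y s a) ς n) θ
        (v, hHatD hM (fun s => y s a) ς n θ v)) (fun w' => ?_) (hD w)
    · simp only [hHatE, stepE_apply, add_apply, act2_apply, quad_apply, jac_apply, graphD_apply]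
      exact h1.add h2
    · exact measurable_clm_apply
        (A := fun a => (along2 hM (lags (fun s => y s a) (n : ℤ))
          (M.hHat (fun s => y s a) ς n) θ).flip w')
        (fun v' => measurable_along2 hM hl hs θ v' w') (hD v)

/-- The vector `ĥ_t''`. -/
def hatSnd (hM : M.Regular) (x : ℤ → ℝ) (ς : orthant q) (n : ℕ) : M.H2 :=
  ⟨fun θ => coords d q (hHatE hM x ς n θ), (coords d q).continuous.comp (hHatE hM x ς n).continuous⟩

theorem measurable_hatSnd (hM : M.Regular) (ς : orthant q) {y : ℤ → α → ℝ} (n : ℕ)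
    (hy : ∀ s < (n : ℤ), Measurable (y s)) :
    Measurable fun a => hatSnd hM (fun s => y s a) ς n := by
  refine measurable_continuousMap fun θ => ?_
  refine (WithLp.measurable_toLp 2 _).comp (measurable_pi_lambda _ fun l => ?_)
  exact (EuclideanSpace.proj (𝕜 := ℝ) l.1).continuous.measurable.comp
    (measurable_hHatE hM ς n hy θ _ _)

theorem measurable_flow {n : ℕ} {y : α → ℤ → ℝ} (hy : Measurable y) (a : ℤ) {s : α → M.H}
    (hs : Measurable s) : Measurable fun ω => flow (M.sys (y ω)) a n (s ω) := by
  induction n with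
  | zero => exact hs
  | succ n ih =>
    exact measurable_Phi (measurable_lags (y := fun s ω => y ω s) fun s _ =>
      (measurable_pi_apply s).comp hy) ih

theorem continuous_Phi (x : Fin p → ℝ) : Continuous (M.Phi x) := by
  refine ContinuousMap.continuous_of_continuous_uncurry _ ?_
  refine Continuous.subtype_mk ?_ _
  exact (continuousOn_psiV x).comp_continuous (f := fun z : M.H × M.K => ((z.2 : E d), (z.1 z.2 : E q)))
    (by fun_prop) fun z => ⟨z.2.2, (z.1 z.2).2⟩

theorem continuous_flow (x : ℤ → ℝ) (a : ℤ) (n : ℕ) : Continuous (flow (M.sys x) a n) := by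
  induction n with
  | zero => exact continuous_id
  | succ n ih => exact (continuous_Phi _).comp ih

end Family

/-- The quotient is continuous off the diagonal, so a dense set of pairs suffices; diagonal pairs
contribute 0/0 = 0. With a countable dense set this makes the Lipschitz coefficients measurable. -/
theorem lipCoeff_eq_iSup {S : Type*} [MetricSpace S] {φ : S → S} (hφ : Continuous φ)
    {D : Set (S × S)} (hD : Dense D) :
    lipCoeff φ = ⨆ z ∈ D, edist (φ z.1) (φ z.2) / edist z.1 z.2 := by
  refine le_antisymm (iSup₂_le fun x y => iSup_le fun hxy => ?_) (iSup₂_le fun z _ => ?_)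
  · refine le_of_forall_lt fun R hR => ?_
    have h0 : edist x y ≠ 0 := fun h => hxy (edist_eq_zero.1 h)
    have hc : Tendsto (fun z : S × S => edist (φ z.1) (φ z.2) / edist z.1 z.2) (𝓝 (x, y))
        (𝓝 (edist (φ x) (φ y) / edist x y)) :=
      ENNReal.Tendsto.div
        ((hφ.comp continuous_fst).edist (hφ.comp continuous_snd)).continuousAt
        (Or.inr h0) (continuous_fst.edist continuous_snd).continuousAt
        (Or.inl (edist_ne_top _ _))
    obtain ⟨z, hzD, hz⟩ := hD.inter_nhds_nonempty (hc.eventually (lt_mem_nhds hR))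
    exact lt_of_lt_of_le (show R < _ from hz) (le_iSup₂_of_le z hzD le_rfl)
  · rcases eq_or_ne z.1 z.2 with h | h
    · simp [h]
    · exact le_iSup₂_of_le z.1 z.2 (le_iSup_of_le h le_rfl)

theorem Family.measurable_lipCoeff_flow {d p q : ℕ} {M : Family d p q} (a : ℤ) (n : ℕ) :
    Measurable fun x : ℤ → ℝ => lipCoeff (flow (M.sys x) a n) := by
  obtain ⟨D, hDc, hD⟩ := TopologicalSpace.exists_countable_dense (M.H × M.H)
  simp_rw [fun x : ℤ → ℝ => lipCoeff_eq_iSup (Family.continuous_flow (M := M) x a n) hD]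
  refine Measurable.biSup _ hDc fun z _ => ?_
  exact ((Family.measurable_flow measurable_id a measurable_const).edist
    (Family.measurable_flow measurable_id a measurable_const)).div_const _

theorem supNorm_eq_enorm {X V : Type*} [TopologicalSpace X] [CompactSpace X]
    [NormedAddCommGroup V] (f : C(X, V)) : supNorm f = ‖f‖ₑ := by
  refine le_antisymm (iSup_le fun θ => ?_) ?_
  · rw [← ofReal_norm, ← ofReal_norm]
    exact ENNReal.ofReal_le_ofReal (f.norm_coe_le_norm θ)
  · rcases eq_or_ne (supNorm f) ∞ with h | h
    · simp [h]
    · rw [← ofReal_norm]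
      refine ENNReal.ofReal_le_of_le_toReal
        ((f.norm_le ENNReal.toReal_nonneg).2 fun θ => ?_)
      rw [← toReal_enorm]
      exact ENNReal.toReal_mono h (le_iSup (fun θ => ‖f θ‖ₑ) θ)

end CHModel

end

noncomputable section

namespace CHModel

/-! ### Stationary sequences -/

section Stationary

variable {Ω Ω' S : Type*} [MeasurableSpace Ω] [MeasurableSpace Ω'] [MeasurableSpace S]
  {P : Measure Ω} {μ : Measure Ω'}

theorem IsStationarySeq.map_eq {v : ℤ → Ω → S} (hv : IsStationarySeq P v) (t : ℤ) :
    P.map (v t) = P.map (v 0) := by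
  have hm : Measurable fun ω t => v t ω := measurable_pi_lambda _ hv.1
  have h1 := (measurePreserving_tr hv.2 t).map_eq
  have h2 := congrArg (fun ν => ν.map fun x : ℤ → S => x 0) h1
  rw [Measure.map_map (measurable_pi_apply 0) (measurable_tr t),
    Measure.map_map ((measurable_pi_apply 0).comp (measurable_tr t)) hm,
    Measure.map_map (measurable_pi_apply 0) hm] at h2
  convert h2 using 2
  · funext ω
    simp [tr]
  · rfl

theorem _root_.MeasureTheory.MeasurePreserving.meanLogPlus_comp {f : Ω → Ω'}
    (hf : MeasurePreserving f P μ) {F : Ω' → ℝ≥0∞} (hF : Measurable F) :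
    meanLogPlus P (fun ω => F (f ω)) = meanLogPlus μ F :=
  hf.lintegral_comp (measurable_ereal_toENNReal.comp (ENNReal.measurable_log.comp hF))

theorem _root_.MeasureTheory.MeasurePreserving.meanLogMinus_comp {f : Ω → Ω'}
    (hf : MeasurePreserving f P μ) {F : Ω' → ℝ≥0∞} (hF : Measurable F) :
    meanLogMinus P (fun ω => F (f ω)) = meanLogMinus μ F :=
  hf.lintegral_comp (measurable_ereal_toENNReal.comp (ENNReal.measurable_log.comp hF).neg)

theorem meanLogPlus_congr {F G : Ω → ℝ≥0∞} (h : F =ᵐ[P] G) :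
    meanLogPlus P F = meanLogPlus P G :=
  lintegral_congr_ae (h.mono fun ω hω => by simp only [hω])

theorem ae_tempered_of_shift {α : Type*} [MeasurableSpace α] {ν : Measure (ℤ → α)}
    [IsProbabilityMeasure ν] (hν : MeasurePreserving (shift : (ℤ → α) → ℤ → α) ν ν)
    {w : (ℤ → α) → ℝ≥0∞} (hw : Measurable w) (hlog : meanLogPlus ν w < ∞) :
    ∀ᵐ x ∂ν, (∀ t, w (tr t x) ≠ ∞) ∧ Tempered fun t => (w (tr t x)).toReal := by
  refine ae_tempered (P := ν) (W := fun t x => w (tr t x))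
    (fun t => (hw.comp (measurable_tr t)).aemeasurable) (fun t => ?_) (by simpa only [tr_zero])
  have h2 : ∀ t, ν.map (fun x => w (tr t x)) = ν.map w := fun t => by
    conv_rhs => rw [← (measurePreserving_tr hν t).map_eq]
    rw [Measure.map_map hw (measurable_tr t)]
    rfl
  rw [h2, h2]

/-- Applying F to all translates commutes with the shift, so the new law is a factor of an ergodic
system. -/
theorem IsStationaryErgodicSeq.map {v : ℤ → Ω → S} (hv : IsStationaryErgodicSeq P v)
    {T : Type*} [MeasurableSpace T] {F : (ℤ → S) → T} (hF : Measurable F) {e : ℤ → Ω → T}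
    (he : ∀ t, Measurable (e t)) (h : ∀ᵐ ω ∂P, ∀ t, e t ω = F (tr t fun s => v s ω)) :
    IsStationaryErgodicSeq P e := by
  refine ⟨he, ?_⟩
  have hG : Measurable fun (x : ℤ → S) (t : ℤ) => F (tr t x) :=
    measurable_pi_lambda _ fun t => hF.comp (measurable_tr t)
  have hmap : (P.map fun ω t => e t ω) =
      (P.map fun ω t => v t ω).map fun (x : ℤ → S) (t : ℤ) => F (tr t x) := by
    rw [Measure.map_map hG (measurable_pi_lambda _ hv.1)]
    exact Measure.map_congr (h.mono fun ω hω => funext hω)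
  rw [hmap]
  refine MeasurePreserving.ergodic_of_ergodic_semiconj ⟨hG, rfl⟩ hv.2 (measurable_tr 1) fun x => ?_
  funext t
  simp only [shift_eq_tr, tr_tr]
  rfl

end Stationary

theorem lipCoeff_comp_le {S : Type*} [MetricSpace S] (φ ψ : S → S) :
    lipCoeff (φ ∘ ψ) ≤ lipCoeff φ * lipCoeff ψ := by
  refine iSup₂_le fun s s' => iSup_le fun hs => ?_
  simp only [Function.comp_apply]
  rcases eq_or_ne (ψ s) (ψ s') with h | h
  · simp [h]
  have h0 : edist (ψ s) (ψ s') ≠ 0 := fun h' => h (edist_eq_zero.1 h')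
  have h1 : edist (φ (ψ s)) (φ (ψ s')) / edist s s' =
      edist (φ (ψ s)) (φ (ψ s')) / edist (ψ s) (ψ s') * (edist (ψ s) (ψ s') / edist s s') := by
    rw [← mul_div_assoc, ENNReal.div_mul_cancel h0 (edist_ne_top _ _)]
  rw [h1]
  refine mul_le_mul' ?_ ?_
  · exact le_iSup_of_le _ (le_iSup_of_le _ (le_iSup_of_le h le_rfl))
  · exact le_iSup_of_le _ (le_iSup_of_le _ (le_iSup_of_le hs le_rfl))

variable {d p q : ℕ} {M : Family d p q}

namespace Family

theorem flow_sys_tr (t : ℤ) (x : ℤ → ℝ) (a : ℤ) (n : ℕ) :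
    flow (M.sys (tr t x)) a n = flow (M.sys x) (t + a) n := by
  induction n with
  | zero => rfl
  | succ n ih =>
    rw [flow, flow, ih, add_assoc]
    exact congrArg (· ∘ _) (sys_translate x t (a + n))

theorem lags_tr {n : ℕ} (t : ℤ) (x : ℤ → ℝ) : (lags (tr t x) 0 : Fin n → ℝ) = lags x t :=
  (lags_translate x t 0).trans (by rw [add_zero])

/-! ### Almost sure properties of the observations -/

theorem ae_contracting {μ : Measure (ℤ → ℝ)} [IsProbabilityMeasure μ]
    (hμ : Ergodic (shift : (ℤ → ℝ) → ℤ → ℝ) μ)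
    (h1 : meanLogPlus μ (fun x => lipCoeff (M.Phi (lags x 0))) < ∞) {r : ℕ} (hr : 1 ≤ r)
    (hneg : MeanLogNeg μ fun x => lipCoeff (M.PhiIter x r 0)) :
    ∃ c, ∀ᵐ x ∂μ, Contracting M x c := by
  set L : ℕ → (ℤ → ℝ) → ℝ≥0∞ := fun n x => lipCoeff (flow (M.sys x) 0 n) with hL
  have hLm : ∀ n, Measurable (L n) := measurable_lipCoeff_flow 0
  have hLtr : ∀ (a : ℤ) n x, L n (tr a x) = lipCoeff (flow (M.sys x) a n) := fun a n x => by
    simp only [hL, flow_sys_tr, add_zero]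
  -- Φ_0^{(r)} covers the times 1 - r, …, 0; stationarity moves the window to start at time 0.
  have hrL : (fun x => lipCoeff (M.PhiIter x r 0)) = fun x => L r (tr (0 - r + 1) x) := by
    funext x
    rw [hLtr, PhiIter_eq_flow]
  have hp := measurePreserving_tr hμ.toMeasurePreserving (0 - r + 1)
  have hL0 : ∀ x, L 0 x ≤ 1 := fun x =>
    iSup₂_le fun s s' => iSup_le fun _ => ENNReal.div_self_le_one
  have hsub : ∀ (k n : ℕ) x, L (k + n) x ≤ L n (tr k x) * L k x := by
    intro k n x
    rw [hLtr]
    simp only [hL]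
    rw [flow_add, zero_add]
    exact lipCoeff_comp_le _ _
  have hL1 : L 1 = fun x => lipCoeff (M.Phi (lags x 0)) := by
    funext x
    simp [hL, flow, sys]
  rw [hrL, MeanLogNeg, hp.meanLogPlus_comp (hLm r), hp.meanLogMinus_comp (hLm r)] at hneg
  obtain ⟨c, hc, h⟩ := ae_expBd_of_meanLogNeg hμ hLm hL0 hsub (hL1 ▸ h1) hr hneg
  refine ⟨c, h.mono fun x hx => ⟨hc, fun a n => hLtr a n x ▸ hx.1 a n, ?_⟩⟩
  have h2 := hx.2
  simp only [hLtr] at h2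
  exact h2

/-- The limit of the backward iterates at time `0`. -/
def limH (M : Family d p q) (ς : orthant q) (x : ℤ → ℝ) : M.H :=
  have : Nonempty M.H := ⟨ContinuousMap.const _ ς⟩
  limUnder atTop fun n : ℕ => flow (M.sys x) (-n) n (ContinuousMap.const _ ς)

/-- Where the iterates diverge, `limUnder` takes a fixed default value, so the limit is measurable
on the whole path space. -/
theorem measurable_limH (ς : orthant q) : Measurable (M.limH ς) := by
  have : Nonempty M.H := ⟨ContinuousMap.const _ ς⟩
  exact (StronglyMeasurable.limUnder fun n : ℕ =>
    (measurable_flow measurable_id (-n) measurable_const).stronglyMeasurable).measurable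

theorem limH_eq {ς : orthant q} {x : ℤ → ℝ} {t : ℤ} {y : M.H} (h : Tendsto
    (fun n : ℕ => flow (M.sys x) (t - n) n (ContinuousMap.const _ ς)) atTop (𝓝 y)) :
    M.limH ς (tr t x) = y := by
  simp only [limH, flow_sys_tr]
  exact h.limUnder_eq

theorem Contracting.exists_orbit {x : ℤ → ℝ} {c : ℝ} (hx : Contracting M x c) {ς : orthant q}
    (h0 : Tempered fun t => dist (M.sys x t (ContinuousMap.const _ ς))
      (ContinuousMap.const _ ς)) :
    (∀ t, M.limH ς (tr (t + 1) x) = M.sys x t (M.limH ς (tr t x))) ∧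
    (Tempered fun t => dist (M.limH ς (tr t x)) (ContinuousMap.const _ ς)) ∧
    ∀ t, Tendsto (fun n : ℕ => flow (M.sys x) (t - n) n (ContinuousMap.const _ ς)) atTop
      (𝓝 (M.limH ς (tr t x))) := by
  obtain ⟨y, hy, hyt, hyl⟩ := exists_tempered_orbit hx.pos hx.bound
    (fun a n s s' => dist_le_lipCoeff (hx.finite a n) s s') _ h0
  have h := fun t => limH_eq (hyl t)
  simp only [h]
  exact ⟨hy, hyt, hyl⟩

theorem dist_le_norm_val (s : M.H) (ς : orthant q) :
    dist s (ContinuousMap.const _ ς) ≤ ‖M.val s‖ + ‖(ς : E q)‖ := by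
  rw [ContinuousMap.dist_le (by positivity)]
  intro θ
  rw [Subtype.dist_eq, dist_eq_norm]
  refine (norm_sub_le _ _).trans ?_
  gcongr
  · exact ContinuousMap.norm_coe_le_norm (M.val s) θ
  · rfl

theorem measurable_val {α : Type*} {m : MeasurableSpace α} {s : α → M.H} (hs : Measurable s) :
    Measurable fun a => M.val (s a) :=
  measurable_continuousMap fun θ => measurable_subtype_coe.comp
    ((ContinuousEvalConst.continuous_eval_const θ).measurable.comp hs)

theorem ae_exists_orbit {μ : Measure (ℤ → ℝ)} [IsProbabilityMeasure μ]
    (hμ : Ergodic (shift : (ℤ → ℝ) → ℤ → ℝ) μ) {ς : orthant q}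
    (hm : meanLogPlus μ (fun x => supNorm fun θ : M.K =>
      ((M.Phi (lags x 0) (ContinuousMap.const _ ς) θ : orthant q) : E q)) < ∞) {c : ℝ}
    (hc : ∀ᵐ x ∂μ, Contracting M x c) :
    ∀ᵐ x ∂μ, (∀ t, M.limH ς (tr (t + 1) x) = M.sys x t (M.limH ς (tr t x))) ∧
      (Tempered fun t => dist (M.limH ς (tr t x)) (ContinuousMap.const _ ς)) ∧
      ∀ t, Tendsto (fun n : ℕ => flow (M.sys x) (t - n) n (ContinuousMap.const _ ς)) atTop
        (𝓝 (M.limH ς (tr t x))) := by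
  have h1 : (fun x : ℤ → ℝ => supNorm fun θ : M.K =>
      ((M.Phi (lags x 0) (ContinuousMap.const _ ς) θ : orthant q) : E q)) =
      fun x => ‖M.val (M.Phi (lags x 0) (ContinuousMap.const _ ς))‖ₑ := by
    funext x
    exact supNorm_eq_enorm (M.val (M.Phi (lags x 0) (ContinuousMap.const _ ς)))
  rw [h1] at hm
  have hw : Measurable fun x : ℤ → ℝ => ‖M.val (M.Phi (lags x 0) (ContinuousMap.const _ ς))‖ₑ :=
    (measurable_val (measurable_Phi (measurable_lags (y := fun s (x : ℤ → ℝ) => x s)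
      fun s _ => measurable_pi_apply s) measurable_const)).enorm
  filter_upwards [hc, ae_tempered_of_shift hμ.toMeasurePreserving hw hm] with x hx ⟨_, hx2⟩
  refine hx.exists_orbit ((hx2.add (tempered_const ‖(ς : E q)‖)).mono fun t => ?_)
  simp only [lags_tr, toReal_enorm]
  exact dist_le_norm_val _ _

/-! ### Norms in terms of coordinates -/

/-- Reduces operator norms to the individual partial derivatives that conditions D.2 and D.3
control. -/
theorem norm_le_sum_dir {W : Type*} [NormedAddCommGroup W] [NormedSpace ℝ W]
    (A : E d × E q →L[ℝ] W) : ‖A‖ ≤ ∑ k, ‖A (dir k)‖ := by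
  refine ContinuousLinearMap.opNorm_le_bound _ (by positivity) fun z => ?_
  have h1 : z = ∑ i, z.1 i • (dir (Sum.inl i) : E d × E q) +
      ∑ i, z.2 i • (dir (Sum.inr i) : E d × E q) := by
    rw [← dir_inr_sum]
    have h2 : ∑ i, z.1 i • (dir (Sum.inl i) : E d × E q) = (z.1, 0) := by
      refine Prod.ext ?_ ?_
      · simp only [Prod.fst_sum, dir, Prod.smul_fst]
        conv_rhs => rw [eq_sum_axis z.1]
        rfl
      · simp [Prod.snd_sum, dir]
    rw [h2]
    simp
  conv_lhs => rw [h1]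
  rw [map_add, map_sum, map_sum, Fintype.sum_sum_type, add_mul, Finset.sum_mul, Finset.sum_mul]
  refine (norm_add_le _ _).trans (add_le_add ?_ ?_)
  · refine (norm_sum_le _ _).trans (Finset.sum_le_sum fun i _ => ?_)
    rw [map_smul, norm_smul, mul_comm]
    gcongr
    exact (PiLp.norm_apply_le z.1 i).trans (norm_fst_le z)
  · refine (norm_sum_le _ _).trans (Finset.sum_le_sum fun i _ => ?_)
    rw [map_smul, norm_smul, mul_comm]
    gcongr
    exact (PiLp.norm_apply_le z.2 i).trans (norm_snd_le z)

theorem norm_le_sum_coord {ι : Type*} [Fintype ι] (u : EuclideanSpace ℝ ι) :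
    ‖u‖ ≤ ∑ j, |u j| := by
  rw [EuclideanSpace.norm_eq]
  refine Real.sqrt_le_iff.2 ⟨by positivity, ?_⟩
  exact Finset.sum_sq_le_sq_sum_of_nonneg fun j _ => norm_nonneg (u j)

theorem norm_le_sum_dir_coord (A : E d × E q →L[ℝ] E q) :
    ‖A‖ ≤ ∑ l : (Fin d ⊕ Fin q) × Fin q, |A (dir l.1) l.2| := by
  rw [Fintype.sum_prod_type]
  exact (norm_le_sum_dir A).trans (Finset.sum_le_sum fun k _ => norm_le_sum_coord _)

theorem norm_le_sum_dir_dir_coord (B : E d × E q →L[ℝ] E d × E q →L[ℝ] E q) :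
    ‖B‖ ≤ ∑ l : (Fin d ⊕ Fin q) × (Fin d ⊕ Fin q) × Fin q,
      |B (dir l.1) (dir l.2.1) l.2.2| := by
  rw [Fintype.sum_prod_type]
  exact (norm_le_sum_dir B).trans (Finset.sum_le_sum fun k _ => norm_le_sum_dir_coord _)

/-- `θ ↦ ∂_j^k ψ(θ, s(θ))`. -/
def coord1 (hM : M.Regular) (x : Fin p → ℝ) (s : M.H) (l : (Fin d ⊕ Fin q) × Fin q) : C(M.K, ℝ) :=
  ⟨fun θ => along1 hM x s θ (dir l.1) l.2, by fun_prop⟩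

/-- `θ ↦ ∂_j^{k₁,k₂} ψ(θ, s(θ))`. -/
def coord2 (hM : M.Regular) (x : Fin p → ℝ) (s : M.H)
    (l : (Fin d ⊕ Fin q) × (Fin d ⊕ Fin q) × Fin q) : C(M.K, ℝ) :=
  ⟨fun θ => along2 hM x s θ (dir l.1) (dir l.2.1) l.2.2, by fun_prop⟩

theorem norm_along1_le (hM : M.Regular) (x : Fin p → ℝ) (s : M.H) :
    ‖along1 hM x s‖ ≤ ∑ l, ‖coord1 hM x s l‖ := by
  rw [ContinuousMap.norm_le _ (by positivity)]
  refine fun θ => (norm_le_sum_dir_coord _).trans (Finset.sum_le_sum fun l _ => ?_)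
  exact ContinuousMap.norm_coe_le_norm (coord1 hM x s l) θ

theorem norm_along2_le (hM : M.Regular) (x : Fin p → ℝ) (s : M.H) :
    ‖along2 hM x s‖ ≤ ∑ l, ‖coord2 hM x s l‖ := by
  rw [ContinuousMap.norm_le _ (by positivity)]
  refine fun θ => (norm_le_sum_dir_dir_coord _).trans (Finset.sum_le_sum fun l _ => ?_)
  exact ContinuousMap.norm_coe_le_norm (coord2 hM x s l) θ

theorem measurable_coord1 (hM : M.Regular) {α : Type*} {m : MeasurableSpace α}
    {y : α → Fin p → ℝ} (hy : Measurable y) {s : α → M.H} (hs : Measurable s)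
    (l : (Fin d ⊕ Fin q) × Fin q) : Measurable fun a => coord1 hM (y a) (s a) l :=
  measurable_continuousMap fun θ => (EuclideanSpace.proj (𝕜 := ℝ) l.2).continuous.measurable.comp
    (measurable_along1 hM hy hs θ _)

theorem measurable_coord2 (hM : M.Regular) {α : Type*} {m : MeasurableSpace α}
    {y : α → Fin p → ℝ} (hy : Measurable y) {s : α → M.H} (hs : Measurable s)
    (l : (Fin d ⊕ Fin q) × (Fin d ⊕ Fin q) × Fin q) :
    Measurable fun a => coord2 hM (y a) (s a) l :=
  measurable_continuousMap fun θ =>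
    (EuclideanSpace.proj (𝕜 := ℝ) l.2.2).continuous.measurable.comp
      (measurable_along2 hM hy hs θ _ _)

theorem norm_along1_sub_le (hM : M.Regular) {x : Fin p → ℝ} {C κ : ℝ} (hC : 0 ≤ C) (hκ : 0 ≤ κ)
    (h : ∀ (j : Fin q) (k : Fin d ⊕ Fin q), ∀ u ∈ orthant q, ∀ u' ∈ orthant q, ∀ θ ∈ M.K,
      |M.dpsi x j k θ u - M.dpsi x j k θ u'| ≤ C * ‖u - u'‖ ^ κ) (s s' : M.H) :
    ‖along1 hM x s - along1 hM x s'‖ ≤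
      (Fintype.card ((Fin d ⊕ Fin q) × Fin q) * C) * dist s s' ^ κ := by
  rw [ContinuousMap.norm_le _ (by positivity)]
  intro θ
  refine (norm_le_sum_dir_coord _).trans ?_
  rw [mul_assoc, ← nsmul_eq_mul]
  refine Finset.sum_le_card_nsmul _ _ _ fun l _ => ?_
  have h1 := h l.2 l.1 _ (s θ).2 _ (s' θ).2 θ θ.2
  rw [hM.dpsi_eq _ _ _ θ.2 (s θ).2, hM.dpsi_eq _ _ _ θ.2 (s' θ).2] at h1
  refine h1.trans ?_
  gcongr
  rw [← dist_eq_norm, ← Subtype.dist_eq]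
  exact ContinuousMap.dist_apply_le_dist θ

theorem norm_along2_sub_le (hM : M.Regular) {x : Fin p → ℝ} {C κ : ℝ} (hC : 0 ≤ C) (hκ : 0 ≤ κ)
    (h : ∀ (j : Fin q) (k₁ k₂ : Fin d ⊕ Fin q), ∀ u ∈ orthant q, ∀ u' ∈ orthant q, ∀ θ ∈ M.K,
      |M.ddpsi x j k₁ k₂ θ u - M.ddpsi x j k₁ k₂ θ u'| ≤ C * ‖u - u'‖ ^ κ) (s s' : M.H) :
    ‖along2 hM x s - along2 hM x s'‖ ≤
      (Fintype.card ((Fin d ⊕ Fin q) × (Fin d ⊕ Fin q) × Fin q) * C) * dist s s' ^ κ := by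
  rw [ContinuousMap.norm_le _ (by positivity)]
  intro θ
  refine (norm_le_sum_dir_dir_coord _).trans ?_
  rw [mul_assoc, ← nsmul_eq_mul]
  refine Finset.sum_le_card_nsmul _ _ _ fun l _ => ?_
  have h1 := h l.2.2 l.1 l.2.1 _ (s θ).2 _ (s' θ).2 θ θ.2
  rw [hM.ddpsi_eq _ _ _ _ θ.2 (s θ).2, hM.ddpsi_eq _ _ _ _ θ.2 (s' θ).2] at h1
  refine h1.trans ?_
  gcongr
  rw [← dist_eq_norm, ← Subtype.dist_eq]
  exact ContinuousMap.dist_apply_le_dist θ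

end Family

end CHModel

end

noncomputable section

namespace CHModel

variable {d p q : ℕ} {M : Family d p q} {Ω : Type*} [MeasurableSpace Ω] {P : Measure Ω}

namespace Family

/-! ### The good paths have full measure -/

/-- The distance of h_t to the m-step iterate from ς is at most a Lipschitz coefficient tending to
zero times the distance of h_{t-m} to ς, whose law does not depend on m. So h is a function of the
observations, and (X, h) is jointly stationary. -/
theorem ae_eq_limH [IsProbabilityMeasure P] {X : ℤ → Ω → ℝ} {h : ℤ → Ω → M.H} (hh : IsStationarySolution P M X h)
    {ς : orthant q} {c : ℝ} (hc : ∀ᵐ ω ∂P, Contracting M (fun s => X s ω) c)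
    (hlim : ∀ᵐ ω ∂P, ∀ t, Tendsto (fun n : ℕ => flow (M.sys fun s => X s ω) (t - n) n
      (ContinuousMap.const _ ς)) atTop (𝓝 (M.limH ς (tr t fun s => X s ω)))) :
    ∀ᵐ ω ∂P, ∀ t, h t ω = M.limH ς (tr t fun s => X s ω) := by
  refine ae_all_iff.2 fun t => ?_
  have hlaw : ∀ m : ℕ, P.map (fun ω => dist (h (t - m) ω) (ContinuousMap.const _ ς)) =
      (P.map (h 0)).map fun s => dist s (ContinuousMap.const _ ς) := fun m => by
    rw [← hh.1.map_eq (t - m), Measure.map_map (by fun_prop) (hh.1.1 _)]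
    rfl
  have key := ae_nonpos_of_tight (P := P)
    (Y := fun ω => dist (h t ω) (M.limH ς (tr t fun s => X s ω)))
    (a := fun m ω => M.lipR (fun s => X s ω) (t - m) m)
    (U := fun m ω => dist (h (t - m) ω) (ContinuousMap.const _ ς))
    (b := fun m ω => dist (flow (M.sys fun s => X s ω) (t - m) m (ContinuousMap.const _ ς))
      (M.limH ς (tr t fun s => X s ω)))
    (fun m => (hh.1.1 _).dist measurable_const) (fun m => by rw [hlaw, hlaw])
    (fun m ω => lipR_nonneg _ _ _)
    (hc.mono fun ω hω => hω.bound.tendsto_backward hω.pos (lipR_nonneg _) t)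
    (hlim.mono fun ω hω => tendsto_iff_dist_tendsto_zero.1 (hω t)) (by
      filter_upwards [hc, ae_all_iff.2 hh.2] with ω hω hω' m
      have h1 := flow_orbit (φ := M.sys fun s => X s ω) (y := fun t => h t ω) hω' (t - m) m
      rw [sub_add_cancel] at h1
      rw [← h1]
      exact (dist_triangle _ _ _).trans (add_le_add (dist_le_lipCoeff (hω.finite _ _) _ _) le_rfl))
  exact key.mono fun ω hω => dist_le_zero.1 hω

/-- Once h is a function of the shifted path, a moment condition at time 0 controls the growth at
all times. -/
theorem ae_tempered_norm {μ : Measure (ℤ → ℝ)} [IsProbabilityMeasure μ]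
    (hμ : MeasurePreserving (shift : (ℤ → ℝ) → ℤ → ℝ) μ μ) {X : ℤ → Ω → ℝ}
    (hX : MeasurePreserving (fun ω s => X s ω) P μ) {h : ℤ → Ω → M.H} {ς : orthant q}
    (hlim : ∀ᵐ ω ∂P, ∀ t, h t ω = M.limH ς (tr t fun s => X s ω))
    {F : (Fin p → ℝ) → M.H → C(M.K, ℝ)}
    (hF : Measurable fun x : ℤ → ℝ => F (lags x 0) (M.limH ς x))
    (hlog : meanLogPlus P (fun ω => supNorm (F (lags (fun s => X s ω) 0) (h 0 ω))) < ∞) :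
    ∀ᵐ ω ∂P, Tempered fun t => ‖F (lags (fun s => X s ω) t) (h t ω)‖ := by
  have hw := hF.enorm
  have h1 : meanLogPlus μ (fun x : ℤ → ℝ => ‖F (lags x 0) (M.limH ς x)‖ₑ) < ∞ := by
    rw [← hX.meanLogPlus_comp hw]
    refine lt_of_eq_of_lt (meanLogPlus_congr ?_) hlog
    filter_upwards [hlim] with ω hω
    rw [supNorm_eq_enorm, hω 0, tr_zero]
  filter_upwards [hX.quasiMeasurePreserving.ae (ae_tempered_of_shift hμ hw h1), hlim] with ω hω hω'
  refine hω.2.mono fun t => ?_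
  rw [lags_tr, toReal_enorm, hω']

theorem ae_tempered_ofReal [IsProbabilityMeasure P] {C : ℤ → Ω → ℝ} (hC : IsStationarySeq P C)
    (hlog : meanLogPlus P (fun ω => ENNReal.ofReal (C 0 ω)) < ∞) :
    ∀ᵐ ω ∂P, Tempered fun t => max (C t ω) 0 := by
  refine (ae_tempered (P := P) (W := fun t ω => ENNReal.ofReal (C t ω))
    (fun t => (hC.1 t).ennreal_ofReal.aemeasurable) (fun t => ?_) hlog).mono fun ω hω => ?_
  · have h1 : ∀ t, P.map (fun ω => ENNReal.ofReal (C t ω)) = (P.map (C 0)).map ENNReal.ofReal :=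
      fun t => by
        rw [← hC.map_eq t, Measure.map_map ENNReal.measurable_ofReal (hC.1 t)]
        rfl
    rw [h1, h1]
  · simpa only [ENNReal.toReal_ofReal_eq_iff, ENNReal.toReal_ofReal'] using hω.2

/-- The constants c, κ, κ' are chosen before the path; exponential almost sure convergence requires
such a deterministic rate. -/
theorem ae_goodPath [IsProbabilityMeasure P] (hM : M.Regular) {X : ℤ → Ω → ℝ} (hX : IsStationaryErgodicSeq P X)
    {ς : orthant q} (hD1 : CondD1 P M X ς) {h : ℤ → Ω → M.H} (hh : IsStationarySolution P M X h)
    (hD2 : CondD2 P M X h) (hD3 : CondD3 P M X h) :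
    ∃ c κ κ', ∀ᵐ ω ∂P, GoodPath hM ς (fun s => X s ω) (fun t => h t ω) c κ κ' := by
  set μ := P.map fun ω s => X s ω with hμdef
  have hXm : Measurable fun ω s => X s ω := measurable_pi_lambda _ hX.1
  have hμ : Ergodic (shift : (ℤ → ℝ) → ℤ → ℝ) μ := hX.2
  have hXμ : MeasurePreserving (fun ω s => X s ω) P μ := ⟨hXm, rfl⟩
  have : IsProbabilityMeasure μ := Measure.isProbabilityMeasure_map hXm.aemeasurable
  obtain ⟨r, hr, hneg⟩ := hD1.contr
  have hlm : Measurable fun x : ℤ → ℝ => (lags x 0 : Fin p → ℝ) :=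
    measurable_lags (y := fun s (x : ℤ → ℝ) => x s) fun s _ => measurable_pi_apply s
  have hlip : Measurable fun x : ℤ → ℝ => lipCoeff (M.Phi (lags x 0)) := by
    have h1 := measurable_lipCoeff_flow (M := M) 0 1
    simpa [flow, sys] using h1
  have hcontr : Measurable fun x : ℤ → ℝ => lipCoeff (M.PhiIter x r 0) := by
    simp only [PhiIter_eq_flow]
    exact measurable_lipCoeff_flow _ _
  have hinit : Measurable fun x : ℤ → ℝ => supNorm fun θ : M.K =>
      ((M.Phi (lags x 0) (ContinuousMap.const _ ς) θ : orthant q) : E q) := by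
    have h1 : (fun x : ℤ → ℝ => supNorm fun θ : M.K =>
        ((M.Phi (lags x 0) (ContinuousMap.const _ ς) θ : orthant q) : E q)) =
        fun x => ‖M.val (M.Phi (lags x 0) (ContinuousMap.const _ ς))‖ₑ :=
      funext fun x => supNorm_eq_enorm (M.val (M.Phi (lags x 0) (ContinuousMap.const _ ς)))
    rw [h1]
    exact (measurable_val (measurable_Phi hlm measurable_const)).enorm
  have e1 := hD1.lip
  rw [hXμ.meanLogPlus_comp hlip] at e1
  have e2 := hD1.moment
  rw [hXμ.meanLogPlus_comp hinit] at e2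
  rw [MeanLogNeg, hXμ.meanLogPlus_comp hcontr, hXμ.meanLogMinus_comp hcontr] at hneg
  obtain ⟨c, hc⟩ := ae_contracting hμ e1 hr hneg
  have horb := hXμ.quasiMeasurePreserving.ae (ae_exists_orbit hμ e2 hc)
  replace hc := hXμ.quasiMeasurePreserving.ae hc
  have hlim := ae_eq_limH hh hc (horb.mono fun ω hω => hω.2.2)
  obtain ⟨C₁, κ, hC₁, hC₁log, hκ, hκ1, hol₁⟩ := hD2.holder
  obtain ⟨C₂, κ', hC₂, hC₂log, hκ', hκ1', hol₂⟩ := hD3.holder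
  refine ⟨c, κ, κ', ?_⟩
  have hn1 : ∀ᵐ ω ∂P, ∀ l, Tempered fun t => ‖coord1 hM (lags (fun s => X s ω) t) (h t ω) l‖ := by
    refine ae_all_iff.2 fun l => ae_tempered_norm hμ.toMeasurePreserving hXμ hlim
      (F := fun x s => coord1 hM x s l) (measurable_coord1 hM hlm (measurable_limH ς) l) ?_
    refine lt_of_eq_of_lt (congrArg _ (funext fun ω => congrArg supNorm (funext fun θ => ?_)))
      (hD2.moment l.2 l.1)
    exact (hM.dpsi_eq _ _ _ θ.2 (h 0 ω θ).2).symm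
  have hn2 : ∀ᵐ ω ∂P, ∀ l, Tempered fun t => ‖coord2 hM (lags (fun s => X s ω) t) (h t ω) l‖ := by
    refine ae_all_iff.2 fun l => ae_tempered_norm hμ.toMeasurePreserving hXμ hlim
      (F := fun x s => coord2 hM x s l) (measurable_coord2 hM hlm (measurable_limH ς) l) ?_
    refine lt_of_eq_of_lt (congrArg _ (funext fun ω => congrArg supNorm (funext fun θ => ?_)))
      (hD3.moment l.2.2 l.1 l.2.1)
    exact (hM.ddpsi_eq _ _ _ _ θ.2 (h 0 ω θ).2).symm
  filter_upwards [hc, horb, hlim, hn1, hn2, ae_tempered_ofReal hC₁ hC₁log,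
    ae_tempered_ofReal hC₂ hC₂log, ae_all_iff.2 hol₁, ae_all_iff.2 hol₂, ae_all_iff.2 hh.2]
    with ω hω horbω hlimω hn1ω hn2ω hC₁ω hC₂ω hol₁ω hol₂ω hhω
  exact
    { toContracting := hω
      orbit := hhω
      init := by
        simp only [hlimω]
        exact horbω.2.1
      psi1 := (Tempered.sum hn1ω).mono fun t => norm_along1_le hM _ _
      psi2 := (Tempered.sum hn2ω).mono fun t => norm_along2_le hM _ _
      κ_pos := hκ
      κ_le := hκ1
      κ'_pos := hκ'
      κ'_le := hκ1'
      holder1 := ⟨_, (tempered_const _).mul hC₁ω fun t => le_max_right _ _,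
        fun t => mul_nonneg (Nat.cast_nonneg _) (le_max_right _ _),
        fun t => norm_along1_sub_le hM (le_max_right _ _) hκ.le fun j k u hu u' hu' θ hθ =>
          (hol₁ω t j k u hu u' hu' θ hθ).trans (by gcongr; exact le_max_left _ _)⟩
      holder2 := ⟨_, (tempered_const _).mul hC₂ω fun t => le_max_right _ _,
        fun t => mul_nonneg (Nat.cast_nonneg _) (le_max_right _ _),
        fun t => norm_along2_sub_le hM (le_max_right _ _) hκ'.le fun j k₁ k₂ u hu u' hu' θ hθ =>
          (hol₂ω t j k₁ k₂ u hu u' hu' θ hθ).trans (by gcongr; exact le_max_left _ _)⟩ }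

/-! ### The second derivatives as a function of the observations -/

/-- The limit of the second derivatives of the backward iterates at time `0`. -/
def limSnd (hM : M.Regular) (ς : orthant q) (x : ℤ → ℝ) : M.H2 :=
  limUnder atTop fun n : ℕ => hatSnd hM (tr (-n) x) ς n

/-- The recursion that ends at time 0 reads observations at strictly negative times only, whence
measurability with respect to the strict past. -/
theorem measurable_limSnd (hM : M.Regular) (ς : orthant q) {α : Type*} {m : MeasurableSpace α}
    {y : ℤ → α → ℝ} (hy : ∀ s < 0, Measurable (y s)) :
    Measurable fun a => limSnd hM ς fun s => y s a :=
  (StronglyMeasurable.limUnder fun n : ℕ =>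
    (measurable_hatSnd hM ς (y := fun s a => y (s + -(n : ℤ)) a) n
      fun s hs => hy _ (by omega)).stronglyMeasurable).measurable

/-- `(∂_i^{k₁,k₂} h(θ))`, `i ≤ q`, from the second derivative. -/
def coordsMap (e : C(M.K, W2 d q)) : M.H2 :=
  ⟨fun θ => coords d q (e θ), (coords d q).continuous.comp e.continuous⟩

theorem norm_coordsMap_sub_le (e e' : C(M.K, W2 d q)) :
    ‖coordsMap e - coordsMap e'‖ ≤ ‖coords d q‖ * ‖e - e'‖ := by
  rw [ContinuousMap.norm_le _ (mul_nonneg (norm_nonneg _) (norm_nonneg_map _))]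
  intro θ
  change ‖coords d q (e θ) - coords d q (e' θ)‖ ≤ _
  rw [← map_sub]
  refine ((coords d q).le_opNorm _).trans ?_
  gcongr
  exact norm_sub_apply_le e e' θ

theorem norm_coordsMap_le (e : C(M.K, W2 d q)) : ‖coordsMap e‖ ≤ ‖coords d q‖ * ‖e‖ := by
  rw [ContinuousMap.norm_le _ (mul_nonneg (norm_nonneg _) (norm_nonneg_map _))]
  refine fun θ => ((coords d q).le_opNorm _).trans ?_
  gcongr
  exact ContinuousMap.norm_coe_le_norm e θ

theorem limSnd_eq {hM : M.Regular} {ς : orthant q} {x : ℤ → ℝ} {c : ℝ} (hc : 0 < c)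
    {e : ℤ → C(M.K, W2 d q)}
    (he : ExpBd c fun a n => ‖hHatE hM (fun s => x (s + a)) ς n - e (a + n)‖) (t : ℤ) :
    limSnd hM ς (tr t x) = coordsMap (e t) := by
  refine Tendsto.limUnder_eq (tendsto_iff_norm_sub_tendsto_zero.2 ?_)
  have h1 := (he.tendsto_backward hc (fun _ _ => norm_nonneg_map _) t).const_mul ‖coords d q‖
  rw [mul_zero] at h1
  refine squeeze_zero (fun n => norm_nonneg _) (fun n => ?_) h1
  rw [tr_tr, sub_add_cancel, neg_add_eq_sub]
  exact norm_coordsMap_sub_le (hHatE hM (tr (t - n) x) ς n) (e t)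

theorem col_coordsMap (e : C(M.K, W2 d q)) (θ : M.K) (k₁ k₂ : Fin d) :
    col (coordsMap e θ) k₁ k₂ =
      e θ (EuclideanSpace.single k₁ 1) (EuclideanSpace.single k₂ 1) := by
  ext i
  exact coords_apply (e θ) (i, k₁, k₂)

theorem ddPhi_coordsMap {hM : M.Regular} {x : ℤ → ℝ} {h : ℤ → M.H}
    {D : ℤ → C(M.K, W1 d q)} {e : ℤ → C(M.K, W2 d q)} (hC2 : ∀ t, M.HasC2 (h t) (D t) (e t))
    (he : ∀ t, e (t + 1) = stepE hM (lags x t) (h t) (D t) (e t)) (t : ℤ) (θ : M.K) :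
    coordsMap (e (t + 1)) θ = M.ddPhi (lags x t) (h t) (coordsMap (e t)) θ := by
  ext ⟨j, k₁, k₂⟩
  rw [(hC2 t).ddPhi_apply hM, col_coordsMap, he]
  refine (coords_apply _ _).trans ?_
  rw [stepE_apply, add_apply, add_apply, act2_apply, add_comm]

/-- Two solutions of the equation for the second derivatives approach each other. -/
theorem GoodPath.norm_sub_le {hM : M.Regular} {ς : orthant q} {x : ℤ → ℝ} {h : ℤ → M.H}
    {c κ κ' : ℝ} (hg : GoodPath hM ς x h c κ κ') {D : ℤ → C(M.K, W1 d q)}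
    {b : ℤ → C(M.K, W2 d q)} (hC2 : ∀ t, M.HasC2 (h t) (D t) (b t)) {e e' : ℤ → M.H2}
    (he : ∀ t θ, e (t + 1) θ = M.ddPhi (lags x t) (h t) (e t) θ)
    (he' : ∀ t θ, e' (t + 1) θ = M.ddPhi (lags x t) (h t) (e' t) θ) (a : ℤ) (n : ℕ) :
    ‖e' (a + n) - e (a + n)‖ ≤
      Fintype.card (Fin q × Fin d × Fin d) * (M.lipR x a n * (q * ‖e' a - e a‖)) := by
  -- For fixed k₁, k₂ the inhomogeneities cancel, and the difference is a vector of ℝ^q propagated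
  -- by the Jacobians along `h`. The factor q and the cardinality come from passing between
  -- Euclidean norms and coordinates.
  have hcol : ∀ θ k₁ k₂, ‖col (e' (a + n) θ) k₁ k₂ - col (e (a + n) θ) k₁ k₂‖ ≤
      M.lipR x a n * (q * ‖e' a - e a‖) := by
    intro θ k₁ k₂
    have h1 := (actV q).homogeneous (J := jacs hM x a (h a) θ)
      (δ := fun n => col (e' (a + n) θ) k₁ k₂ - col (e (a + n) θ) k₁ k₂) (fun n => by
        rw [jacs_orbit hM hg.orbit]
        ext j
        have e1 : (a + (n + 1 : ℕ) : ℤ) = a + n + 1 := by push_cast; ring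
        have e2 : col (e' (a + n + 1) θ) k₁ k₂ j - col (e (a + n + 1) θ) k₁ k₂ j =
            (e' (a + n + 1) θ) (j, k₁, k₂) - (e (a + n + 1) θ) (j, k₁, k₂) := rfl
        rw [e1, PiLp.sub_apply, e2, he, he', (hC2 _).ddPhi_apply hM, (hC2 _).ddPhi_apply hM,
          (actV q).act_sub]
        simp only [PiLp.add_apply, PiLp.sub_apply, add_sub_add_left_eq_sub]
        rfl) n
    simp only [Nat.cast_zero, add_zero] at h1
    rw [h1]
    refine ((actV q).norm_le _ _).trans ?_
    gcongr
    · exact lipR_nonneg _ _ _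
    · exact norm_jprod_jacs_le hM x a n (hg.finite a n) _ θ
    · refine (norm_le_sum_coord _).trans ?_
      refine (Finset.sum_le_card_nsmul _ _ ‖e' a - e a‖ fun i _ => ?_).trans (by simp)
      exact (PiLp.norm_apply_le (e' a θ - e a θ) (i, k₁, k₂)).trans (norm_sub_apply_le _ _ θ)
  have h0 : 0 ≤ M.lipR x a n * (q * ‖e' a - e a‖) :=
    mul_nonneg (lipR_nonneg _ _ _) (by positivity)
  rw [ContinuousMap.norm_le _ (by positivity)]
  refine fun θ => (norm_le_sum_coord _).trans ?_
  refine (Finset.sum_le_card_nsmul _ _ _ fun l _ => ?_).trans (nsmul_eq_mul _ _).le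
  exact (PiLp.norm_apply_le (col (e' (a + n) θ) l.2.1 l.2.2 - col (e (a + n) θ) l.2.1 l.2.2)
    l.1).trans (hcol θ _ _)

namespace GoodPath

variable {hM : M.Regular} {ς : orthant q} {x : ℤ → ℝ} {h : ℤ → M.H} {c κ κ' : ℝ}

theorem exists_limSnd (hg : GoodPath hM ς x h c κ κ') :
    ∃ (D : ℤ → C(M.K, W1 d q)) (b : ℤ → C(M.K, W2 d q)),
      (∀ t, M.HasC2 (h t) (D t) (b t)) ∧
      (∀ t, b (t + 1) = stepE hM (lags x t) (h t) (D t) (b t)) ∧ (Tempered fun t => ‖b t‖) ∧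
      (ExpBd (κ * κ' * c / 16) fun a n => ‖hHatE hM (fun s => x (s + a)) ς n - b (a + n)‖) ∧
      ∀ t, limSnd hM ς (tr t x) = coordsMap (b t) := by
  obtain ⟨D, b, h1, h2, h3, h4⟩ := hg.exists_second
  exact ⟨D, b, h1, h2, h3, h4, limSnd_eq (div_pos hg.rate_pos (by norm_num)) h4⟩

theorem limSnd_succ (hg : GoodPath hM ς x h c κ κ') (t : ℤ) (θ : M.K) :
    limSnd hM ς (tr (t + 1) x) θ =
      M.ddPhi (lags x t) (h t) (limSnd hM ς (tr t x)) θ := by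
  obtain ⟨D, b, h1, h2, -, -, h5⟩ := hg.exists_limSnd
  rw [h5, h5]
  exact ddPhi_coordsMap h1 h2 t θ

theorem isC2_and_eq (hg : GoodPath hM ς x h c κ κ') (t : ℤ) :
    M.IsC2 (h t) ∧ ∀ θ : M.K, M.D2 (h t) θ = limSnd hM ς (tr t x) θ := by
  obtain ⟨D, b, h1, -, -, -, h5⟩ := hg.exists_limSnd
  exact ⟨(h1 t).isC2, fun θ => by rw [(h1 t).D2_eq hM, h5]; rfl⟩

theorem tempered_limSnd (hg : GoodPath hM ς x h c κ κ') :
    Tempered fun t => ‖limSnd hM ς (tr t x)‖ := by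
  obtain ⟨D, b, -, -, h3, -, h5⟩ := hg.exists_limSnd
  refine ((tempered_const ‖coords d q‖).mul h3 fun _ => norm_nonneg_map _).mono fun t => ?_
  rw [h5]
  exact norm_coordsMap_le _

theorem tendsto_hHat_sub (hg : GoodPath hM ς x h c κ κ') :
    Tendsto (fun t : ℕ => ENNReal.ofReal (Real.exp (κ * κ' * c / 32) ^ t) *
      supNorm fun θ : M.K => M.D2 (M.hHat x ς t) θ - limSnd hM ς (tr t x) θ) atTop (𝓝 0) := by
  obtain ⟨D, b, -, -, -, h4, h5⟩ := hg.exists_limSnd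
  have hc := hg.rate_pos
  obtain ⟨C, hC0, hC⟩ := h4.bound one_pos
  set N : ℕ → ℝ := fun t => ‖coordsMap (hHatE hM x ς t) - limSnd hM ς (tr t x)‖ with hN
  have hNle : ∀ t, N t ≤ ‖coords d q‖ * (C * Real.exp (-(κ * κ' * c / 16) * t)) := fun t => by
    have h6 := hC 0 t
    simp only [add_zero, zero_add, Int.cast_zero, abs_zero, mul_zero, zero_sub,
      ← neg_mul] at h6
    simp only [hN, h5]
    exact (norm_coordsMap_sub_le _ _).trans (mul_le_mul_of_nonneg_left h6 (norm_nonneg _))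
  -- The weight uses half of the decay rate κκ'c/16, and the other half still tends to zero.
  have hlim0 : Tendsto (fun t : ℕ => Real.exp (κ * κ' * c / 32) ^ t * N t) atTop (𝓝 0) := by
    have h6 : Tendsto (fun t : ℕ => ‖coords d q‖ * C * Real.exp (-(κ * κ' * c / 32)) ^ t)
        atTop (𝓝 (‖coords d q‖ * C * 0)) :=
      (tendsto_pow_atTop_nhds_zero_of_lt_one (Real.exp_pos _).le
        (Real.exp_lt_one_iff.2 (by linarith))).const_mul _
    rw [mul_zero] at h6
    refine squeeze_zero (fun t => mul_nonneg (pow_nonneg (Real.exp_pos _).le _) (norm_nonneg _))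
      (fun t => ?_) h6
    calc _ ≤ Real.exp (κ * κ' * c / 32) ^ t *
          (‖coords d q‖ * (C * Real.exp (-(κ * κ' * c / 16) * t))) :=
          mul_le_mul_of_nonneg_left (hNle t) (pow_nonneg (Real.exp_pos _).le _)
      _ = ‖coords d q‖ * C * (Real.exp (κ * κ' * c / 32) ^ t *
          Real.exp (-(κ * κ' * c / 16) * t)) := by ring
      _ = _ := by
          rw [← Real.exp_nat_mul, ← Real.exp_nat_mul, ← Real.exp_add]
          congr 2
          ring
  have h7 := ENNReal.tendsto_ofReal hlim0
  rw [ENNReal.ofReal_zero] at h7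
  refine h7.congr fun t => ?_
  have h8 : (fun θ : M.K => M.D2 (M.hHat x ς t) θ - limSnd hM ς (tr t x) θ) =
      (coordsMap (hHatE hM x ς t) - limSnd hM ς (tr t x) : M.H2) :=
    funext fun θ => by
      rw [(hasC2_hHat hM _ ς t).D2_eq hM]
      rfl
  rw [h8, supNorm_eq_enorm, ENNReal.ofReal_mul (pow_nonneg (Real.exp_pos _).le _), ofReal_norm]

theorem tendsto_lipR_mul_limSnd (hg : GoodPath hM ς x h c κ κ') (t : ℤ) :
    Tendsto (fun m : ℕ => M.lipR x (t - m) m * ‖limSnd hM ς (tr (t - m) x)‖) atTop (𝓝 0) :=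
  ((hg.bound.mul hg.tempered_limSnd.expBd_start fun _ _ => norm_nonneg _).weaken
    (add_zero c).ge).tendsto_backward hg.pos
      (fun _ _ => mul_nonneg (lipR_nonneg _ _ _) (norm_nonneg _)) t

theorem norm_sub_limSnd_le (hg : GoodPath hM ς x h c κ κ') {e' : ℤ → M.H2}
    (he' : ∀ t θ, e' (t + 1) θ = M.ddPhi (lags x t) (h t) (e' t) θ) (t : ℤ) (m : ℕ) :
    ‖e' t - limSnd hM ς (tr t x)‖ ≤
      Fintype.card (Fin q × Fin d × Fin d) * q * M.lipR x (t - m) m * ‖e' (t - m)‖ +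
      Fintype.card (Fin q × Fin d × Fin d) * q *
        (M.lipR x (t - m) m * ‖limSnd hM ς (tr (t - m) x)‖) := by
  obtain ⟨D, b, h1, -, -, -, -⟩ := hg.exists_limSnd
  have h2 := hg.norm_sub_le h1 (e := fun t => limSnd hM ς (tr t x)) hg.limSnd_succ he' (t - m) m
  simp only [sub_add_cancel] at h2
  refine h2.trans ?_
  calc _ = Fintype.card (Fin q × Fin d × Fin d) * q * M.lipR x (t - m) m *
        ‖e' (t - m) - limSnd hM ς (tr (t - m) x)‖ := by ring
    _ ≤ Fintype.card (Fin q × Fin d × Fin d) * q * M.lipR x (t - m) m *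
        (‖e' (t - m)‖ + ‖limSnd hM ς (tr (t - m) x)‖) :=
      mul_le_mul_of_nonneg_left (_root_.norm_sub_le _ _) (mul_nonneg (by positivity) (lipR_nonneg _ _ _))
    _ = _ := by ring

end GoodPath

/-- Stationarity makes ‖e'_{t-m}‖ tight in m, while the coefficients in front of it and the second
error term vanish almost surely. -/
theorem ae_eq_limSnd [IsProbabilityMeasure P] {hM : M.Regular} {ς : orthant q} {X : ℤ → Ω → ℝ}
    {h : ℤ → Ω → M.H} {c κ κ' : ℝ}
    (hg : ∀ᵐ ω ∂P, GoodPath hM ς (fun s => X s ω) (fun t => h t ω) c κ κ') {e' : ℤ → Ω → M.H2}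
    (he' : IsStationarySeq P e') (hsol : IsSecondOrderSolution P M X h e') (t : ℤ) :
    ∀ᵐ ω ∂P, e' t ω = limSnd hM ς (tr t fun s => X s ω) := by
  have h1 : ∀ s, P.map (fun ω => ‖e' s ω‖) = (P.map (e' 0)).map fun x => ‖x‖ := fun s => by
    rw [← he'.map_eq s, Measure.map_map measurable_norm (he'.1 s)]
    rfl
  set k : ℝ := Fintype.card (Fin q × Fin d × Fin d) * q with hk
  have hk0 : 0 ≤ k := by positivity
  have h2 := ae_nonpos_of_tight (P := P)
    (Y := fun ω => ‖e' t ω - limSnd hM ς (tr t fun s => X s ω)‖)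
    (a := fun m ω => k * M.lipR (fun s => X s ω) (t - m) m)
    (U := fun m ω => ‖e' (t - m) ω‖)
    (b := fun m ω => k * (M.lipR (fun s => X s ω) (t - m) m *
      ‖limSnd hM ς (tr (t - m) fun s => X s ω)‖))
    (fun m => (he'.1 _).norm) (fun m => by rw [h1, h1])
    (fun m ω => mul_nonneg hk0 (lipR_nonneg _ _ _))
    (hg.mono fun ω hω => by
      simpa using (hω.bound.tendsto_backward hω.pos (lipR_nonneg _) t).const_mul k)
    (hg.mono fun ω hω => by simpa using (hω.tendsto_lipR_mul_limSnd t).const_mul k)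
    (by
      filter_upwards [hg, ae_all_iff.2 hsol] with ω hω hs m
      exact hω.norm_sub_limSnd_le (e' := fun t => e' t ω) hs t m)
  exact h2.mono fun ω hω => sub_eq_zero.1 (norm_le_zero_iff.1 hω)

end Family

end CHModel

end

/-! ### The proposition -/

theorem proposition6p2 {d p q : ℕ} {Ω : Type*} [MeasurableSpace Ω] (P : Measure Ω)
    [IsProbabilityMeasure P] (M : Family d p q) (θ₀ : E d) (hθ₀ : θ₀ ∈ M.K)
    (Z X σ : ℤ → Ω → ℝ) (hZ : IsInnovation P Z) (hX : IsUniqueModelSolution P M θ₀ Z X σ)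
    (ς : orthant q) (hD1 : CondD1 P M X ς)
    (h : ℤ → Ω → M.H) (hh : IsStationarySolution P M X h)
    (hD2 : CondD2 P M X h) (hD3 : CondD3 P M X h) :
    (∀ (t : ℕ) (ω : Ω), M.IsC2 (M.hHat (fun s => X s ω) ς t)) ∧
    ∃ e : ℤ → Ω → M.H2,
      IsStationaryErgodicSeq P e ∧
      IsSecondOrderSolution P M X h e ∧
      (∀ e' : ℤ → Ω → M.H2, IsStationarySeq P e' → IsSecondOrderSolution P M X h e' →
        ∀ t, ∀ᵐ ω ∂P, e' t ω = e t ω) ∧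
      (∀ t, Measurable[past Z (t - 1)] (e t)) ∧
      TendstoZeroEAS P (fun t ω => supNorm fun θ : M.K =>
        M.D2 (M.hHat (fun s => X s ω) ς t) θ - e t ω θ) ∧
      ∀ t, ∀ᵐ ω ∂P, M.IsC2 (h t ω) ∧ ∀ θ : M.K, M.D2 (h t ω) θ = e t ω θ := by
  have hM : M.Regular := ⟨hD1.K_reg, hD3.smooth⟩
  have hXe : IsStationaryErgodicSeq P X := by
    have hm : ∀ t, Measurable (X t) := fun t => measurable_fst.comp (hX.1.stat.1 t)
    exact hX.1.stat.map (F := fun x => (x 0).1) (measurable_fst.comp (measurable_pi_apply 0)) hm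
      (ae_of_all _ fun ω t => by simp [tr])
  obtain ⟨c, κ, κ', hgood⟩ := Family.ae_goodPath hM hXe hD1 hh hD2 hD3
  -- A single good path suffices to see that the deterministic rate is positive.
  obtain ⟨ω₀, hω₀⟩ := hgood.exists
  have hc := hω₀.rate_pos
  have hpast : ∀ t, past Z t ≤ ‹MeasurableSpace Ω› := fun t =>
    iSup_le fun k => (hZ.meas k).comap_le
  have hmono : ∀ {s t : ℤ}, s ≤ t → past Z s ≤ past Z t := fun hst =>
    iSup_le fun k => le_iSup_of_le ⟨k.1, k.2.trans hst⟩ le_rfl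
  have hYm : ∀ t, Measurable[past Z t] fun ω => σ t ω * Z t ω := fun t =>
    Measurable.mul ((hX.1.adapted t).mono (hmono (by omega)) le_rfl)
      ((comap_measurable (Z t)).mono (le_iSup_of_le ⟨t, le_rfl⟩ le_rfl) le_rfl)
  have hXY : ∀ᵐ ω ∂P, (fun s => σ s ω * Z s ω) = fun s => X s ω :=
    (ae_all_iff.2 hX.1.eq_X).mono fun ω hω => funext fun t => (hω t).symm
  have hlim : Measurable (Family.limSnd hM ς) :=
    Family.measurable_limSnd hM ς (y := fun s (x : ℤ → ℝ) => x s) fun s _ => measurable_pi_apply s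
  -- X_t equals σ_t Z_t only almost surely, so it need not be measurable with respect to the
  -- uncompleted past. Building e_t from σ_s Z_s, s < t, gives exact measurability and changes it
  -- only on a null set.
  obtain ⟨e, hem, heX⟩ : ∃ e : ℤ → Ω → M.H2, (∀ t, Measurable[past Z (t - 1)] (e t)) ∧
      ∀ᵐ ω ∂P, ∀ t, e t ω = Family.limSnd hM ς (tr t fun s => X s ω) :=
    ⟨fun t ω => Family.limSnd hM ς (tr t fun s => σ s ω * Z s ω), fun t =>
      Family.measurable_limSnd hM ς (m := past Z (t - 1))
        (y := fun s ω => σ (s + t) ω * Z (s + t) ω)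
        fun s hs => (hYm _).mono (hmono (by omega)) le_rfl,
      hXY.mono fun ω hω t => by simp only [hω]⟩
  refine ⟨fun t ω => (Family.hasC2_hHat hM _ ς t).isC2, e,
    hXe.map hlim (fun t => (hem t).mono (hpast _) le_rfl) heX, fun t => ?_,
    fun e' he' hsol t => ?_, hem,
    ⟨Real.exp (κ * κ' * c / 32), Real.one_lt_exp_iff.2 (by linarith), ?_⟩, fun t => ?_⟩
  · filter_upwards [hgood, heX] with ω hω h1 θ
    rw [h1, h1]
    exact hω.limSnd_succ t θ
  · filter_upwards [Family.ae_eq_limSnd hgood he' hsol t, heX] with ω h1 h2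
    rw [h1, h2]
  · filter_upwards [hgood, heX] with ω hω h1
    simp only [h1]
    exact hω.tendsto_hHat_sub
  · filter_upwards [hgood, heX] with ω hω h1
    rw [h1]
    exact hω.isC2_and_eq t
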